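/- **Setting.** Let $G$ be a Lie group with Lie algebra $\mathfrak g$, let $\Gamma\rightrightarrows\Gamma_0$ be a Lie groupoid with target $\alpha$ and source $\beta$, and let $\Gamma_n$ be the manifold of composable strings $(\gamma_1,\dots,\gamma_n)$, $\beta(\gamma_i)=\alpha(\gamma_{i+1})$, with the face maps $\varepsilon_0,\dots,\varepsilon_n:\Gamma_n\to\Gamma_{n-1}$ ($\varepsilon_0$ drops $\gamma_1$, $\varepsilon_n$ drops $\gamma_n$, $\varepsilon_i$ multiplies $\gamma_i\gamma_{i+1}$; for $n=1$, $\varepsilon_0=\beta$, $\varepsilon_1=\alpha$). $H^*_{dR}(\Gamma_\bullet)$ is the cohomology of the total complex $\bigoplus_{n,q}\Omega^q(\Gamma_n)$ with differential $\delta=(-1)^n d+\sum_i(-1)^i\varepsilon_i^*$, and $Z^*_{dR}(\Gamma_\bullet)$ is its space of cocycles. Let $\pi:P\to\Gamma_0$ be a principal $G$-bundle over $\Gamma\rightrightarrows\Gamma_0$, i.e. a right principal $G$-bundle with a left $\Gamma$-action commuting with $G$, and let $Q_n$ be the manifold of composable strings of the transformation groupoid $\Gamma\times_{\beta,\Gamma_0,\pi}P\rightrightarrows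 P$, with the vertex maps $p_0,\dots,p_n:Q_n\to P$. For a connection form $\theta\in\Omega^1(P)\otimes\mathfrak g$ on $P\to\Gamma_0$ put $\tilde\theta_n=\sum_{i=0}^n t_i\,p_i^*\theta$ on $\Delta_n\times Q_n$ and $\tilde\Omega_n=d\tilde\theta_n+\tfrac12[\tilde\theta_n,\tilde\theta_n]$. For $f\in S^k(\mathfrak g^*)^G$ the form $f(\tilde\Omega_n)$ is the pull-back of a unique form on $\Delta_n\times\Gamma_n$; $z_\theta(f)\in\bigoplus_n\Omega^{2k-n}(\Gamma_n)$ is the sum over $n$ of its integrals over the fibres $\Delta_n$. It is a cocycle, and $w_\theta(f)\in H^{2k}_{dR}(\Gamma_\bullet)$ is its class, which is independent of $\theta$ and denoted by $w_P(f)$. This defines, by additivity, $z_\theta:S(\mathfrak g^*)^G\to Z^*_{dR}(\Gamma_\bullet)$ and $w_P:S(\mathfrak g^*)^G\to H^*_{dR}(\Gamma_\bullet)$. **Theorem.** 1. Let $\Gamma=M\rightrightarrows M$ be a manifold, with only unit arrows, and let $P\to M$ be a principal $G$-bundle over it. The inclusion $\Omega^*(M)=\Omega^*(\Gamma_0)\to\bigoplus\Omega^q(\Gamma_n)$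 maps closed forms to cocycles and induces an isomorphism $\Phi:H^*_{dR}(M)\to H^*_{dR}(M_\bullet)$, and under it $w_P$ is the classical Chern–Weil map: $w_\theta(f)=\Phi([c_{\theta'}(f)])$ for all connections $\theta,\theta'$ on $P\to M$ and all $f\in S(\mathfrak g^*)^G$, where, for $f$ homogeneous, $c_{\theta'}(f)$ is the unique form on $M$ whose pull-back to $P$ is $f(\Omega')$, $\Omega'=d\theta'+\tfrac12[\theta',\theta']$ (it is closed). 2. Let $\Gamma=G\rightrightarrows\cdot$ be a Lie group, let $P$ be the principal $G$-bundle $G\to\cdot$ over it (both actions by multiplication), and let $\theta$ be the left Maurer–Cartan form of $G$. Then $\theta$ is a connection form on $P$, and $$z_\theta:S(\mathfrak g^*)^G\to Z^*_{dR}(G_\bullet),\qquad w_P:S(\mathfrak g^*)^G\to H^*_{dR}(G_\bullet)$$ coincide with the Bott–Shulman maps. The latter are defined as follows: on $\Delta_n\times G^{n+1}$ take the connection $\sum_i t_i\,\mathrm{pr}_i^*\theta$ with curvature $F_n$; for $f\in S^k(\mathfrak g^*)^G$ the form $f(F_n)$ is the pull-back, along $G^{n+1}\to G^n$, $(g_0,\dots,g_n)\mapsto(g_0g_1^{-1},\dots,g_{n-1}g_n^{-1})$,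 of a unique form on $\Delta_n\times G^n$; the Bott–Shulman cochain of $f$ is the sum over $n$ of the integrals of these forms over $\Delta_n$, and the Bott–Shulman class is its cohomology class. -/

import Mathlib

open scoped Manifold ContDiff Topology

noncomputable section

open MeasureTheory

namespace ChernWeil

/-- Euclidean space `ℝⁿ`. -/
abbrev EE (n : ℕ) : Type := EuclideanSpace ℝ (Fin n)

section Diffeologies

variable {X Y : Type*}

/-- The diffeology induced on `X` by a map `f : X → Y`: a map into `X` is a plot iff its composition
with `f` is one. -/
def inducedD (f : X → Y) (D : DiffeologicalSpace Y) : DiffeologicalSpace X where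
  plots n := {p | f ∘ p ∈ D.plots n}
  constant_plots x := D.constant_plots (f x)
  plot_reparam hp hf := D.plot_reparam hp hf
  locality {n p} h := D.locality fun x => by
    obtain ⟨u, hu, hx, H⟩ := h x
    exact ⟨u, hu, hx, fun {m f'} h1 h2 => H h1 h2⟩

/-- The product of two diffeological spaces. -/
def prodD (D : DiffeologicalSpace X) (D' : DiffeologicalSpace Y) : DiffeologicalSpace (X × Y) :=
  inducedD Prod.fst D ⊓ inducedD Prod.snd D'

/-- A power of a diffeological space. -/
def piD (ι : Type*) (D : DiffeologicalSpace X) : DiffeologicalSpace (ι → X) :=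
  ⨅ i, inducedD (fun x => x i) D

theorem mem_plots_inf {D D' : DiffeologicalSpace X} {n : ℕ} {p : EE n → X} :
    p ∈ (D ⊓ D').plots n ↔ p ∈ D.plots n ∧ p ∈ D'.plots n :=
  DiffeologicalSpace.isPlot_inf_iff

theorem mem_plots_iInf {ι : Type*} {D : ι → DiffeologicalSpace X} {n : ℕ} {p : EE n → X} :
    p ∈ (⨅ i, D i).plots n ↔ ∀ i, p ∈ (D i).plots n :=
  DiffeologicalSpace.isPlot_iInf_iff

theorem mem_plots_prodD {D : DiffeologicalSpace X} {D' : DiffeologicalSpace Y} {n : ℕ}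
    {p : EE n → X × Y} : p ∈ (prodD D D').plots n ↔
      (fun x => (p x).1) ∈ D.plots n ∧ (fun x => (p x).2) ∈ D'.plots n :=
  mem_plots_inf

theorem mem_plots_piD {ι : Type*} {D : DiffeologicalSpace X} {n : ℕ} {p : EE n → ι → X} :
    p ∈ (piD ι D).plots n ↔ ∀ i, (fun x => p x i) ∈ D.plots n :=
  mem_plots_iInf

/-- The diffeology of a smooth manifold: the plots are the smooth maps `ℝⁿ → M`. -/
def mfdD (E : Type*) [NormedAddCommGroup E] [NormedSpace ℝ E] (M : Type*) [TopologicalSpace M]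
    [ChartedSpace E M] : DiffeologicalSpace M where
  plots n := {p : EE n → M | ContMDiff 𝓘(ℝ, EE n) 𝓘(ℝ, E) ∞ p}
  constant_plots _ := contMDiff_const
  plot_reparam hp hf := ContMDiff.comp hp hf.contMDiff
  locality {n p} h := by
    intro x
    obtain ⟨u, hu, hx, H⟩ := h x
    obtain ⟨ε, hε, hε'⟩ := Metric.isOpen_iff.mp hu x hx
    have h1 : ContMDiff 𝓘(ℝ, EE n) 𝓘(ℝ, E) ∞ (p ∘ OpenPartialHomeomorph.univBall x ε) := by
      refine H (f := OpenPartialHomeomorph.univBall x ε) (fun y => hε' ?_)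
        OpenPartialHomeomorph.contDiff_univBall
      have := (OpenPartialHomeomorph.univBall x ε).map_source (x := y)
      rw [OpenPartialHomeomorph.univBall_target x hε] at this
      exact this (by simp)
    have h2 : ContMDiffAt 𝓘(ℝ, EE n) 𝓘(ℝ, EE n) ∞ (OpenPartialHomeomorph.univBall x ε).symm x :=
      ((OpenPartialHomeomorph.contDiffOn_univBall_symm (c := x) (r := ε)).contDiffAt
        (Metric.ball_mem_nhds x hε)).contMDiffAt
    have h3 := (h1.contMDiffAt).comp x h2
    refine h3.congr_of_eventuallyEq ?_
    filter_upwards [Metric.ball_mem_nhds x hε] with y hy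
    have hy' : y ∈ (OpenPartialHomeomorph.univBall x ε).target := by
      rwa [OpenPartialHomeomorph.univBall_target x hε]
    simp [(OpenPartialHomeomorph.univBall x ε).right_inv hy']

/-- Smooth maps between diffeological spaces. -/
abbrev Smooth (D : DiffeologicalSpace X) (D' : DiffeologicalSpace Y) (f : X → Y) : Prop :=
  @Diffeology.DSmooth X Y D D' f

theorem smooth_of_contMDiff {E E' : Type*} [NormedAddCommGroup E] [NormedSpace ℝ E]
    [NormedAddCommGroup E'] [NormedSpace ℝ E'] [TopologicalSpace X] [ChartedSpace E X]
    [TopologicalSpace Y] [ChartedSpace E' Y] {f : X → Y}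
    (hf : ContMDiff 𝓘(ℝ, E) 𝓘(ℝ, E') ∞ f) : Smooth (mfdD E X) (mfdD E' Y) f :=
  fun _ _ hp => ContMDiff.comp hf hp

theorem smooth_prodMap {X' Y' : Type*} {D₁ : DiffeologicalSpace X} {D₁' : DiffeologicalSpace X'}
    {D₂ : DiffeologicalSpace Y} {D₂' : DiffeologicalSpace Y'} {f : X → Y} {g : X' → Y'}
    (hf : Smooth D₁ D₂ f) (hg : Smooth D₁' D₂' g) :
    Smooth (prodD D₁ D₁') (prodD D₂ D₂') (Prod.map f g) := fun n _ hp =>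
  mem_plots_prodD.2 ⟨hf n _ (mem_plots_prodD.1 hp).1, hg n _ (mem_plots_prodD.1 hp).2⟩

theorem smooth_id (D : DiffeologicalSpace X) : Smooth D D id := fun _ _ hp => hp

theorem smooth_fst (D : DiffeologicalSpace X) (D' : DiffeologicalSpace Y) :
    Smooth (prodD D D') D Prod.fst := fun _ _ hp => (mem_plots_prodD.1 hp).1

theorem smooth_snd (D : DiffeologicalSpace X) (D' : DiffeologicalSpace Y) :
    Smooth (prodD D D') D' Prod.snd := fun _ _ hp => (mem_plots_prodD.1 hp).2

theorem smooth_eval {ι : Type*} (D : DiffeologicalSpace X) (i : ι) :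
    Smooth (piD ι D) D (fun x => x i) := fun _ _ hp => mem_plots_piD.1 hp i

end Diffeologies

section Alternating

variable {W V : Type*} [NormedAddCommGroup W] [NormedSpace ℝ W] [FiniteDimensional ℝ W]
  [NormedAddCommGroup V] [NormedSpace ℝ V] [FiniteDimensional ℝ V] {k : ℕ}

instance finiteDimensional_alternating : FiniteDimensional ℝ (W [⋀^Fin k]→L[ℝ] V) := by
  let L : (W [⋀^Fin k]→L[ℝ] V) →ₗ[ℝ] MultilinearMap ℝ (fun _ : Fin k => W) V :=
    { toFun := fun f => f.toMultilinearMap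
      map_add' := fun _ _ => rfl
      map_smul' := fun _ _ => rfl }
  refine FiniteDimensional.of_injective L fun f g h => ?_
  ext v
  exact DFunLike.congr_fun h v

theorem continuous_multilinear (f : MultilinearMap ℝ (fun _ : Fin k => W) V) : Continuous f := by
  let b := Module.finBasis ℝ W
  have h : ∀ v : Fin k → W, f v = ∑ s : Fin k → Fin (Module.finrank ℝ W),
      (∏ i, b.repr (v i) (s i)) • f (fun i => b (s i)) := by
    intro v
    have h0 : v = fun i => ∑ j, b.repr (v i) j • b j :=
      funext fun i => (b.sum_repr (v i)).symm
    have h1 := f.map_sum (fun i j => b.repr (v i) j • b j)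
    refine ((congrArg f h0).trans h1).trans (Finset.sum_congr rfl fun s _ => ?_)
    exact f.map_smul_univ (fun i => b.repr (v i) (s i)) fun i => b (s i)
  have hc : ∀ j, Continuous fun w : W => b.repr w j := fun j =>
    (b.coord j).continuous_of_finiteDimensional
  change Continuous fun v => f v
  rw [funext h]
  exact continuous_finsetSum _ fun s _ => (continuous_finsetProd _ fun i _ =>
    (hc (s i)).comp (continuous_apply i)).smul continuous_const

/-- An alternating map on a finite-dimensional space is continuous. -/
def contAlt (f : W [⋀^Fin k]→ₗ[ℝ] V) : W [⋀^Fin k]→L[ℝ] V :=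
  { f with cont := continuous_multilinear f.toMultilinearMap }

theorem contDiff_alternating_iff {W' : Type*} [NormedAddCommGroup W'] [NormedSpace ℝ W']
    {F : W' → W [⋀^Fin k]→L[ℝ] V} :
    ContDiff ℝ ∞ F ↔ ∀ v : Fin k → W, ContDiff ℝ ∞ (fun x => F x v) := by
  constructor
  · intro h v
    have hL : ContDiff ℝ ∞ (fun f : W [⋀^Fin k]→L[ℝ] V => f v) :=
      (LinearMap.toContinuousLinearMap
        ({ toFun := fun f => f v, map_add' := fun _ _ => rfl, map_smul' := fun _ _ => rfl } :
          (W [⋀^Fin k]→L[ℝ] V) →ₗ[ℝ] V)).contDiff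
    exact hL.comp h
  · intro h
    let b := Module.finBasis ℝ W
    let L : (W [⋀^Fin k]→L[ℝ] V) →ₗ[ℝ] ((Fin k → Fin (Module.finrank ℝ W)) → V) :=
      { toFun := fun f s => f (fun i => b (s i))
        map_add' := fun _ _ => rfl
        map_smul' := fun _ _ => rfl }
    have hL : LinearMap.ker L = ⊥ := by
      rw [LinearMap.ker_eq_bot]
      intro f g hfg
      have : f.toMultilinearMap = g.toMultilinearMap :=
        Module.Basis.ext_multilinear (fun _ => b) fun s => congrFun hfg s
      ext v
      exact DFunLike.congr_fun this v
    obtain ⟨R, hR⟩ := L.exists_leftInverse_of_injective hL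
    have hF : F = fun x => LinearMap.toContinuousLinearMap R (L (F x)) := by
      funext x
      exact (LinearMap.congr_fun hR (F x)).symm
    rw [hF]
    exact (LinearMap.toContinuousLinearMap R).contDiff.comp
      (contDiff_pi.2 fun s => h fun i => b (s i))

end Alternating

section Forms

variable {X Y : Type*} {D : DiffeologicalSpace X} {D' : DiffeologicalSpace Y} {k : ℕ}
  {V : Type*} [NormedAddCommGroup V] [NormedSpace ℝ V]

/-- A family `w` of alternating-form-valued functions, indexed by the plots `p : ℝⁿ → X` and to be
thought of as the family of pull-backs `p^* w`, is a smooth differential form if each `p^* w` is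
smooth, and `(p ∘ f)^* w = f^* (p^* w)` for all smooth maps `f : ℝᵐ → ℝⁿ`. -/
structure IsForm (D : DiffeologicalSpace X)
    (w : ∀ n, D.plots n → EE n → (EE n) [⋀^Fin k]→L[ℝ] V) : Prop where
  smooth : ∀ n p, ContDiff ℝ ∞ (w n p)
  compat : ∀ (m n : ℕ) (p : D.plots n) (f : EE m → EE n) (hf : ContDiff ℝ ∞ f) (x : EE m),
    w m ⟨p.1 ∘ f, D.plot_reparam p.2 hf⟩ x =
      (w n p (f x)).compContinuousLinearMap (fderiv ℝ f x)

/-- The smooth differential forms, as a subspace of the space of all families. -/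
def formSubmodule (D : DiffeologicalSpace X) (k : ℕ) (V : Type*) [NormedAddCommGroup V]
    [NormedSpace ℝ V] : Submodule ℝ (∀ n, D.plots n → EE n → (EE n) [⋀^Fin k]→L[ℝ] V) where
  carrier := {w | IsForm D w}
  add_mem' ha hb := ⟨fun n p => (ha.smooth n p).add (hb.smooth n p), fun m n p f hf x => by
    simp only [Pi.add_apply, ha.compat m n p f hf x, hb.compat m n p f hf x]; rfl⟩
  zero_mem' := ⟨fun _ _ => contDiff_const, fun _ _ _ _ _ _ => rfl⟩
  smul_mem' c w h := ⟨fun n p => (h.smooth n p).const_smul c, fun m n p f hf x => by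
    simp only [Pi.smul_apply, h.compat m n p f hf x]; rfl⟩

/-- The space of smooth differential `k`-forms with values in `V` on a diffeological space.
On a smooth manifold these are the usual differential forms: a form is given by its
representatives in all smooth parametrizations. -/
def Form (D : DiffeologicalSpace X) (k : ℕ) (V : Type*) [NormedAddCommGroup V]
    [NormedSpace ℝ V] : Type _ := formSubmodule D k V

instance instAddCommGroupForm : AddCommGroup (Form D k V) :=
  inferInstanceAs (AddCommGroup (formSubmodule D k V))

instance instModuleForm : Module ℝ (Form D k V) := inferInstanceAs (Module ℝ (formSubmodule D k V))

theorem form_smooth (w : Form D k V) (n : ℕ) (p : D.plots n) : ContDiff ℝ ∞ (w.1 n p) :=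
  IsForm.smooth w.2 n p

theorem form_compat (w : Form D k V) {m n : ℕ} (p : D.plots n) {f : EE m → EE n}
    (hf : ContDiff ℝ ∞ f) (x : EE m) : w.1 m ⟨p.1 ∘ f, D.plot_reparam p.2 hf⟩ x =
      (w.1 n p (f x)).compContinuousLinearMap (fderiv ℝ f x) :=
  IsForm.compat w.2 m n p f hf x

/-- The pull-back of differential forms along a smooth map. -/
def pullback (f : X → Y) (hf : Smooth D D' f) : Form D' k V →ₗ[ℝ] Form D k V where
  toFun w := ⟨fun n p => w.1 n ⟨f ∘ p.1, hf n p.1 p.2⟩, IsForm.mk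
    (fun n _ => form_smooth w n _)
    (fun _ n p _ hg x => form_compat w (⟨f ∘ p.1, hf n p.1 p.2⟩ : D'.plots n) hg x)⟩
  map_add' _ _ := rfl
  map_smul' _ _ := rfl

/-- The exterior derivative. -/
def extD : Form D k V →ₗ[ℝ] Form D (k + 1) V where
  toFun w := ⟨fun n p => extDeriv (w.1 n p), IsForm.mk
    (fun n p => by
      have h1 : ContDiff ℝ ∞ (fderiv ℝ (w.1 n p)) := (form_smooth w n p).fderiv_right (by simp)
      have h2 : ContDiff ℝ ∞ (fun g : EE n →L[ℝ] EE n [⋀^Fin k]→L[ℝ] V =>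
          ContinuousAlternatingMap.alternatizeUncurryFinCLM ℝ (EE n) V g) :=
        ContinuousLinearMap.contDiff (𝕜 := ℝ) _
      exact h2.comp h1)
    (fun m n p f hf x => by
      have h := extDeriv_pullback (x := x) ((form_smooth w n p).differentiable (by simp) (f x))
        (hf.contDiffAt) (by rw [minSmoothness_of_isRCLikeNormedField]; exact ENat.LEInfty.out)
      rw [← h]
      congr 1
      funext y
      exact form_compat w p hf y)⟩
  map_add' w w' := by
    apply Subtype.ext
    funext n p x
    exact extDeriv_add ((form_smooth w n p).differentiable (by simp) x)
      ((form_smooth w' n p).differentiable (by simp) x)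
  map_smul' c w := by
    apply Subtype.ext
    funext n p x
    exact extDeriv_smul c _

/-- The product of a form with a smooth function. -/
def fnMul (h : X → ℝ) (hh : Smooth D (mfdD ℝ ℝ) h) (w : Form D k V) : Form D k V :=
  ⟨fun n p x => h (p.1 x) • w.1 n p x, IsForm.mk
    (fun n p => (contMDiff_iff_contDiff.1 (hh n p.1 p.2)).smul (form_smooth w n p))
    (fun m n p f hf x => by simp only [Function.comp, form_compat w p hf x]; rfl)⟩

end Forms

section FibreIntegration

theorem contDiff_setIntegral {n m : ℕ} {K : Set (EE n)} (hK : IsCompact K) (N : ℕ) :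
    ∀ {V : Type*} [NormedAddCommGroup V] [NormedSpace ℝ V] [CompleteSpace V]
      {F : EE n × EE m → V} (_ : ContDiff ℝ ∞ F),
      ContDiff ℝ N (fun x => ∫ t in K, F (t, x)) := by
  have hmain : ∀ {V : Type _} [NormedAddCommGroup V] [NormedSpace ℝ V] [CompleteSpace V]
      {F : EE n × EE m → V} (_ : ContDiff ℝ ∞ F) (x : EE m),
      HasFDerivAt (fun x => ∫ t in K, F (t, x))
        (∫ t in K, (fderiv ℝ F (t, x)).comp (ContinuousLinearMap.inr ℝ (EE n) (EE m))) x := by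
    intro V _ _ _ F hF x
    have hF' : Continuous fun z : EE n × EE m =>
        (fderiv ℝ F z).comp (ContinuousLinearMap.inr ℝ (EE n) (EE m)) :=
      (hF.continuous_fderiv (by simp)).clm_comp continuous_const
    obtain ⟨C, hC⟩ := (hK.prod (isCompact_closedBall x 1)).exists_bound_of_continuousOn
      hF'.continuousOn
    refine hasFDerivAt_integral_of_dominated_of_fderiv_le (bound := fun _ => C)
      (F' := fun x t => (fderiv ℝ F (t, x)).comp (ContinuousLinearMap.inr ℝ (EE n) (EE m)))
      (Metric.closedBall_mem_nhds x one_pos) ?_ ?_ ?_ ?_ ?_ ?_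
    · exact Filter.Eventually.of_forall fun y =>
        (hF.continuous.comp (Continuous.prodMk_left y)).aestronglyMeasurable
    · exact ((hF.continuous.comp (Continuous.prodMk_left x)).continuousOn).integrableOn_compact hK
    · have : SecondCountableTopologyEither (EE n) (EE m →L[ℝ] V) := ⟨Or.inl inferInstance⟩
      exact (hF'.comp (Continuous.prodMk_left x)).aestronglyMeasurable
    · refine (ae_restrict_iff' hK.measurableSet).2 (Filter.Eventually.of_forall fun t ht y hy => ?_)
      exact hC (t, y) ⟨ht, hy⟩
    · exact continuousOn_const.integrableOn_compact hK
    · refine Filter.Eventually.of_forall fun t y _ => ?_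
      have h1 := (hF.differentiable (by simp) (t, y)).hasFDerivAt
      exact h1.comp y (hasFDerivAt_prodMk_right t y)
  induction N with
  | zero =>
    intro V _ _ _ F hF
    rw [Nat.cast_zero, contDiff_zero]
    exact continuous_iff_continuousAt.2 fun x => (hmain hF x).continuousAt
  | succ N ih =>
    intro V _ _ _ F hF
    rw [Nat.cast_succ, contDiff_succ_iff_fderiv]
    refine ⟨fun x => (hmain hF x).differentiableAt, by simp, ?_⟩
    have h2 : ContDiff ℝ ∞ fun z : EE n × EE m =>
        (fderiv ℝ F z).comp (ContinuousLinearMap.inr ℝ (EE n) (EE m)) :=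
      (hF.fderiv_right (m := ∞) (by simp)).clm_comp contDiff_const
    have h3 : fderiv ℝ (fun x => ∫ t in K, F (t, x)) = fun x =>
        ∫ t in K, (fderiv ℝ F (t, x)).comp (ContinuousLinearMap.inr ℝ (EE n) (EE m)) :=
      funext fun x => (hmain hF x).fderiv
    rw [h3]
    exact ih h2

variable {X : Type*} {V : Type*} [NormedAddCommGroup V] [NormedSpace ℝ V] [FiniteDimensional ℝ V]

/-- The standard `n`-simplex, in the coordinates `t₁, …, tₙ` (so that `t₀ = 1 - ∑ tᵢ`). -/
def simplex (n : ℕ) : Set (EE n) := {t | (∀ i, 0 ≤ t i) ∧ ∑ i, t i ≤ 1}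

theorem isCompact_simplex (n : ℕ) : IsCompact (simplex n) := by
  have hc : ∀ i, Continuous fun t : EE n => t i := fun i =>
    (EuclideanSpace.proj (𝕜 := ℝ) i).continuous
  have h0 : IsCompact ((EuclideanSpace.equiv (Fin n) ℝ).symm '' Set.Icc 0 1) :=
    isCompact_Icc.image (EuclideanSpace.equiv (Fin n) ℝ).symm.continuous
  refine h0.of_isClosed_subset ?_ fun t ht => ⟨EuclideanSpace.equiv (Fin n) ℝ t, ⟨?_, ?_⟩, by simp⟩
  · rw [show simplex n = (⋂ i, {t : EE n | 0 ≤ t i}) ∩ {t | ∑ i, t i ≤ 1} by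
      ext t; simp [simplex]]
    exact (isClosed_iInter fun i => isClosed_le continuous_const (hc i)).inter
      (isClosed_le (continuous_finsetSum _ fun i _ => hc i) continuous_const)
  · exact fun i => ht.1 i
  · exact fun i => (Finset.single_le_sum (fun j _ => ht.1 j) (Finset.mem_univ i)).trans ht.2

/-- The splitting `ℝⁿ⁺ᵐ = ℝⁿ × ℝᵐ`. -/
def splitE (n m : ℕ) : EE (n + m) ≃L[ℝ] EE n × EE m := EuclideanSpace.finAddEquivProd

/-- The plot `id × p : ℝⁿ × ℝᵐ → ℝⁿ × X` for a plot `p : ℝᵐ → X`. -/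
def idProd (n : ℕ) {m : ℕ} (p : EE m → X) : EE (n + m) → EE n × X :=
  fun z => ((splitE n m z).1, p (splitE n m z).2)

theorem idProd_mem (D : DiffeologicalSpace X) (n : ℕ) {m : ℕ} (p : D.plots m) :
    idProd n p.1 ∈ (prodD (mfdD (EE n) (EE n)) D).plots (n + m) :=
  mem_plots_prodD.2 ⟨(contDiff_fst.comp (splitE n m).contDiff).contMDiff,
    D.plot_reparam p.2 (contDiff_snd.comp (splitE n m).contDiff)⟩

theorem update_frame {n q m : ℕ} {_ : DecidableEq (Fin q)} (v : Fin q → EE m) (i : Fin q)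
    (z : EE m) :
    Fin.append (fun i : Fin n => (splitE n m).symm (EuclideanSpace.single i 1, 0))
        (fun j => (splitE n m).symm (0, Function.update v i z j)) =
      Function.update (Fin.append
        (fun i : Fin n => (splitE n m).symm (EuclideanSpace.single i 1, 0))
        (fun j => (splitE n m).symm (0, v j))) (Fin.natAdd n i) ((splitE n m).symm (0, z)) := by
  funext l
  refine Fin.addCases (fun j => ?_) (fun j => ?_) l
  · have : Fin.castAdd q j ≠ Fin.natAdd n i := by
      intro h
      have := congrArg Fin.val h
      simp at this
      omega
    simp [Function.update_of_ne this]
  · by_cases hj : j = i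
    · subst hj
      simp
    · have : Fin.natAdd n j ≠ Fin.natAdd n i := by simpa using hj
      simp [Function.update_of_ne this, Function.update_of_ne hj]

/-- The alternating map `v ↦ g (∂₁, …, ∂ₙ, v₁, …, v_q)` on `ℝᵐ`, where `∂₁, …, ∂ₙ` are the
coordinate vectors of the first factor of `ℝⁿ × ℝᵐ`. -/
def insertFrame (n q m : ℕ) (g : (EE (n + m)) [⋀^Fin (n + q)]→L[ℝ] V) :
    (EE m) [⋀^Fin q]→L[ℝ] V :=
  contAlt
    { toFun := fun v => g (Fin.append
        (fun i => (splitE n m).symm (EuclideanSpace.single i 1, 0))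
        (fun j => (splitE n m).symm (0, v j)))
      map_update_add' := by
        intro _ v i x y
        rw [update_frame, update_frame, update_frame, ← g.map_update_add, ← map_add]
        simp
      map_update_smul' := by
        intro _ v i c x
        rw [update_frame, update_frame, ← g.map_update_smul, ← map_smul]
        simp
      map_eq_zero_of_eq' := by
        intro v i j h hij
        refine g.map_eq_zero_of_eq _ (i := Fin.natAdd n i) (j := Fin.natAdd n j) ?_ ?_
        · simp [h]
        · simpa using hij }

theorem insertFrame_comp {n q m m' : ℕ} (g : (EE (n + m)) [⋀^Fin (n + q)]→L[ℝ] V)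
    (A : EE m' →L[ℝ] EE m) (B : EE (n + m') →L[ℝ] EE (n + m))
    (hB : ∀ t x, B ((splitE n m').symm (t, x)) = (splitE n m).symm (t, A x)) :
    insertFrame n q m' (g.compContinuousLinearMap B) =
      (insertFrame n q m g).compContinuousLinearMap A := by
  ext v
  change g (B ∘ Fin.append _ _) = g (Fin.append _ _)
  congr 1
  funext i
  refine Fin.addCases (fun j => ?_) (fun j => ?_) i
  · simp [hB]
  · simp [hB]

theorem contDiff_insertFrame {D : DiffeologicalSpace X} {n q m : ℕ}
    (w : Form (prodD (mfdD (EE n) (EE n)) D) (n + q) V) (p : D.plots m) :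
    ContDiff ℝ ∞ fun z : EE n × EE m => insertFrame n q m
      (w.1 (n + m) ⟨idProd n p.1, idProd_mem D n p⟩ ((splitE n m).symm z)) := by
  refine contDiff_alternating_iff.2 fun v => ?_
  exact (contDiff_alternating_iff.1 (form_smooth w _ _) _).comp (splitE n m).symm.contDiff

theorem insertFrame_pullback {D : DiffeologicalSpace X} {n q m m' : ℕ}
    (w : Form (prodD (mfdD (EE n) (EE n)) D) (n + q) V) (p : D.plots m) {f : EE m' → EE m}
    (hf : ContDiff ℝ ∞ f) (t : EE n) (x : EE m') :
    insertFrame n q m' (w.1 (n + m') ⟨idProd n (p.1 ∘ f),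
        idProd_mem D n ⟨p.1 ∘ f, D.plot_reparam p.2 hf⟩⟩ ((splitE n m').symm (t, x))) =
      (insertFrame n q m (w.1 (n + m) ⟨idProd n p.1, idProd_mem D n p⟩
        ((splitE n m).symm (t, f x)))).compContinuousLinearMap (fderiv ℝ f x) := by
  let F : EE (n + m') → EE (n + m) := fun z =>
    (splitE n m).symm ((splitE n m' z).1, f (splitE n m' z).2)
  have hF : ContDiff ℝ ∞ F := (splitE n m).symm.contDiff.comp
    ((contDiff_fst.comp (splitE n m').contDiff).prodMk
      (hf.comp (contDiff_snd.comp (splitE n m').contDiff)))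
  have hp : idProd n (p.1 ∘ f) = idProd n p.1 ∘ F := by
    funext z
    simp [idProd, F]
  have h := form_compat w ⟨idProd n p.1, idProd_mem D n p⟩ hF ((splitE n m').symm (t, x))
  have hx : F ((splitE n m').symm (t, x)) = (splitE n m).symm (t, f x) := by simp [F]
  simp only [hp]
  rw [h, hx]
  refine insertFrame_comp _ _ _ fun s y => ?_
  have hd : HasFDerivAt F ((splitE n m).symm.toContinuousLinearMap.comp
      (((ContinuousLinearMap.fst ℝ _ _).comp (splitE n m').toContinuousLinearMap).prod
        ((fderiv ℝ f x).comp ((ContinuousLinearMap.snd ℝ _ _).comp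
          (splitE n m').toContinuousLinearMap)))) ((splitE n m').symm (t, x)) := by
    refine (splitE n m).symm.hasFDerivAt.comp _ (HasFDerivAt.prodMk ?_ ?_)
    · exact ((ContinuousLinearMap.fst ℝ _ _).comp
        (splitE n m').toContinuousLinearMap).hasFDerivAt
    · have h1 : HasFDerivAt f (fderiv ℝ f x) (splitE n m' ((splitE n m').symm (t, x))).2 := by
        simpa using (hf.differentiable (by simp) x).hasFDerivAt
      exact HasFDerivAt.comp (g := f) (f := fun z => (splitE n m' z).2)
        ((splitE n m').symm (t, x)) h1 ((ContinuousLinearMap.snd ℝ _ _).comp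
          (splitE n m').toContinuousLinearMap).hasFDerivAt
  rw [hd.fderiv]
  simp

/-- Integration over the fibres of `Δₙ × X → X` of a form on `ℝⁿ × X`: in a plot it is the form
`v ↦ ∫_{t ∈ Δₙ} w_{(t, x)} (∂₁, …, ∂ₙ, v₁, …, v_q) dt`. -/
def simplexIntegral {D : DiffeologicalSpace X} (n q : ℕ)
    (w : Form (prodD (mfdD (EE n) (EE n)) D) (n + q) V) : Form D q V :=
  ⟨fun m p x => ∫ t in simplex n,
      insertFrame n q m (w.1 (n + m) ⟨idProd n p.1, idProd_mem D n p⟩ ((splitE n m).symm (t, x))),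
    IsForm.mk
      (fun m p => contDiff_infty.2 fun N => contDiff_setIntegral (isCompact_simplex n) N
        (contDiff_insertFrame w p))
      (fun m' m p f hf x => by
        have h := fun t : EE n => insertFrame_pullback w p hf t x
        have hint : Integrable (fun t => insertFrame n q m
            (w.1 (n + m) ⟨idProd n p.1, idProd_mem D n p⟩ ((splitE n m).symm (t, f x))))
            (volume.restrict (simplex n)) :=
          (((contDiff_insertFrame w p).continuous.comp
            (Continuous.prodMk_left (f x))).continuousOn).integrableOn_compact (isCompact_simplex n)
        exact (integral_congr_ae (Filter.Eventually.of_forall h)).trans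
          ((ContinuousAlternatingMap.compContinuousLinearMapCLM
            (fderiv ℝ f x)).integral_comp_comm hint))⟩

end FibreIntegration

section LieGroups

variable (E : Type*) [NormedAddCommGroup E] [NormedSpace ℝ E]
  {G : Type*} [TopologicalSpace G] [ChartedSpace E G] [Group G]

/-- The adjoint action of `g` on the Lie algebra of `G`, which as a vector space is the model space
`E = T₁ G`: the derivative at `1` of the conjugation by `g`. -/
def Ad (g : G) : E →L[ℝ] E := mfderiv 𝓘(ℝ, E) 𝓘(ℝ, E) (fun h : G => g * h * g⁻¹) 1

/-- The bracket of the Lie algebra `E = T₁ G` of `G`. -/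
def lieBr (G : Type*) [TopologicalSpace G] [ChartedSpace E G] [Group G] (u v : E) : E :=
  let u' : GroupLieAlgebra 𝓘(ℝ, E) G := u
  let v' : GroupLieAlgebra 𝓘(ℝ, E) G := v
  let r : GroupLieAlgebra 𝓘(ℝ, E) G := ⁅u', v'⁆
  r

/-- The homogeneous part `S^k(𝔤*)^G` of degree `k` of the algebra of invariant polynomials: the
symmetric `k`-linear forms on `𝔤` that are invariant under the adjoint action. -/
def InvPoly (G : Type*) [TopologicalSpace G] [ChartedSpace E G] [Group G] (k : ℕ) :
    Submodule ℝ (MultilinearMap ℝ (fun _ : Fin k => E) ℝ) where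
  carrier := {f | (∀ (s : Equiv.Perm (Fin k)) (v : Fin k → E), f (fun i => v (s i)) = f v) ∧
    ∀ (g : G) (v : Fin k → E), f (fun i => Ad E g (v i)) = f v}
  add_mem' ha hb := ⟨fun s v => congrArg₂ (· + ·) (ha.1 s v) (hb.1 s v),
    fun g v => congrArg₂ (· + ·) (ha.2 g v) (hb.2 g v)⟩
  zero_mem' := ⟨fun _ _ => rfl, fun _ _ => rfl⟩
  smul_mem' c _ h := ⟨fun s v => congrArg (c • ·) (h.1 s v), fun g v => congrArg (c • ·) (h.2 g v)⟩

variable [FiniteDimensional ℝ E] [LieGroup 𝓘(ℝ, E) ∞ G]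

/-- The bracket of the Lie algebra as a bilinear map. -/
def lieBrL (G : Type*) [TopologicalSpace G] [ChartedSpace E G] [Group G]
    [LieGroup 𝓘(ℝ, E) ∞ G] : E →ₗ[ℝ] E →ₗ[ℝ] E :=
  haveI : CompleteSpace E := FiniteDimensional.complete ℝ E
  haveI : LieGroup 𝓘(ℝ, E) (minSmoothness ℝ 3) G := by
    rw [minSmoothness_of_isRCLikeNormedField]
    infer_instance
  LinearMap.mk₂ ℝ (lieBr E G)
    (fun u v w => add_lie (L := GroupLieAlgebra 𝓘(ℝ, E) G) (M := GroupLieAlgebra 𝓘(ℝ, E) G) u v w)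
    (fun c u v => smul_lie (L := GroupLieAlgebra 𝓘(ℝ, E) G)
      (M := GroupLieAlgebra 𝓘(ℝ, E) G) c u v)
    (fun u v w => lie_add (L := GroupLieAlgebra 𝓘(ℝ, E) G) (M := GroupLieAlgebra 𝓘(ℝ, E) G) u v w)
    (fun c u v => lie_smul (L := GroupLieAlgebra 𝓘(ℝ, E) G)
      (M := GroupLieAlgebra 𝓘(ℝ, E) G) c u v)

end LieGroups

section Curvature

variable {X : Type*} {D : DiffeologicalSpace X} {E : Type*} [NormedAddCommGroup E]
  [NormedSpace ℝ E] [FiniteDimensional ℝ E]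

theorem form1_add {W : Type*} [NormedAddCommGroup W] [NormedSpace ℝ W] (a : W [⋀^Fin 1]→L[ℝ] E)
    (x y : W) : (a fun _ => x + y) = (a fun _ => x) + a fun _ => y := by
  have h := a.map_update_add (fun _ => x) 0 x y
  simp only [Function.update_eq_const_of_subsingleton] at h
  exact h

theorem form1_smul {W : Type*} [NormedAddCommGroup W] [NormedSpace ℝ W] (a : W [⋀^Fin 1]→L[ℝ] E)
    (c : ℝ) (x : W) : (a fun _ => c • x) = c • a fun _ => x := by
  have h := a.map_update_smul (fun _ => x) 0 c x
  simp only [Function.update_eq_const_of_subsingleton] at h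
  exact h

/-- For a bilinear map `B` and linear maps `a`, `b`, the alternating map
`(u, v) ↦ B (a u, b v) - B (a v, b u)`. -/
def altPair {W : Type*} [NormedAddCommGroup W] [NormedSpace ℝ W] [FiniteDimensional ℝ W]
    (B : E →ₗ[ℝ] E →ₗ[ℝ] E) (a b : W [⋀^Fin 1]→L[ℝ] E) : W [⋀^Fin 2]→L[ℝ] E :=
  contAlt
    { toFun := fun v => B (a fun _ => v 0) (b fun _ => v 1) - B (a fun _ => v 1) (b fun _ => v 0)
      map_update_add' := by
        intro _ v i x y
        fin_cases i <;> simp [form1_add] <;> abel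
      map_update_smul' := by
        intro _ v i c x
        fin_cases i <;> simp [form1_smul, smul_sub]
      map_eq_zero_of_eq' := by
        intro v i j h hij
        have : v 0 = v 1 := by
          fin_cases i <;> fin_cases j <;> simp_all
        simp [this] }

/-- The bracket `[a, b]` of two `𝔤`-valued `1`-forms, for a bracket `B` on `𝔤`:
`[a, b](u, v) = [a(u), b(v)] - [a(v), b(u)]`. -/
def formBracket (B : E →ₗ[ℝ] E →ₗ[ℝ] E) (a b : Form D 1 E) : Form D 2 E :=
  ⟨fun n p x => altPair B (a.1 n p x) (b.1 n p x), IsForm.mk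
    (fun n p => by
      refine contDiff_alternating_iff.2 fun v => ?_
      have hB : ContDiff ℝ ∞ fun z : E × E => B z.1 z.2 :=
        (LinearMap.toContinuousLinearMap
          ((LinearMap.toContinuousLinearMap (𝕜 := ℝ) (E := E) (F' := E)).toLinearMap.comp
            B)).isBoundedBilinearMap.contDiff
      have h := fun (c : Form D 1 E) (u : EE n) =>
        contDiff_alternating_iff.1 (form_smooth c n p) fun _ => u
      exact (hB.comp ((h a (v 0)).prodMk (h b (v 1)))).sub
        (hB.comp ((h a (v 1)).prodMk (h b (v 0)))))
    (fun m n p f hf x => by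
      rw [form_compat a p hf x, form_compat b p hf x]
      rfl)⟩

/-- The curvature `dθ + ½ [θ, θ]` of a `1`-form with values in the Lie algebra of `G`. -/
def curvature (G : Type*) [TopologicalSpace G] [ChartedSpace E G] [Group G]
    [LieGroup 𝓘(ℝ, E) ∞ G] (a : Form D 1 E) : Form D 2 E :=
  extD a + (1 / 2 : ℝ) • formBracket (lieBrL E G) a a

theorem pair_update {W : Type*} [NormedAddCommGroup W] [NormedSpace ℝ W] {k : ℕ}
    {_ : DecidableEq (Fin k × Fin 2)} (A : W [⋀^Fin 2]→L[ℝ] E) (v : Fin k × Fin 2 → W)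
    (i : Fin k × Fin 2) (z : W) :
    (fun l => A fun j => Function.update v i z (l, j)) = Function.update
      (fun l => A fun j => v (l, j)) i.1 (A (Function.update (fun j => v (i.1, j)) i.2 z)) := by
  funext l
  by_cases hl : l = i.1
  · subst hl
    rw [Function.update_self]
    congr 1
    funext j
    by_cases hj : j = i.2
    · subst hj
      simp
    · rw [Function.update_of_ne hj, Function.update_of_ne (fun h => hj (congrArg Prod.snd h))]
  · rw [Function.update_of_ne hl]
    congr 1
    funext j
    rw [Function.update_of_ne (fun h => hl (congrArg Prod.fst h))]

/-- The multilinear map `(v₁, …, v₂ₖ) ↦ f (A (v₁, v₂), …, A (v₂ₖ₋₁, v₂ₖ))`. -/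
def pairEval {W : Type*} [NormedAddCommGroup W] [NormedSpace ℝ W] {k : ℕ}
    (f : MultilinearMap ℝ (fun _ : Fin k => E) ℝ) (A : W [⋀^Fin 2]→L[ℝ] E) :
    MultilinearMap ℝ (fun _ : Fin (k * 2) => W) ℝ :=
  MultilinearMap.domDomCongr finProdFinEquiv
    ({ toFun := fun v => f fun i => A fun j => v (i, j)
       map_update_add' := by
        intro _ v i x y
        simp only [pair_update]
        rw [A.map_update_add, f.map_update_add]
       map_update_smul' := by
        intro _ v i c x
        simp only [pair_update]
        rw [A.map_update_smul, f.map_update_smul] } : MultilinearMap ℝ (fun _ : Fin k × Fin 2 => W) ℝ)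

/-- The evaluation `f(Ω) = f(Ω ∧ ⋯ ∧ Ω)` of a `k`-linear form `f` on a `2`-form `Ω`:
`f(Ω)(v₁, …, v₂ₖ) = 2⁻ᵏ ∑_s sgn(s) f (Ω (v_{s(1)}, v_{s(2)}), …, Ω (v_{s(2k-1)}, v_{s(2k)}))`. -/
def evalForm {k : ℕ} (f : MultilinearMap ℝ (fun _ : Fin k => E) ℝ) (a : Form D 2 E) :
    Form D (k * 2) ℝ :=
  ⟨fun n p x => contAlt ((1 / 2 ^ k : ℝ) • MultilinearMap.alternatization (pairEval f (a.1 n p x))),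
    IsForm.mk
      (fun n p => by
        refine contDiff_alternating_iff.2 fun v => ?_
        have hf : ContDiff ℝ ∞ f := (⟨f, continuous_multilinear f⟩ :
          ContinuousMultilinearMap ℝ (fun _ : Fin k => E) ℝ).contDiff
        have hp : ∀ v, ContDiff ℝ ∞ fun x => pairEval f (a.1 n p x) v := fun v =>
          hf.comp (contDiff_pi.2 fun i => contDiff_alternating_iff.1 (form_smooth a n p) _)
        have h : ∀ x, contAlt ((1 / 2 ^ k : ℝ) •
            MultilinearMap.alternatization (pairEval f (a.1 n p x))) v = (1 / 2 ^ k : ℝ) *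
              ∑ s : Equiv.Perm (Fin (k * 2)), (Equiv.Perm.sign s : ℤ) •
                pairEval f (a.1 n p x) (fun i => v (s i)) := fun x =>
          congrArg (fun r : ℝ => (1 / 2 ^ k : ℝ) * r)
            (MultilinearMap.alternatization_apply (pairEval f (a.1 n p x)) v)
        simp only [h]
        exact contDiff_const.mul (ContDiff.sum fun s _ => by
          simp only [zsmul_eq_mul]
          exact contDiff_const.mul (hp _)))
      (fun m n p g hg x => by
        rw [form_compat a p hg x]
        ext v
        exact congrArg (fun r : ℝ => (1 / 2 ^ k : ℝ) * r)
          ((MultilinearMap.alternatization_apply _ v).trans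
            (MultilinearMap.alternatization_apply (pairEval f (a.1 n p (g x)))
              (fun i => fderiv ℝ g x (v i))).symm))⟩

end Curvature

section MaurerCartan

variable {E : Type*} [NormedAddCommGroup E] [NormedSpace ℝ E] {G : Type*} [TopologicalSpace G]
  [ChartedSpace E G] [Group G]

theorem inTangentCoordinates_one [IsManifold 𝓘(ℝ, E) 1 G] {n : ℕ} (g : EE n → G)
    (hg : ∀ x, g x = 1) (L : EE n → EE n →L[ℝ] E) (x₀ x u : EE n) :
    inTangentCoordinates 𝓘(ℝ, EE n) 𝓘(ℝ, E) id g L x₀ x u = L x u := by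
  obtain rfl : g = fun _ => 1 := funext hg
  rw [inTangentCoordinates_eq]
  · simp only [ContinuousLinearMap.comp_apply]
    rw [(tangentBundleCore 𝓘(ℝ, E) G).coordChange_self]
    · simp
    · exact mem_chart_source E (1 : G)
  · exact Set.mem_univ x
  · exact mem_chart_source E (1 : G)

/-- The derivative of `y ↦ p(x)⁻¹ p(y)` at `y = x`. -/
def leftDeriv (E : Type*) [NormedAddCommGroup E] [NormedSpace ℝ E] {G : Type*} [TopologicalSpace G]
    [ChartedSpace E G] [Group G] {n : ℕ} (p : EE n → G) (x : EE n) : EE n →L[ℝ] E :=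
  mfderiv 𝓘(ℝ, EE n) 𝓘(ℝ, E) (fun y => (p x)⁻¹ * p y) x

variable [LieGroup 𝓘(ℝ, E) ∞ G]

theorem contDiff_leftDeriv {n : ℕ} {p : EE n → G} (hp : ContMDiff 𝓘(ℝ, EE n) 𝓘(ℝ, E) ∞ p)
    (u : EE n) : ContDiff ℝ ∞ fun x => leftDeriv E p x u := by
  have : IsManifold 𝓘(ℝ, E) 1 G := IsManifold.of_le (n := ∞) (by simp)
  have hF : ContMDiff (𝓘(ℝ, EE n).prod 𝓘(ℝ, EE n)) 𝓘(ℝ, E) ∞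
      (Function.uncurry fun x y : EE n => (p x)⁻¹ * p y) :=
    (ContMDiff.inv (ContMDiff.comp hp contMDiff_fst)).mul (ContMDiff.comp hp contMDiff_snd)
  refine contMDiff_iff_contDiff.1 fun x₀ => ?_
  have h := ContMDiffAt.mfderiv_apply (m := ∞) (fun x y : EE n => (p x)⁻¹ * p y) id id
    (fun _ => u) (x₀ := x₀) (hF.contMDiffAt) contMDiffAt_id contMDiffAt_id
    (contMDiffAt_const (I := 𝓘(ℝ, EE n))) (by simp)
  refine h.congr_of_eventuallyEq (Filter.Eventually.of_forall fun x => ?_)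
  exact (inTangentCoordinates_one (fun x => (p x)⁻¹ * p x) (fun x => inv_mul_cancel _)
    (fun x => leftDeriv E p x) x₀ x u).symm

theorem leftDeriv_comp {n m : ℕ} {p : EE n → G} (hp : ContMDiff 𝓘(ℝ, EE n) 𝓘(ℝ, E) ∞ p)
    {f : EE m → EE n} (hf : ContDiff ℝ ∞ f) (x : EE m) :
    leftDeriv E (p ∘ f) x = (leftDeriv E p (f x)).comp (fderiv ℝ f x) := by
  have hp : MDifferentiableAt 𝓘(ℝ, EE n) 𝓘(ℝ, E) (fun y => (p (f x))⁻¹ * p y) (f x) :=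
    (contMDiff_const.mul hp : ContMDiff 𝓘(ℝ, EE n) 𝓘(ℝ, E) ∞
      (fun y => (p (f x))⁻¹ * p y)).mdifferentiableAt (by simp)
  have hf' : MDifferentiableAt 𝓘(ℝ, EE m) 𝓘(ℝ, EE n) f x :=
    hf.contMDiff.mdifferentiableAt (by simp)
  have h := mfderiv_comp x hp hf'
  rw [mfderiv_eq_fderiv] at h
  exact h

/-- The left Maurer–Cartan form of `G`: the `𝔤`-valued `1`-form that maps a tangent vector `u` at
`g` to the tangent vector `g⁻¹ u` at `1`. -/
def maurerCartan (E : Type*) [NormedAddCommGroup E] [NormedSpace ℝ E] [FiniteDimensional ℝ E] (G : Type*)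
    [TopologicalSpace G] [ChartedSpace E G] [Group G] [LieGroup 𝓘(ℝ, E) ∞ G] :
    Form (mfdD E G) 1 E :=
  ⟨fun n p x => ContinuousAlternatingMap.ofSubsingleton ℝ (EE n) E (0 : Fin 1)
      (leftDeriv E p.1 x),
    IsForm.mk (fun n p => contDiff_alternating_iff.2 fun v => contDiff_leftDeriv p.2 (v 0))
      (fun m n p f hf x => by
        rw [leftDeriv_comp p.2 hf x]
        rfl)⟩

end MaurerCartan

section Groupoids

/-- A Lie groupoid `Γ ⇉ Γ₀` (finite-dimensional, smooth), with target map `tgt`, source map `src`,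
unit map, inversion and multiplication. The product `γ γ'` is only meaningful if
`src γ = tgt γ'`; the values of `mul` at other pairs are irrelevant. Smoothness of the product on
the manifold of composable pairs is expressed through smooth families of composable pairs. -/
structure LieGroupoid (EΓ : Type*) [NormedAddCommGroup EΓ] [NormedSpace ℝ EΓ]
    [FiniteDimensional ℝ EΓ] (Γ : Type*) [TopologicalSpace Γ] [ChartedSpace EΓ Γ]
    [IsManifold 𝓘(ℝ, EΓ) ∞ Γ] (E₀ : Type*) [NormedAddCommGroup E₀] [NormedSpace ℝ E₀]
    [FiniteDimensional ℝ E₀] (Γ₀ : Type*) [TopologicalSpace Γ₀] [ChartedSpace E₀ Γ₀]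
    [IsManifold 𝓘(ℝ, E₀) ∞ Γ₀] where
  tgt : Γ → Γ₀
  src : Γ → Γ₀
  unit : Γ₀ → Γ
  inv : Γ → Γ
  mul : Γ → Γ → Γ
  tgt_unit : ∀ x, tgt (unit x) = x
  src_unit : ∀ x, src (unit x) = x
  tgt_mul : ∀ a b, src a = tgt b → tgt (mul a b) = tgt a
  src_mul : ∀ a b, src a = tgt b → src (mul a b) = src b
  unit_mul : ∀ a, mul (unit (tgt a)) a = a
  mul_unit : ∀ a, mul a (unit (src a)) = a
  mul_assoc : ∀ a b c, src a = tgt b → src b = tgt c → mul (mul a b) c = mul a (mul b c)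
  tgt_inv : ∀ a, tgt (inv a) = src a
  src_inv : ∀ a, src (inv a) = tgt a
  inv_mul : ∀ a, mul (inv a) a = unit (src a)
  mul_inv : ∀ a, mul a (inv a) = unit (tgt a)
  tgt_smooth : ContMDiff 𝓘(ℝ, EΓ) 𝓘(ℝ, E₀) ∞ tgt
  src_smooth : ContMDiff 𝓘(ℝ, EΓ) 𝓘(ℝ, E₀) ∞ src
  tgt_submersion : ∀ a, Function.Surjective (mfderiv 𝓘(ℝ, EΓ) 𝓘(ℝ, E₀) tgt a)
  src_submersion : ∀ a, Function.Surjective (mfderiv 𝓘(ℝ, EΓ) 𝓘(ℝ, E₀) src a)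
  unit_smooth : ContMDiff 𝓘(ℝ, E₀) 𝓘(ℝ, EΓ) ∞ unit
  inv_smooth : ContMDiff 𝓘(ℝ, EΓ) 𝓘(ℝ, EΓ) ∞ inv
  mul_smooth : ∀ (n : ℕ) (a b : EE n → Γ), ContMDiff 𝓘(ℝ, EE n) 𝓘(ℝ, EΓ) ∞ a →
    ContMDiff 𝓘(ℝ, EE n) 𝓘(ℝ, EΓ) ∞ b → (∀ x, src (a x) = tgt (b x)) →
    ContMDiff 𝓘(ℝ, EE n) 𝓘(ℝ, EΓ) ∞ fun x => mul (a x) (b x)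

variable {EΓ : Type*} [NormedAddCommGroup EΓ] [NormedSpace ℝ EΓ] [FiniteDimensional ℝ EΓ]
  {Γ : Type*} [TopologicalSpace Γ] [ChartedSpace EΓ Γ] [IsManifold 𝓘(ℝ, EΓ) ∞ Γ]
  {E₀ : Type*} [NormedAddCommGroup E₀] [NormedSpace ℝ E₀] [FiniteDimensional ℝ E₀]
  {Γ₀ : Type*} [TopologicalSpace Γ₀] [ChartedSpace E₀ Γ₀] [IsManifold 𝓘(ℝ, E₀) ∞ Γ₀]
  (Gd : LieGroupoid EΓ Γ E₀ Γ₀)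

/-- The manifold `Γₙ` of composable strings
`x₀ ←γ₁← x₁ ←γ₂← ⋯ ←γₙ← xₙ` of the groupoid. (For `n ≥ 1` the vertices are determined by the
arrows; for `n = 0` this is `Γ₀`.) -/
def Nerve (n : ℕ) : Type _ :=
  {s : (Fin (n + 1) → Γ₀) × (Fin n → Γ) //
    ∀ i : Fin n, Gd.tgt (s.2 i) = s.1 i.castSucc ∧ Gd.src (s.2 i) = s.1 i.succ}

/-- The smooth structure of `Γₙ`. -/
def nerveD (n : ℕ) : DiffeologicalSpace (Nerve Gd n) :=
  inducedD Subtype.val (prodD (piD (Fin (n + 1)) (mfdD E₀ Γ₀)) (piD (Fin n) (mfdD EΓ Γ)))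

theorem mem_plots_nerveD {n m : ℕ} {p : EE m → Nerve Gd n} : p ∈ (nerveD Gd n).plots m ↔
    (∀ i, ContMDiff 𝓘(ℝ, EE m) 𝓘(ℝ, E₀) ∞ fun x => (p x).1.1 i) ∧
      ∀ i, ContMDiff 𝓘(ℝ, EE m) 𝓘(ℝ, EΓ) ∞ fun x => (p x).1.2 i :=
  mem_plots_prodD.trans (and_congr mem_plots_piD mem_plots_piD)

/-- The face map `εᵢ : Γₙ₊₁ → Γₙ`, which omits the vertex `xᵢ`: it drops the first arrow for
`i = 0`, the last one for `i = n + 1`, and multiplies `γᵢ` and `γᵢ₊₁` otherwise. -/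
def face {n : ℕ} (i : Fin (n + 2)) (s : Nerve Gd (n + 1)) : Nerve Gd n :=
  ⟨(fun j => s.1.1 (i.succAbove j), fun k =>
    if (k : ℕ) + 1 < i then s.1.2 k.castSucc
    else if (k : ℕ) + 1 = i then Gd.mul (s.1.2 k.castSucc) (s.1.2 k.succ)
    else s.1.2 k.succ), fun k => by
      have h0 := s.2 k.castSucc
      have h1 := s.2 k.succ
      have hm : Gd.src (s.1.2 k.castSucc) = Gd.tgt (s.1.2 k.succ) := by
        rw [h0.2, h1.1, Fin.succ_castSucc]
      dsimp only
      split_ifs with ha hb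
      · rw [h0.1, h0.2]
        constructor <;> refine congrArg s.1.1 (Fin.ext ?_) <;>
          simp [Fin.succAbove, Fin.lt_def] <;> split_ifs <;> simp <;> omega
      · rw [Gd.tgt_mul _ _ hm, Gd.src_mul _ _ hm, h0.1, h1.2]
        constructor <;> refine congrArg s.1.1 (Fin.ext ?_) <;>
          simp [Fin.succAbove, Fin.lt_def] <;> split_ifs <;> simp <;> omega
      · rw [h1.1, h1.2]
        constructor <;> refine congrArg s.1.1 (Fin.ext ?_) <;>
          simp [Fin.succAbove, Fin.lt_def] <;> split_ifs <;> simp <;> omega⟩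

theorem face_smooth {n : ℕ} (i : Fin (n + 2)) :
    Smooth (nerveD Gd (n + 1)) (nerveD Gd n) (face Gd i) := by
  intro m p hp
  have hp := (mem_plots_nerveD Gd).1 hp
  refine (mem_plots_nerveD Gd).2 ⟨fun j => hp.1 _, fun k => ?_⟩
  by_cases ha : (k : ℕ) + 1 < i
  · simpa [face, ha] using hp.2 k.castSucc
  · by_cases hb : (k : ℕ) + 1 = i
    · have he : (fun x => ((face Gd i ∘ p) x).1.2 k) =
          fun x => Gd.mul ((p x).1.2 k.castSucc) ((p x).1.2 k.succ) :=
        funext fun x => (if_neg ha).trans (if_pos hb)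
      rw [he]
      refine Gd.mul_smooth _ _ _ (hp.2 k.castSucc) (hp.2 k.succ) fun x => ?_
      rw [((p x).2 k.castSucc).2, ((p x).2 k.succ).1, Fin.succ_castSucc]
    · simpa [face, ha, hb] using hp.2 k.succ

end Groupoids

section Bundles

/-- A (right) principal bundle `P → N` with structure group `G`, smooth and locally trivial. -/
structure PrincipalBundle (E : Type*) [NormedAddCommGroup E] [NormedSpace ℝ E]
    [FiniteDimensional ℝ E] (G : Type*) [TopologicalSpace G] [ChartedSpace E G] [Group G]
    [LieGroup 𝓘(ℝ, E) ∞ G] (EN : Type*) [NormedAddCommGroup EN] [NormedSpace ℝ EN]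
    [FiniteDimensional ℝ EN] (N : Type*) [TopologicalSpace N] [ChartedSpace EN N]
    [IsManifold 𝓘(ℝ, EN) ∞ N] (EP : Type*) [NormedAddCommGroup EP] [NormedSpace ℝ EP]
    [FiniteDimensional ℝ EP] (P : Type*) [TopologicalSpace P] [ChartedSpace EP P]
    [IsManifold 𝓘(ℝ, EP) ∞ P] where
  proj : P → N
  act : P → G → P
  proj_smooth : ContMDiff 𝓘(ℝ, EP) 𝓘(ℝ, EN) ∞ proj
  act_smooth : ContMDiff (𝓘(ℝ, EP).prod 𝓘(ℝ, E)) 𝓘(ℝ, EP) ∞ fun z : P × G => act z.1 z.2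
  act_one : ∀ p, act p 1 = p
  act_mul : ∀ p g h, act p (g * h) = act (act p g) h
  proj_act : ∀ p g, proj (act p g) = proj p
  /-- Around each point there is an equivariant diffeomorphism `p ↦ (proj p, φ p)` from the part
  of `P` over an open set `U` onto `U × G`, with inverse `ψ`. -/
  locally_trivial : ∀ x : N, ∃ (U : Set N) (φ : P → G) (ψ : N × G → P), IsOpen U ∧ x ∈ U ∧
    ContMDiffOn 𝓘(ℝ, EP) 𝓘(ℝ, E) ∞ φ (proj ⁻¹' U) ∧
    ContMDiffOn (𝓘(ℝ, EN).prod 𝓘(ℝ, E)) 𝓘(ℝ, EP) ∞ ψ (U ×ˢ Set.univ) ∧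
    (∀ y ∈ U, ∀ g, proj (ψ (y, g)) = y ∧ φ (ψ (y, g)) = g) ∧
    (∀ p, proj p ∈ U → ψ (proj p, φ p) = p) ∧
    ∀ p g, proj p ∈ U → φ (act p g) = φ p * g

/-- A principal `G`-bundle over a Lie groupoid `Γ ⇉ Γ₀`: a principal `G`-bundle `P → Γ₀` with a
left action of `Γ` on `P` that commutes with the action of `G`. The product `γ · p` is only
meaningful if `src γ = proj p`; the values of `gact` at other pairs are irrelevant. -/
structure GroupoidBundle (E : Type*) [NormedAddCommGroup E] [NormedSpace ℝ E]
    [FiniteDimensional ℝ E] (G : Type*) [TopologicalSpace G] [ChartedSpace E G] [Group G]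
    [LieGroup 𝓘(ℝ, E) ∞ G] {EΓ : Type*} [NormedAddCommGroup EΓ] [NormedSpace ℝ EΓ]
    [FiniteDimensional ℝ EΓ] {Γ : Type*} [TopologicalSpace Γ] [ChartedSpace EΓ Γ]
    [IsManifold 𝓘(ℝ, EΓ) ∞ Γ] {E₀ : Type*} [NormedAddCommGroup E₀] [NormedSpace ℝ E₀]
    [FiniteDimensional ℝ E₀] {Γ₀ : Type*} [TopologicalSpace Γ₀] [ChartedSpace E₀ Γ₀]
    [IsManifold 𝓘(ℝ, E₀) ∞ Γ₀] (Gd : LieGroupoid EΓ Γ E₀ Γ₀)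
    (EP : Type*) [NormedAddCommGroup EP] [NormedSpace ℝ EP]
    [FiniteDimensional ℝ EP] (P : Type*) [TopologicalSpace P] [ChartedSpace EP P]
    [IsManifold 𝓘(ℝ, EP) ∞ P] extends PrincipalBundle E G E₀ Γ₀ EP P where
  gact : Γ → P → P
  proj_gact : ∀ a p, Gd.src a = proj p → proj (gact a p) = Gd.tgt a
  unit_gact : ∀ p, gact (Gd.unit (proj p)) p = p
  mul_gact : ∀ a b p, Gd.src a = Gd.tgt b → Gd.src b = proj p →
    gact (Gd.mul a b) p = gact a (gact b p)
  gact_act : ∀ a p g, Gd.src a = proj p → gact a (act p g) = act (gact a p) g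
  gact_smooth : ∀ (n : ℕ) (a : EE n → Γ) (p : EE n → P), ContMDiff 𝓘(ℝ, EE n) 𝓘(ℝ, EΓ) ∞ a →
    ContMDiff 𝓘(ℝ, EE n) 𝓘(ℝ, EP) ∞ p → (∀ x, Gd.src (a x) = proj (p x)) →
    ContMDiff 𝓘(ℝ, EE n) 𝓘(ℝ, EP) ∞ fun x => gact (a x) (p x)

variable {E : Type*} [NormedAddCommGroup E] [NormedSpace ℝ E] [FiniteDimensional ℝ E]
  {G : Type*} [TopologicalSpace G] [ChartedSpace E G] [Group G] [LieGroup 𝓘(ℝ, E) ∞ G]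
  {EP : Type*} [NormedAddCommGroup EP] [NormedSpace ℝ EP] [FiniteDimensional ℝ EP]
  {P : Type*} [TopologicalSpace P] [ChartedSpace EP P] [IsManifold 𝓘(ℝ, EP) ∞ P]

section Connections

variable {EN : Type*} [NormedAddCommGroup EN] [NormedSpace ℝ EN] [FiniteDimensional ℝ EN]
  {N : Type*} [TopologicalSpace N] [ChartedSpace EN N] [IsManifold 𝓘(ℝ, EN) ∞ N]
  (B : PrincipalBundle E G EN N EP P)

theorem act_right_smooth (g : G) : Smooth (mfdD EP P) (mfdD EP P) fun p => B.act p g :=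
  smooth_of_contMDiff (B.act_smooth.comp (contMDiff_id.prodMk contMDiff_const))

theorem act_left_smooth (p : P) : Smooth (mfdD E G) (mfdD EP P) fun g => B.act p g :=
  smooth_of_contMDiff (B.act_smooth.comp (contMDiff_const.prodMk contMDiff_id))

/-- A `𝔤`-valued `1`-form `θ` on `P` is a connection form if `R_g^* θ = Ad_{g⁻¹} θ` for all `g`,
and if its pull-back along each orbit map `g ↦ p g` is the left Maurer–Cartan form (that is,
`θ` maps the fundamental vector field of each `ξ ∈ 𝔤` to `ξ`). -/
structure IsConnection (θ : Form (mfdD EP P) 1 E) : Prop where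
  equivariant : ∀ (g : G) (n : ℕ) (c : (mfdD EP P).plots n) (x : EE n) (v : Fin 1 → EE n),
    (pullback (fun p => B.act p g) (act_right_smooth B g) θ).1 n c x v =
      Ad E g⁻¹ (θ.1 n c x v)
  vertical : ∀ p : P, pullback (fun g => B.act p g) (act_left_smooth B p) θ = maurerCartan E G

end Connections

variable {EΓ : Type*} [NormedAddCommGroup EΓ] [NormedSpace ℝ EΓ] [FiniteDimensional ℝ EΓ]
  {Γ : Type*} [TopologicalSpace Γ] [ChartedSpace EΓ Γ] [IsManifold 𝓘(ℝ, EΓ) ∞ Γ]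
  {E₀ : Type*} [NormedAddCommGroup E₀] [NormedSpace ℝ E₀] [FiniteDimensional ℝ E₀]
  {Γ₀ : Type*} [TopologicalSpace Γ₀] [ChartedSpace E₀ Γ₀] [IsManifold 𝓘(ℝ, E₀) ∞ Γ₀]
  {Gd : LieGroupoid EΓ Γ E₀ Γ₀} (B : GroupoidBundle E G Gd EP P)

/-- The manifold `Qₙ` of composable strings of the transformation groupoid `Q = Γ ×_{Γ₀} P ⇉ P`,
whose arrows `(γ, p)`, `src γ = proj p`, lead from `p` to `γ · p`: a string consists of a string
of `Γ` and of points `p₀, …, pₙ` of `P` over its vertices with `pᵢ₋₁ = γᵢ · pᵢ`. -/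
def BundleNerve (n : ℕ) : Type _ :=
  {s : Nerve Gd n × (Fin (n + 1) → P) // (∀ i, B.proj (s.2 i) = s.1.1.1 i) ∧
    ∀ i : Fin n, s.2 i.castSucc = B.gact (s.1.1.2 i) (s.2 i.succ)}

/-- The smooth structure of `Qₙ`. -/
def bundleNerveD (n : ℕ) : DiffeologicalSpace (BundleNerve B n) :=
  inducedD Subtype.val (prodD (nerveD Gd n) (piD (Fin (n + 1)) (mfdD EP P)))

/-- The projection `Qₙ → Γₙ`. -/
def bundleNerveProj (n : ℕ) (s : BundleNerve B n) : Nerve Gd n := s.1.1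

theorem bundleNerveProj_smooth (n : ℕ) :
    Smooth (bundleNerveD B n) (nerveD Gd n) (bundleNerveProj B n) :=
  fun _ _ hp => (mem_plots_prodD.1 hp).1

/-- The map `pᵢ : Qₙ → P` given by the `i`-th vertex. -/
def bundleVertex (n : ℕ) (i : Fin (n + 1)) (s : BundleNerve B n) : P := s.1.2 i

theorem bundleVertex_smooth (n : ℕ) (i : Fin (n + 1)) :
    Smooth (bundleNerveD B n) (mfdD EP P) (bundleVertex B n i) :=
  fun _ _ hp => mem_plots_piD.1 (mem_plots_prodD.1 hp).2 i

end Bundles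

section Construction

/-- The barycentric coordinates `t₀ = 1 - ∑ tⱼ, t₁, …, tₙ` as functions on `ℝⁿ`. -/
def bary {n : ℕ} (i : Fin (n + 1)) (t : EE n) : ℝ :=
  Fin.cases (1 - ∑ j, t j) (fun j => t j) i

theorem bary_smooth {n : ℕ} (i : Fin (n + 1)) : Smooth (mfdD (EE n) (EE n)) (mfdD ℝ ℝ) (bary i) := by
  have hc : ∀ j, ContDiff ℝ ∞ fun t : EE n => t j := fun j =>
    contDiff_piLp_apply 2
  refine smooth_of_contMDiff (contMDiff_iff_contDiff.2 ?_)
  refine Fin.cases ?_ (fun j => ?_) i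
  · exact contDiff_const.sub (ContDiff.sum fun j _ => hc j)
  · exact hc j

variable {E : Type*} [NormedAddCommGroup E] [NormedSpace ℝ E] [FiniteDimensional ℝ E]
  {P Q N : Type*} {DP : DiffeologicalSpace P} {DQ : DiffeologicalSpace Q}
  {DN : DiffeologicalSpace N}

/-- The `1`-form `∑ᵢ tᵢ pᵢ^* θ` on `Δₙ × Q` for maps `p₀, …, pₙ : Q → P`. -/
def simplexForm {n : ℕ} (v : Fin (n + 1) → Q → P) (hv : ∀ i, Smooth DQ DP (v i))
    (θ : Form DP 1 E) : Form (prodD (mfdD (EE n) (EE n)) DQ) 1 E :=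
  ∑ i, fnMul (bary i ∘ Prod.fst) (fun m p hp => bary_smooth i m _ (smooth_fst _ _ m p hp))
    (pullback (v i ∘ Prod.snd) (fun m p hp => hv i m _ (smooth_snd _ _ m p hp)) θ)

/-- The Chern–Weil form `f(Ω)`, `Ω = dθ + ½ [θ, θ]`. -/
def chernForm (G : Type*) [TopologicalSpace G] [ChartedSpace E G] [Group G]
    [LieGroup 𝓘(ℝ, E) ∞ G] {k : ℕ} (f : InvPoly E G k) (θ : Form DP 1 E) : Form DP (k * 2) ℝ :=
  evalForm f.1 (curvature G θ)

/-- `w` descends along `π : Q → N`: it is the pull-back of exactly one form on `N`. -/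
def Descends {k : ℕ} {V : Type*} [NormedAddCommGroup V] [NormedSpace ℝ V] (π : Q → N)
    (hπ : Smooth DQ DN π) (w : Form DQ k V) : Prop :=
  ∃! η : Form DN k V, pullback π hπ η = w

open Classical in
/-- The form on `N` whose pull-back along `π : Q → N` is `w` (and `0` if there is none). -/
def descend {k : ℕ} {V : Type*} [NormedAddCommGroup V] [NormedSpace ℝ V] (π : Q → N)
    (hπ : Smooth DQ DN π) (w : Form DQ k V) : Form DN k V :=
  if h : ∃ η : Form DN k V, pullback π hπ η = w then h.choose else 0

/-- Forms of equal degrees. -/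
def castDeg {k l : ℕ} (h : k = l) {V : Type*} [NormedAddCommGroup V] [NormedSpace ℝ V]
    (w : Form DN k V) : Form DN l V := h ▸ w

end Construction

section Complexes

/-- The cohomology `ker d / im d` of a module with a differential. -/
abbrev Cohomology {C : Type*} [AddCommGroup C] [Module ℝ C] (d : C →ₗ[ℝ] C) : Type _ :=
  LinearMap.ker d ⧸ (LinearMap.range d).submoduleOf (LinearMap.ker d)

open Classical in
/-- The cohomology class of a cocycle (and `0` for other elements). -/
def cohClass {C : Type*} [AddCommGroup C] [Module ℝ C] (d : C →ₗ[ℝ] C) (c : C) : Cohomology d :=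
  if h : d c = 0 then Submodule.Quotient.mk ⟨c, LinearMap.mem_ker.2 h⟩ else 0

/-- The de Rham complex `⨁ₖ Ωᵏ(X)`. -/
def DeRham {X : Type*} (D : DiffeologicalSpace X) : Type _ := DirectSum ℕ fun k => Form D k ℝ

instance {X : Type*} (D : DiffeologicalSpace X) : AddCommGroup (DeRham D) :=
  inferInstanceAs (AddCommGroup (DirectSum ℕ fun k => Form D k ℝ))

instance {X : Type*} (D : DiffeologicalSpace X) : Module ℝ (DeRham D) :=
  inferInstanceAs (Module ℝ (DirectSum ℕ fun k => Form D k ℝ))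

/-- The inclusion of `Ωᵏ(X)` into the de Rham complex. -/
def deRhamInc {X : Type*} (D : DiffeologicalSpace X) (k : ℕ) : Form D k ℝ →ₗ[ℝ] DeRham D :=
  DirectSum.lof ℝ ℕ (fun k => Form D k ℝ) k

/-- The exterior derivative on the de Rham complex. -/
def deRhamD {X : Type*} (D : DiffeologicalSpace X) : DeRham D →ₗ[ℝ] DeRham D :=
  DirectSum.toModule ℝ ℕ (DeRham D) fun k => deRhamInc D (k + 1) ∘ₗ extD

/-- The de Rham cohomology `H^*_{dR}(X)`. -/
abbrev DeRhamCohomology {X : Type*} (D : DiffeologicalSpace X) : Type _ :=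
  Cohomology (deRhamD D)

/-- The de Rham cohomology class of a closed form. -/
def deRhamClass {X : Type*} (D : DiffeologicalSpace X) (c : DeRham D) : DeRhamCohomology D :=
  cohClass (deRhamD D) c

variable {EΓ : Type*} [NormedAddCommGroup EΓ] [NormedSpace ℝ EΓ] [FiniteDimensional ℝ EΓ]
  {Γ : Type*} [TopologicalSpace Γ] [ChartedSpace EΓ Γ] [IsManifold 𝓘(ℝ, EΓ) ∞ Γ]
  {E₀ : Type*} [NormedAddCommGroup E₀] [NormedSpace ℝ E₀] [FiniteDimensional ℝ E₀]
  {Γ₀ : Type*} [TopologicalSpace Γ₀] [ChartedSpace E₀ Γ₀] [IsManifold 𝓘(ℝ, E₀) ∞ Γ₀]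
  (Gd : LieGroupoid EΓ Γ E₀ Γ₀)

/-- The total complex `⨁ Ω^q(Γₙ)` of the simplicial manifold `Γ_•`, indexed by the pairs
`(n, q)`. -/
def TotForm : Type _ := DirectSum (ℕ × ℕ) fun a => Form (nerveD Gd a.1) a.2 ℝ

instance : AddCommGroup (TotForm Gd) :=
  inferInstanceAs (AddCommGroup (DirectSum (ℕ × ℕ) fun a => Form (nerveD Gd a.1) a.2 ℝ))

instance : Module ℝ (TotForm Gd) :=
  inferInstanceAs (Module ℝ (DirectSum (ℕ × ℕ) fun a => Form (nerveD Gd a.1) a.2 ℝ))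

/-- The inclusion of `Ω^q(Γₙ)` into the total complex. -/
def totInc (n q : ℕ) : Form (nerveD Gd n) q ℝ →ₗ[ℝ] TotForm Gd :=
  DirectSum.lof ℝ (ℕ × ℕ) (fun a => Form (nerveD Gd a.1) a.2 ℝ) (n, q)

/-- The simplicial differential `∂ = ∑ (-1)ⁱ εᵢ^* : Ω^q(Γₙ) → Ω^q(Γₙ₊₁)`. -/
def simplD (n q : ℕ) : Form (nerveD Gd n) q ℝ →ₗ[ℝ] Form (nerveD Gd (n + 1)) q ℝ :=
  ∑ i : Fin (n + 2), (-1 : ℝ) ^ (i : ℕ) • pullback (face Gd i) (face_smooth Gd i)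

/-- The total differential `δ = (-1)ⁿ d + ∂` on `Ω^q(Γₙ)`. -/
def totD : TotForm Gd →ₗ[ℝ] TotForm Gd :=
  DirectSum.toModule ℝ (ℕ × ℕ) (TotForm Gd) fun a =>
    (-1 : ℝ) ^ a.1 • (totInc Gd a.1 (a.2 + 1) ∘ₗ extD) + totInc Gd (a.1 + 1) a.2 ∘ₗ simplD Gd a.1 a.2

/-- The cohomology `H^*_{dR}(Γ_•)` of the total complex. -/
abbrev TotCohomology : Type _ := Cohomology (totD Gd)

/-- The class in `H^*_{dR}(Γ_•)` of a cocycle of the total complex. -/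
def totClass (c : TotForm Gd) : TotCohomology Gd := cohClass (totD Gd) c

end Complexes

section ChernWeilMap

variable {E : Type*} [NormedAddCommGroup E] [NormedSpace ℝ E] [FiniteDimensional ℝ E]
  {G : Type*} [TopologicalSpace G] [ChartedSpace E G] [Group G] [LieGroup 𝓘(ℝ, E) ∞ G]
  {EΓ : Type*} [NormedAddCommGroup EΓ] [NormedSpace ℝ EΓ] [FiniteDimensional ℝ EΓ]
  {Γ : Type*} [TopologicalSpace Γ] [ChartedSpace EΓ Γ] [IsManifold 𝓘(ℝ, EΓ) ∞ Γ]
  {E₀ : Type*} [NormedAddCommGroup E₀] [NormedSpace ℝ E₀] [FiniteDimensional ℝ E₀]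
  {Γ₀ : Type*} [TopologicalSpace Γ₀] [ChartedSpace E₀ Γ₀] [IsManifold 𝓘(ℝ, E₀) ∞ Γ₀]
  {Gd : LieGroupoid EΓ Γ E₀ Γ₀}
  {EP : Type*} [NormedAddCommGroup EP] [NormedSpace ℝ EP] [FiniteDimensional ℝ EP]
  {P : Type*} [TopologicalSpace P] [ChartedSpace EP P] [IsManifold 𝓘(ℝ, EP) ∞ P]
  (B : GroupoidBundle E G Gd EP P) (θ : Form (mfdD EP P) 1 E)

/-- The algebra `S(𝔤^*)^G = ⨁ₖ S^k(𝔤^*)^G` of invariant polynomials (as a vector space). -/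
abbrev InvPolys (E : Type*) [NormedAddCommGroup E] [NormedSpace ℝ E] (G : Type*)
    [TopologicalSpace G] [ChartedSpace E G] [Group G] : Type _ :=
  DirectSum ℕ fun k => InvPoly E G k

/-- The component in `Ω^{2k-n}(Γₙ)`, for `n ≤ 2k`, of the cochain obtained from forms
`c n ∈ Ω^{2k}(Δₙ × Γₙ)` by integration over the simplices, summed over `n`. (For `n > 2k` the
integral over `Δₙ` vanishes for degree reasons.) -/
def integrateSimplices {k : ℕ}
    (c : ∀ n, Form (prodD (mfdD (EE n) (EE n)) (nerveD Gd n)) (k * 2) ℝ) : TotForm Gd :=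
  ∑ n : Fin (k * 2 + 1), totInc Gd n (k * 2 - n) (simplexIntegral n (k * 2 - n)
    (castDeg (Nat.add_sub_of_le (Nat.lt_succ_iff.1 n.2)).symm (c n)))

/-- The form `θ̃ = ∑ᵢ tᵢ pᵢ^* θ` on `Δₙ × Qₙ`. -/
def thetaTilde (n : ℕ) : Form (prodD (mfdD (EE n) (EE n)) (bundleNerveD B n)) 1 E :=
  simplexForm (bundleVertex B n) (bundleVertex_smooth B n) θ

/-- The projection `Δₙ × Qₙ → Δₙ × Γₙ`. -/
def simplexProj (n : ℕ) : EE n × BundleNerve B n → EE n × Nerve Gd n :=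
  Prod.map id (bundleNerveProj B n)

theorem simplexProj_smooth (n : ℕ) : Smooth (prodD (mfdD (EE n) (EE n)) (bundleNerveD B n))
    (prodD (mfdD (EE n) (EE n)) (nerveD Gd n)) (simplexProj B n) :=
  smooth_prodMap (smooth_id _) (bundleNerveProj_smooth B n)

/-- The cochain `z_θ(f)` of an invariant polynomial `f` of degree `k`: the Chern–Weil form of
`θ̃` on `Δₙ × Qₙ`, descended to `Δₙ × Γₙ` and integrated over `Δₙ`. -/
def zHom {k : ℕ} (f : InvPoly E G k) : TotForm Gd :=
  integrateSimplices fun n =>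
    descend (simplexProj B n) (simplexProj_smooth B n) (chernForm G f (thetaTilde B θ n))

open Classical in
/-- The map `z_θ : S(𝔤^*)^G → Z^*_{dR}(Γ_•)`. -/
def zMap (f : InvPolys E G) : TotForm Gd := ∑ k ∈ DFinsupp.support f, zHom B θ (f k)

/-- The map `w_θ : S(𝔤^*)^G → H^*_{dR}(Γ_•)`. -/
def wMap (f : InvPolys E G) : TotCohomology Gd := totClass Gd (zMap B θ f)

end ChernWeilMap

section Examples

/-- A manifold `M` as a Lie groupoid `M ⇉ M` with only unit arrows. -/
def unitGroupoid (EM : Type*) [NormedAddCommGroup EM] [NormedSpace ℝ EM] [FiniteDimensional ℝ EM]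
    (M : Type*) [TopologicalSpace M] [ChartedSpace EM M] [IsManifold 𝓘(ℝ, EM) ∞ M] :
    LieGroupoid EM M EM M where
  tgt := id
  src := id
  unit := id
  inv := id
  mul a _ := a
  tgt_unit _ := rfl
  src_unit _ := rfl
  tgt_mul _ _ _ := rfl
  src_mul _ _ h := h
  unit_mul _ := rfl
  mul_unit _ := rfl
  mul_assoc _ _ _ _ _ := rfl
  tgt_inv _ := rfl
  src_inv _ := rfl
  inv_mul _ := rfl
  mul_inv _ := rfl
  tgt_smooth := contMDiff_id
  src_smooth := contMDiff_id
  tgt_submersion _ := by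
    rw [mfderiv_id]
    exact Function.surjective_id
  src_submersion _ := by
    rw [mfderiv_id]
    exact Function.surjective_id
  unit_smooth := contMDiff_id
  inv_smooth := contMDiff_id
  mul_smooth _ _ _ ha _ _ := ha

variable (E : Type*) [NormedAddCommGroup E] [NormedSpace ℝ E] [FiniteDimensional ℝ E]
  (G : Type*) [TopologicalSpace G] [ChartedSpace E G] [Group G] [LieGroup 𝓘(ℝ, E) ∞ G]

/-- A Lie group `G` as a Lie groupoid `G ⇉ pt` over the one-point manifold `pt = ℝ⁰`. -/
def groupGroupoid : LieGroupoid E G (EE 0) (EE 0) where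
  tgt _ := 0
  src _ := 0
  unit _ := 1
  inv a := a⁻¹
  mul a b := a * b
  tgt_unit _ := Subsingleton.elim _ _
  src_unit _ := Subsingleton.elim _ _
  tgt_mul _ _ _ := rfl
  src_mul _ _ _ := rfl
  unit_mul := one_mul
  mul_unit := mul_one
  mul_assoc a b c _ _ := _root_.mul_assoc a b c
  tgt_inv _ := rfl
  src_inv _ := rfl
  inv_mul := inv_mul_cancel
  mul_inv := mul_inv_cancel
  tgt_smooth := contMDiff_const
  src_smooth := contMDiff_const
  tgt_submersion _ := fun _ => ⟨0, Subsingleton.elim (α := EE 0) _ _⟩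
  src_submersion _ := fun _ => ⟨0, Subsingleton.elim (α := EE 0) _ _⟩
  unit_smooth := contMDiff_const
  inv_smooth := contMDiff_inv 𝓘(ℝ, E) ∞
  mul_smooth _ _ _ ha hb _ := ha.mul hb

/-- The principal `G`-bundle `G → pt` over the groupoid `G ⇉ pt`: both groups act on `G` by
multiplication. -/
def groupBundle : GroupoidBundle E G (groupGroupoid E G) E G where
  proj _ := 0
  act p g := p * g
  proj_smooth := contMDiff_const
  act_smooth := contMDiff_mul 𝓘(ℝ, E) ∞
  act_one := mul_one
  act_mul p g h := (mul_assoc p g h).symm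
  proj_act _ _ := rfl
  locally_trivial x := ⟨Set.univ, id, Prod.snd, isOpen_univ, Set.mem_univ x,
    contMDiff_id.contMDiffOn, contMDiff_snd.contMDiffOn,
    fun _ _ _ => ⟨Subsingleton.elim _ _, rfl⟩, fun _ _ => rfl, fun _ _ _ => rfl⟩
  gact a p := a * p
  proj_gact _ _ _ := rfl
  unit_gact := one_mul
  mul_gact a b p _ _ := mul_assoc a b p
  gact_act a p g _ := (mul_assoc a p g).symm
  gact_smooth _ _ _ ha hp _ := ha.mul hp

end Examples

section ClassicalChernWeil

variable {E : Type*} [NormedAddCommGroup E] [NormedSpace ℝ E] [FiniteDimensional ℝ E]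
  {G : Type*} [TopologicalSpace G] [ChartedSpace E G] [Group G] [LieGroup 𝓘(ℝ, E) ∞ G]
  {EN : Type*} [NormedAddCommGroup EN] [NormedSpace ℝ EN] [FiniteDimensional ℝ EN]
  {N : Type*} [TopologicalSpace N] [ChartedSpace EN N] [IsManifold 𝓘(ℝ, EN) ∞ N]
  {EP : Type*} [NormedAddCommGroup EP] [NormedSpace ℝ EP] [FiniteDimensional ℝ EP]
  {P : Type*} [TopologicalSpace P] [ChartedSpace EP P] [IsManifold 𝓘(ℝ, EP) ∞ P]
  (B : PrincipalBundle E G EN N EP P) (θ : Form (mfdD EP P) 1 E)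

theorem proj_dsmooth : Smooth (mfdD EP P) (mfdD EN N) B.proj := smooth_of_contMDiff B.proj_smooth

open Classical in
/-- The classical Chern–Weil map of a principal bundle `P → N` with connection `θ`, on the level
of forms: `f ∈ S^k(𝔤^*)^G` is mapped to the form on `N` whose pull-back to `P` is `f(Ω)`. -/
def classicalForm (f : InvPolys E G) : DeRham (mfdD EN N) :=
  ∑ k ∈ DFinsupp.support f, deRhamInc (mfdD EN N) (k * 2)
    (descend B.proj (proj_dsmooth B) (chernForm G (f k) θ))

/-- The classical Chern–Weil map `S(𝔤^*)^G → H^*_{dR}(N)`. -/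
def classicalMap (f : InvPolys E G) : DeRhamCohomology (mfdD EN N) :=
  deRhamClass (mfdD EN N) (classicalForm B θ f)

end ClassicalChernWeil

section ColumnZero

variable {EΓ : Type*} [NormedAddCommGroup EΓ] [NormedSpace ℝ EΓ] [FiniteDimensional ℝ EΓ]
  {Γ : Type*} [TopologicalSpace Γ] [ChartedSpace EΓ Γ] [IsManifold 𝓘(ℝ, EΓ) ∞ Γ]
  {E₀ : Type*} [NormedAddCommGroup E₀] [NormedSpace ℝ E₀] [FiniteDimensional ℝ E₀]
  {Γ₀ : Type*} [TopologicalSpace Γ₀] [ChartedSpace E₀ Γ₀] [IsManifold 𝓘(ℝ, E₀) ∞ Γ₀]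
  (Gd : LieGroupoid EΓ Γ E₀ Γ₀)

theorem nerveZero_smooth : Smooth (nerveD Gd 0) (mfdD E₀ Γ₀) fun s => s.1.1 0 :=
  fun _ _ hp => ((mem_plots_nerveD Gd).1 hp).1 0

/-- The inclusion `Ω^*(Γ₀) → ⨁ Ω^q(Γₙ)` of the forms on `Γ₀` (the column `n = 0`). -/
def columnZero : DeRham (mfdD E₀ Γ₀) →ₗ[ℝ] TotForm Gd :=
  DirectSum.toModule ℝ ℕ (TotForm Gd) fun q =>
    totInc Gd 0 q ∘ₗ pullback (fun s : Nerve Gd 0 => s.1.1 0) (nerveZero_smooth Gd)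

end ColumnZero

section BottShulman

variable (E : Type*) [NormedAddCommGroup E] [NormedSpace ℝ E] [FiniteDimensional ℝ E]
  (G : Type*) [TopologicalSpace G] [ChartedSpace E G] [Group G] [LieGroup 𝓘(ℝ, E) ∞ G]

/-- The simplicial universal bundle `Gⁿ⁺¹ → Gⁿ`,
`(g₀, …, gₙ) ↦ (g₀ g₁⁻¹, …, gₙ₋₁ gₙ⁻¹)`. -/
def universalProj (n : ℕ) (g : Fin (n + 1) → G) : Nerve (groupGroupoid E G) n :=
  ⟨(fun _ => 0, fun i => g i.castSucc * (g i.succ)⁻¹), fun _ => ⟨rfl, rfl⟩⟩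

theorem universalProj_smooth (n : ℕ) : Smooth (piD (Fin (n + 1)) (mfdD E G))
    (nerveD (groupGroupoid E G) n) (universalProj E G n) := fun _ _ hp =>
  (mem_plots_nerveD _).2 ⟨fun _ => contMDiff_const, fun i =>
    ContMDiff.mul (mem_plots_piD.1 hp i.castSucc) (ContMDiff.inv (mem_plots_piD.1 hp i.succ))⟩

/-- The projection `Δₙ × Gⁿ⁺¹ → Δₙ × Gⁿ`. -/
def simplexUniversalProj (n : ℕ) :
    EE n × (Fin (n + 1) → G) → EE n × Nerve (groupGroupoid E G) n :=
  Prod.map id (universalProj E G n)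

theorem simplexUniversalProj_smooth (n : ℕ) :
    Smooth (prodD (mfdD (EE n) (EE n)) (piD (Fin (n + 1)) (mfdD E G)))
      (prodD (mfdD (EE n) (EE n)) (nerveD (groupGroupoid E G) n)) (simplexUniversalProj E G n) :=
  smooth_prodMap (smooth_id _) (universalProj_smooth E G n)

/-- The canonical connection `∑ᵢ tᵢ pr_i^* θ₀` on `Δₙ × Gⁿ⁺¹ → Δₙ × Gⁿ`, where `θ₀` is the left
Maurer–Cartan form. -/
def universalConnection (n : ℕ) :
    Form (prodD (mfdD (EE n) (EE n)) (piD (Fin (n + 1)) (mfdD E G))) 1 E :=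
  simplexForm (fun i (g : Fin (n + 1) → G) => g i) (fun i => smooth_eval _ i) (maurerCartan E G)

variable {E G}

/-- The Bott–Shulman cochain of `f ∈ S^k(𝔤^*)^G`: the Chern–Weil form of the canonical connection,
descended to `Δₙ × Gⁿ` and integrated over `Δₙ`. -/
def bottShulmanHom {k : ℕ} (f : InvPoly E G k) : TotForm (groupGroupoid E G) :=
  integrateSimplices fun n => descend (simplexUniversalProj E G n)
    (simplexUniversalProj_smooth E G n) (chernForm G f (universalConnection E G n))

open Classical in
/-- The Bott–Shulman map into the forms on `G_•`. -/
def bottShulmanForm (f : InvPolys E G) : TotForm (groupGroupoid E G) :=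
  ∑ k ∈ DFinsupp.support f, bottShulmanHom (f k)

/-- The Bott–Shulman map `S(𝔤^*)^G → H^*_{dR}(G_•)`. -/
def bottShulmanMap (f : InvPolys E G) : TotCohomology (groupGroupoid E G) :=
  totClass (groupGroupoid E G) (bottShulmanForm f)

end BottShulman

end ChernWeil

end

open ChernWeil

open scoped Manifold ContDiff Topology

set_option linter.unusedSectionVars false

noncomputable section

open MeasureTheory

namespace ChernWeil

/-! ### Locality of forms and descent along maps with local lifts. -/

section Localization

/-! The core of the proof is gauge invariance. If a `𝔤`-valued one-form changes by `a ↦ Ad(g⁻¹) a +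
g⁻¹dg`, its curvature is merely conjugated (`extDeriv_add_lieBr_gauge`, which rests on the
Maurer–Cartan equation `extD_maurerCartan` and on the derivative of `Ad` in `hasFDerivAt_Ad`), so
`f(Ω)` is unchanged for invariant `f`. Since forms are families indexed by plots, descent takes a
plotwise shape: a form descends along `π` when plots lift locally along `π` and its value depends
only on the projected plot (`descends_of_forall_eq`). Two plots of `P` with the same projection
differ by a smooth `g : ℝᵐ → G`; for `Qₙ` a single `g` serves all vertices, because `Γ` and `G`
commute, and an affine combination of connections transforms like each of them. Hence all Chern–Weil
forms descend. They are closed (`extD_chernForm`) for a related reason: a gauge transformation can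
make the one-form vanish at a given point, and there `f(Ω)` agrees to first order with the closed
form `f(da)`, so no Bianchi identity is needed.

On the face `tᵢ = 0` the `i`-th summand of `θ̃` disappears, so the descended forms on `Δₙ × Γₙ`
match under faces and cofaces: they make up a closed simplicial form. Stokes' theorem along the
fibres (`simplexIntegral_succ_extD`) makes the integration of simplicial forms a chain map
(`totD_intTotal`), whence `z_θ(f)` is a cocycle. The same argument on `Δ₁ × Δₙ × Qₙ`, with the
connection interpolating between two given ones, gives independence of the connection
(`exists_totD_eq_sub`, `wMap_eq`).

For the groupoid `M ⇉ M` every `Mₙ` is `M` and every face map is the identity, so the simplicial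
differential out of column `n` is `0` for even `n` and the identity for odd `n`. The column `n = 0`
is therefore a deformation retract of the total complex (`unitHomotopy_spec`). The column-zero
component of `z_θ(f)` is the classical form, because `θ̃₀ = θ`, and a cocycle is cohomologous to its
retraction.

For the groupoid `G ⇉ pt` a string in `Qₙ` is determined by its vertices, which are arbitrary.
Through `universalString` the connection `θ̃ₙ` becomes the universal connection on `Gⁿ⁺¹`, and the
two descended forms agree by uniqueness. Thus the cochains are equal, and the classes agree for
every connection by independence. -/

/-- Plots have all of `ℝᵐ` as domain. Precomposition with `β` turns data that are given or valid
only near `x` into global plots without changing them near `x`. The map is `y ↦ x + χ(y) (y - x)`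
for a bump function `χ` at `x`. -/
theorem exists_localizer {m : ℕ} {U : Set (EE m)} {x : EE m} (hU : U ∈ 𝓝 x) :
    ∃ β : EE m → EE m, ContDiff ℝ ∞ β ∧ (∀ y, β y ∈ U) ∧ ∀ᶠ y in 𝓝 x, β y = y := by
  obtain ⟨ε, hε, hεU⟩ := Metric.mem_nhds_iff.1 hU
  let χ : ContDiffBump x := ⟨ε / 2, ε, by linarith, by linarith⟩
  refine ⟨fun y => x + χ y • (y - x), ?_, fun y => hεU ?_, ?_⟩
  · exact contDiff_const.add (χ.contDiff.smul (contDiff_id.sub contDiff_const))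
  · rw [Metric.mem_ball, dist_eq_norm, add_sub_cancel_left, norm_smul, Real.norm_eq_abs,
      abs_of_nonneg χ.nonneg]
    by_cases hy : dist y x < ε
    · refine lt_of_le_of_lt (mul_le_of_le_one_left (norm_nonneg _) χ.le_one) ?_
      rwa [← dist_eq_norm]
    · rw [χ.zero_of_le_dist (not_lt.1 hy), zero_mul]
      exact hε
  · filter_upwards [Metric.closedBall_mem_nhds x (show 0 < ε / 2 by linarith)] with y hy
    rw [χ.one_of_mem_closedBall hy, one_smul, add_sub_cancel]

variable {X Y Z : Type*} {D : DiffeologicalSpace X} {D' : DiffeologicalSpace Y}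
  {D'' : DiffeologicalSpace Z} {k : ℕ} {V : Type*} [NormedAddCommGroup V] [NormedSpace ℝ V]

theorem form_ext {w w' : Form D k V}
    (h : ∀ (m : ℕ) (p : D.plots m) (x : EE m) (v : Fin k → EE m), w.1 m p x v = w'.1 m p x v) :
    w = w' := by
  apply Subtype.ext
  funext m p x
  ext v
  exact h m p x v

/-- The value of a form at a plot as a linear map in the form. -/
def formEval {m : ℕ} (p : D.plots m) (x : EE m) (v : Fin k → EE m) : Form D k V →ₗ[ℝ] V where
  toFun w := w.1 m p x v
  map_add' _ _ := rfl
  map_smul' _ _ := rfl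

theorem form_sum_apply {ι : Type*} (s : Finset ι) (w : ι → Form D k V) {m : ℕ} (p : D.plots m)
    (x : EE m) (v : Fin k → EE m) : (∑ i ∈ s, w i).1 m p x v = ∑ i ∈ s, (w i).1 m p x v :=
  map_sum (formEval p x v) w s

/-- Compatibility for a plot that is only propositionally a composite; the membership proofs are
free, which avoids rewriting under a dependent type. -/
theorem form_compat_mk (w : Form D k V) {m n : ℕ} {p : EE n → X} (hp : p ∈ D.plots n)
    {f : EE m → EE n} (hf : ContDiff ℝ ∞ f) {q : EE m → X} (hq : q ∈ D.plots m) (h : q = p ∘ f)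
    (x : EE m) (v : Fin k → EE m) :
    w.1 m ⟨q, hq⟩ x v = w.1 n ⟨p, hp⟩ (f x) (fun i => fderiv ℝ f x (v i)) := by
  subst h
  exact congrArg (fun a => a v) (form_compat w ⟨p, hp⟩ hf x)

/-- Forms are local. -/
theorem form_congr_nhds (w : Form D k V) {m : ℕ} {p q : D.plots m} {x : EE m}
    (h : p.1 =ᶠ[𝓝 x] q.1) : w.1 m p x = w.1 m q x := by
  obtain ⟨β, hβ, hβU, hβx⟩ := exists_localizer h
  -- Near `x` the map `β` is the identity, so its derivative at `x` is the identity and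
  -- compatibility with `β` preserves the value.
  have key : ∀ r : D.plots m, ∀ v, w.1 m ⟨r.1 ∘ β, D.plot_reparam r.2 hβ⟩ x v = w.1 m r x v := by
    intro r v
    rw [form_compat_mk w r.2 hβ _ rfl, hβx.self_of_nhds,
      Filter.EventuallyEq.fderiv_eq (f := id) hβx]
    simp
  have he : p.1 ∘ β = q.1 ∘ β := funext fun y => hβU y
  ext v
  rw [← key p v, ← key q v]
  exact congrArg (fun r : D.plots m => w.1 m r x v) (Subtype.ext he)

/-- Plots of the target lift locally along `π`. -/
def LocallyLifts (D : DiffeologicalSpace X) (D' : DiffeologicalSpace Y) (π : X → Y) : Prop :=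
  ∀ (m : ℕ) (p : EE m → Y), p ∈ D'.plots m → ∀ x : EE m, ∃ q ∈ D.plots m, ∀ᶠ y in 𝓝 x, π (q y) = p y

theorem LocallyLifts.prodMap {π : X → Y} (h : LocallyLifts D D' π) :
    LocallyLifts (prodD D'' D) (prodD D'' D') (Prod.map id π) := by
  intro m p hp x
  obtain ⟨q, hq, hqx⟩ := h m _ (mem_plots_prodD.1 hp).2 x
  refine ⟨fun y => ((p y).1, q y), mem_plots_prodD.2 ⟨(mem_plots_prodD.1 hp).1, hq⟩, ?_⟩
  filter_upwards [hqx] with y hy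
  exact Prod.ext rfl hy

/-- By locality, the value at a point of a plot can be computed from the projection of a local lift,
hence from the pulled-back form. Later identities on the base are all verified upstairs through
this. -/
theorem pullback_injective {π : X → Y} (hπ : Smooth D D' π) (hl : LocallyLifts D D' π) :
    Function.Injective (pullback (k := k) (V := V) π hπ) := by
  intro w w' h
  refine form_ext fun m p x v => ?_
  obtain ⟨q, hq, hqx⟩ := hl m p.1 p.2 x
  have e : ∀ w : Form D' k V, w.1 m p x v = (pullback π hπ w).1 m ⟨q, hq⟩ x v := by
    intro w
    rw [form_congr_nhds w (p := p) (q := ⟨π ∘ q, hπ m q hq⟩)]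
    · rfl
    · filter_upwards [hqx] with y hy using hy.symm
  rw [e, e, h]

/-- The assumption concerns plots whose projections agree everywhere; a localizer reduces
projections that agree only near `x` to that case. -/
theorem form_eq_of_nhds {π : X → Y} {w : Form D k V}
    (h : ∀ (m : ℕ) (q q' : D.plots m), (∀ y, π (q.1 y) = π (q'.1 y)) → w.1 m q = w.1 m q')
    {m : ℕ} {q q' : D.plots m} {x : EE m} (hx : ∀ᶠ y in 𝓝 x, π (q.1 y) = π (q'.1 y)) :
    w.1 m q x = w.1 m q' x := by
  obtain ⟨β, hβ, hβU, hβx⟩ := exists_localizer hx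
  have key : ∀ r : D.plots m, w.1 m ⟨r.1 ∘ β, D.plot_reparam r.2 hβ⟩ x = w.1 m r x := by
    intro r
    refine form_congr_nhds w ?_
    filter_upwards [hβx] with y hy
    simp [hy]
  rw [← key q, ← key q', h m ⟨q.1 ∘ β, D.plot_reparam q.2 hβ⟩
    ⟨q'.1 ∘ β, D.plot_reparam q'.2 hβ⟩ fun y => hβU y]

/-- A form descends along `π` if plots lift locally and the form only depends on the projections
of the plots. -/
theorem descends_of_forall_eq {π : X → Y} (hπ : Smooth D D' π) (hl : LocallyLifts D D' π)
    {w : Form D k V}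
    (h : ∀ (m : ℕ) (q q' : D.plots m), (∀ y, π (q.1 y) = π (q'.1 y)) → w.1 m q = w.1 m q') :
    Descends π hπ w := by
  choose q hq hqx using hl
  -- The lift is chosen anew for every point `x`. By `hη` any other lift near `x` gives the same
  -- value, so near `x` a single lift can be used to check smoothness.
  let η : ∀ m, D'.plots m → EE m → (EE m) [⋀^Fin k]→L[ℝ] V := fun m p x =>
    w.1 m ⟨q m p.1 p.2 x, hq m p.1 p.2 x⟩ x
  have hη : ∀ (m : ℕ) (p : D'.plots m) (r : D.plots m) (x : EE m),
      (∀ᶠ y in 𝓝 x, π (r.1 y) = p.1 y) → η m p x = w.1 m r x := by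
    intro m p r x hr
    refine form_eq_of_nhds h ?_
    filter_upwards [hr, hqx m p.1 p.2 x] with y h1 h2
    exact h2.trans h1.symm
  have hform : IsForm D' η := by
    refine ⟨fun m p => contDiff_iff_contDiffAt.2 fun x => ?_, fun m n p f hf x => ?_⟩
    · have h1 := (form_smooth w m ⟨q m p.1 p.2 x, hq m p.1 p.2 x⟩).contDiffAt (x := x)
      refine h1.congr_of_eventuallyEq ?_
      filter_upwards [eventually_eventually_nhds.2 (hqx m p.1 p.2 x)] with y hy
      exact hη m p ⟨q m p.1 p.2 x, hq m p.1 p.2 x⟩ y hy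
    · have h1 := hη m ⟨p.1 ∘ f, D'.plot_reparam p.2 hf⟩
        ⟨q n p.1 p.2 (f x) ∘ f, D.plot_reparam (hq n p.1 p.2 (f x)) hf⟩ x
        (hf.continuous.continuousAt.eventually (hqx n p.1 p.2 (f x)))
      rw [h1]
      exact form_compat w ⟨q n p.1 p.2 (f x), hq n p.1 p.2 (f x)⟩ hf x
  refine ⟨⟨η, hform⟩, ?_, fun η' hη' => ?_⟩
  · apply Subtype.ext
    funext m r x
    exact hη m ⟨π ∘ r.1, hπ m r.1 r.2⟩ r x (Filter.Eventually.of_forall fun _ => rfl)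
  · refine pullback_injective hπ (fun m p hp x => ⟨q m p hp x, hq m p hp x, hqx m p hp x⟩) ?_
    rw [hη']
    apply Subtype.ext
    funext m r x
    exact (hη m ⟨π ∘ r.1, hπ m r.1 r.2⟩ r x (Filter.Eventually.of_forall fun _ => rfl)).symm

theorem pullback_descend {π : X → Y} {hπ : Smooth D D' π} {w : Form D k V} (h : Descends π hπ w) :
    pullback π hπ (descend π hπ w) = w := by
  unfold descend
  rw [dif_pos h.exists]
  exact h.exists.choose_spec

theorem descend_eq {π : X → Y} {hπ : Smooth D D' π} (hl : LocallyLifts D D' π) {w : Form D k V}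
    {η : Form D' k V} (h : pullback π hπ η = w) : descend π hπ w = η := by
  have h' : ∃ η : Form D' k V, pullback π hπ η = w := ⟨η, h⟩
  unfold descend
  rw [dif_pos h']
  exact pullback_injective hπ hl (h'.choose_spec.trans h.symm)

theorem smooth_comp {f : X → Y} {g : Y → Z} (hg : Smooth D' D'' g) (hf : Smooth D D' f) :
    Smooth D D'' (g ∘ f) := fun m p hp => hg m _ (hf m p hp)

theorem pullback_congr {f g : X → Y} (h : f = g) (hf : Smooth D D' f) (hg : Smooth D D' g)
    (w : Form D' k V) : pullback f hf w = pullback g hg w := by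
  subst h
  rfl

theorem pullback_extD {f : X → Y} (hf : Smooth D D' f) (w : Form D' k V) :
    pullback f hf (extD w) = extD (pullback f hf w) := rfl

variable {E : Type*} [NormedAddCommGroup E] [NormedSpace ℝ E] [FiniteDimensional ℝ E]
  {G : Type*} [TopologicalSpace G] [ChartedSpace E G] [Group G] [LieGroup 𝓘(ℝ, E) ∞ G]

/-- True by definition: pull-back only re-indexes plots, while exterior derivative, bracket and
evaluation are computed plot by plot. -/
theorem pullback_chernForm {f : X → Y} (hf : Smooth D D' f) {k : ℕ} (s : InvPoly E G k)
    (θ : Form D' 1 E) : pullback f hf (chernForm G s θ) = chernForm G s (pullback f hf θ) := rfl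

end Localization

/-! ### Left logarithmic derivatives and chart plots of a Lie group. -/

section MaurerCartan

variable {E : Type*} [NormedAddCommGroup E] [NormedSpace ℝ E] [FiniteDimensional ℝ E]
  {G : Type*} [TopologicalSpace G] [ChartedSpace E G] [Group G] [LieGroup 𝓘(ℝ, E) ∞ G]

/-- The derivative of a map between manifolds, as a map of the model spaces. -/
def modelDeriv (E₁ E₂ : Type*) [NormedAddCommGroup E₁] [NormedSpace ℝ E₁] [NormedAddCommGroup E₂]
    [NormedSpace ℝ E₂] {M₁ M₂ : Type*} [TopologicalSpace M₁] [ChartedSpace E₁ M₁]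
    [TopologicalSpace M₂] [ChartedSpace E₂ M₂] (f : M₁ → M₂) (x : M₁) : E₁ →L[ℝ] E₂ :=
  mfderiv 𝓘(ℝ, E₁) 𝓘(ℝ, E₂) f x

theorem modelDeriv_comp {E₁ E₂ E₃ : Type*} [NormedAddCommGroup E₁] [NormedSpace ℝ E₁]
    [NormedAddCommGroup E₂] [NormedSpace ℝ E₂] [NormedAddCommGroup E₃] [NormedSpace ℝ E₃]
    {M₁ M₂ M₃ : Type*} [TopologicalSpace M₁] [ChartedSpace E₁ M₁] [TopologicalSpace M₂]
    [ChartedSpace E₂ M₂] [TopologicalSpace M₃] [ChartedSpace E₃ M₃] {f : M₁ → M₂} {g : M₂ → M₃}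
    {x : M₁} {y : M₂} (hg : MDifferentiableAt 𝓘(ℝ, E₂) 𝓘(ℝ, E₃) g y)
    (hf : MDifferentiableAt 𝓘(ℝ, E₁) 𝓘(ℝ, E₂) f x) (hy : f x = y) :
    modelDeriv E₁ E₃ (g ∘ f) x = (modelDeriv E₂ E₃ g y).comp (modelDeriv E₁ E₂ f x) := by
  subst hy
  exact mfderiv_comp x hg hf

theorem contMDiff_mul_const_left (g : G) : ContMDiff 𝓘(ℝ, E) 𝓘(ℝ, E) ∞ (fun h : G => g * h) :=
  contMDiff_const.mul contMDiff_id

theorem contMDiff_conj (g : G) : ContMDiff 𝓘(ℝ, E) 𝓘(ℝ, E) ∞ (fun h : G => g * h * g⁻¹) :=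
  (contMDiff_mul_const_left g).mul contMDiff_const

theorem contMDiff_div_left {m : ℕ} {g : EE m → G} (hg : ContMDiff 𝓘(ℝ, EE m) 𝓘(ℝ, E) ∞ g)
    (c : G) : ContMDiff 𝓘(ℝ, EE m) 𝓘(ℝ, E) ∞ fun y => c * g y :=
  (contMDiff_mul_const_left c).comp hg

theorem modelDeriv_eq_leftDeriv {m : ℕ} {g : EE m → G} (hg : ContMDiff 𝓘(ℝ, EE m) 𝓘(ℝ, E) ∞ g)
    (x : EE m) : modelDeriv (EE m) E g x =
      (modelDeriv E E (fun h : G => g x * h) 1).comp (leftDeriv E g x) := by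
  have h := modelDeriv_comp
    ((contMDiff_mul_const_left (E := E) (g x)).mdifferentiableAt (by simp))
    ((contMDiff_div_left hg (g x)⁻¹).mdifferentiableAt (by simp) (x := x)) (inv_mul_cancel (g x))
  refine Eq.trans ?_ h
  congr 1
  funext y
  exact (mul_inv_cancel_left _ _).symm

theorem leftDeriv_eq_modelDeriv {m : ℕ} {g : EE m → G} (hg : ContMDiff 𝓘(ℝ, EE m) 𝓘(ℝ, E) ∞ g)
    (x : EE m) : leftDeriv E g x =
      (modelDeriv E E (fun h : G => (g x)⁻¹ * h) (g x)).comp (modelDeriv (EE m) E g x) :=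
  modelDeriv_comp ((contMDiff_mul_const_left (E := E) (g x)⁻¹).mdifferentiableAt (by simp))
    (hg.mdifferentiableAt (by simp)) rfl

/-- Chain rule for `(c g(x) c⁻¹)⁻¹ (c g(y) c⁻¹) = c (g(x)⁻¹ g(y)) c⁻¹`. -/
theorem leftDeriv_conj {m : ℕ} {g : EE m → G} (hg : ContMDiff 𝓘(ℝ, EE m) 𝓘(ℝ, E) ∞ g) (c : G)
    (x v : EE m) : leftDeriv E (fun y => c * g y * c⁻¹) x v = Ad E c (leftDeriv E g x v) := by
  have h := modelDeriv_comp ((contMDiff_conj (E := E) c).mdifferentiableAt (by simp))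
    ((contMDiff_div_left hg (g x)⁻¹).mdifferentiableAt (by simp) (x := x)) (inv_mul_cancel (g x))
  refine Eq.trans ?_ (congrArg (fun L : EE m →L[ℝ] E => L v) h)
  refine congrArg (fun f : EE m → G => modelDeriv (EE m) E f x v) (funext fun y => ?_)
  simp [mul_assoc]

theorem leftDeriv_const_mul {m : ℕ} (g : EE m → G) (c : G) (x : EE m) :
    leftDeriv E (fun y => c * g y) x = leftDeriv E g x := by
  refine congrArg (fun f : EE m → G => modelDeriv (EE m) E f x) (funext fun y => ?_)
  simp [mul_assoc]

/-- Left translation does not affect `leftDeriv`, and up to a left translation `g c` is the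
conjugate `c⁻¹ g c`. -/
theorem leftDeriv_mul_const {m : ℕ} {g : EE m → G} (hg : ContMDiff 𝓘(ℝ, EE m) 𝓘(ℝ, E) ∞ g) (c : G)
    (x v : EE m) : leftDeriv E (fun y => g y * c) x v = Ad E c⁻¹ (leftDeriv E g x v) := by
  rw [← leftDeriv_conj hg, ← leftDeriv_const_mul (E := E) (fun y => g y * c) c⁻¹]
  simp [mul_assoc]

theorem contDiff_leftDeriv_clm {m : ℕ} {p : EE m → G} (hp : ContMDiff 𝓘(ℝ, EE m) 𝓘(ℝ, E) ∞ p) :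
    ContDiff ℝ ∞ fun x => leftDeriv E p x :=
  contDiff_clm_apply_iff.2 fun u => contDiff_leftDeriv hp u

theorem groupBundle_maurerCartan_isConnection :
    IsConnection (groupBundle E G).toPrincipalBundle (maurerCartan E G) where
  equivariant g n c x v := leftDeriv_mul_const c.2 g x (v 0)
  vertical p := by
    refine form_ext fun m q x v => ?_
    exact congrArg (fun L : EE m →L[ℝ] E => L (v 0)) (leftDeriv_const_mul q.1 p x)

/-- A plot of a Lie group whose derivative is invertible at `y₀`. -/
theorem exists_chartPlot (g₀ : G) : ∃ (c : EE (Module.finrank ℝ E) → G)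
    (y₀ : EE (Module.finrank ℝ E)), ContMDiff 𝓘(ℝ, EE (Module.finrank ℝ E)) 𝓘(ℝ, E) ∞ c ∧ c y₀ = g₀ ∧
    (leftDeriv E c y₀).IsInvertible ∧
    ∀ (m : ℕ) (p : EE m → G) (x : EE m), ContMDiff 𝓘(ℝ, EE m) 𝓘(ℝ, E) ∞ p → p x = g₀ →
      ∃ γ : EE m → EE (Module.finrank ℝ E), ContDiff ℝ ∞ γ ∧ γ x = y₀ ∧ p =ᶠ[𝓝 x] c ∘ γ := by
  have h1 : IsManifold 𝓘(ℝ, E) 1 G := IsManifold.of_le (n := ∞) (by simp)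
  let e : E ≃L[ℝ] EE (Module.finrank ℝ E) := toEuclidean
  let φ := extChartAt 𝓘(ℝ, E) g₀
  have hT : IsOpen φ.target := isOpen_extChartAt_target g₀
  let y₀ := e (φ g₀)
  have hU : e.symm ⁻¹' φ.target ∈ 𝓝 y₀ :=
    (hT.preimage e.symm.continuous).mem_nhds (by simp [y₀, φ])
  -- The inverse chart is smooth only on the target of the chart; `β` moves all of Euclidean space
  -- into it.
  obtain ⟨β, hβ, hβU, hβy⟩ := exists_localizer hU
  have hs : ContMDiffOn 𝓘(ℝ, E) 𝓘(ℝ, E) ∞ φ.symm φ.target := contMDiffOn_extChartAt_symm g₀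
  have hc : ContMDiff 𝓘(ℝ, EE (Module.finrank ℝ E)) 𝓘(ℝ, E) ∞ fun y => φ.symm (e.symm (β y)) :=
    hs.comp_contMDiff (e.symm.contDiff.comp hβ).contMDiff hβU
  have hy₀ : β y₀ = y₀ := hβy.self_of_nhds
  have hc₀ : φ.symm (e.symm (β y₀)) = g₀ := by
    rw [hy₀, e.symm_apply_apply, extChartAt_to_inv]
  refine ⟨fun y => φ.symm (e.symm (β y)), y₀, hc, hc₀, ?_, ?_⟩
  · -- the inverse is the derivative of `e ∘ φ ∘ (g₀ * ·)`
    have hφ : MDifferentiableAt 𝓘(ℝ, E) 𝓘(ℝ, E) φ g₀ :=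
      mdifferentiableAt_extChartAt (mem_chart_source E g₀)
    have hφi : (modelDeriv E E φ g₀).IsInvertible :=
      isInvertible_mfderiv_extChartAt (mem_extChartAt_source g₀)
    have hcomp : (modelDeriv E E φ g₀).comp
        (modelDeriv (EE (Module.finrank ℝ E)) E (fun y => φ.symm (e.symm (β y))) y₀) =
        e.symm.toContinuousLinearMap := by
      rw [← modelDeriv_comp hφ (hc.mdifferentiableAt (by simp)) hc₀]
      have h2 : (φ ∘ fun y => φ.symm (e.symm (β y))) =ᶠ[𝓝 y₀] e.symm := by
        filter_upwards [hβy, hU] with y hy hy'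
        simp only [Function.comp, hy]
        exact φ.right_inv hy'
      refine (Filter.EventuallyEq.mfderiv_eq h2).trans ?_
      rw [mfderiv_eq_fderiv]
      exact e.symm.fderiv
    rw [leftDeriv_eq_modelDeriv hc]
    refine ContinuousLinearMap.IsInvertible.comp ?_ ?_
    -- Translations by `a` and `a⁻¹` are inverse, hence so are their derivatives; both composites
    -- are instances of this.
    · have hl : ∀ (a b c : G), c = a⁻¹ → (modelDeriv E E (fun h : G => a * h) (c * b)).comp
          (modelDeriv E E (fun h : G => c * h) b) = ContinuousLinearMap.id ℝ E := by
        rintro a b _ rfl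
        rw [← modelDeriv_comp ((contMDiff_mul_const_left a).mdifferentiableAt (by simp))
          ((contMDiff_mul_const_left a⁻¹).mdifferentiableAt (by simp)) rfl]
        rw [show ((fun h : G => a * h) ∘ fun h => a⁻¹ * h) = id by funext h; simp]
        exact mfderiv_id
      refine ContinuousLinearMap.IsInvertible.of_inverse (g := modelDeriv E E
        (fun h : G => φ.symm (e.symm (β y₀)) * h)
          ((φ.symm (e.symm (β y₀)))⁻¹ * φ.symm (e.symm (β y₀)))) ?_ ?_
      · have := hl (φ.symm (e.symm (β y₀)))⁻¹
          ((φ.symm (e.symm (β y₀)))⁻¹ * φ.symm (e.symm (β y₀))) _ (inv_inv _).symm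
        rwa [mul_inv_cancel_left] at this
      · exact hl _ _ _ rfl
    · obtain ⟨f, hf⟩ := hφi
      refine ⟨e.symm.trans f.symm, ?_⟩
      ext v
      have h3 := congrArg (fun L : EE (Module.finrank ℝ E) →L[ℝ] E => f.symm (L v)) hcomp
      rw [← hf] at h3
      simpa using h3.symm
  -- Near `x` the curve `γ` is the coordinate expression of `p`. One localizer `α` keeps `p` in the
  -- chart domain, and `β`, built into the plot, is inactive near `y₀`.
  · intro m p x hp hpx
    have hsrc : p ⁻¹' φ.source ∈ 𝓝 x :=
      hp.continuous.continuousAt.preimage_mem_nhds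
        (by rw [hpx]; exact extChartAt_source_mem_nhds g₀)
    have hφs : ContMDiffOn 𝓘(ℝ, E) 𝓘(ℝ, E) ∞ φ φ.source := by
      rw [extChartAt_source]
      exact contMDiffOn_extChartAt
    obtain ⟨α, hα, hαU, hαx⟩ := exists_localizer hsrc
    have hx : α x = x := hαx.self_of_nhds
    have hγ : ContDiff ℝ ∞ fun y => e (φ (p (α y))) :=
      e.contDiff.comp (contMDiff_iff_contDiff.1
        (hφs.comp_contMDiff (hp.comp hα.contMDiff) fun y => hαU y))
    have hγx : e (φ (p (α x))) = y₀ := by rw [hx, hpx]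
    refine ⟨fun y => e (φ (p (α y))), hγ, hγx, ?_⟩
    have h4 : ∀ᶠ y in 𝓝 x, β (e (φ (p (α y)))) = e (φ (p (α y))) :=
      (hγ.continuous.tendsto' x y₀ hγx).eventually hβy
    filter_upwards [h4, hαx, hsrc] with y h5 h6 h7
    change p y = φ.symm (e.symm (β (e (φ (p (α y))))))
    rw [h5, h6, e.symm_apply_apply]
    exact (φ.left_inv h7).symm

/-- A group-valued map with prescribed first-order jet: compose the chart plot at `1` with an affine
map whose slope is `L` followed by the inverse of the derivative of the chart plot. It realizes Lie
algebra elements as velocities, and supplies the gauge transformation that kills a one-form at a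
point. -/
theorem exists_plot_leftDeriv {m : ℕ} (x : EE m) (L : EE m →L[ℝ] E) : ∃ h : EE m → G,
    ContMDiff 𝓘(ℝ, EE m) 𝓘(ℝ, E) ∞ h ∧ h x = 1 ∧ leftDeriv E h x = L := by
  obtain ⟨c, y₀, hc, hc1, ⟨f, hf⟩, -⟩ := exists_chartPlot (E := E) (1 : G)
  let γ : EE m → EE (Module.finrank ℝ E) := fun y => y₀ + (f.symm.toContinuousLinearMap.comp L) (y - x)
  have hγ : ContDiff ℝ ∞ γ := contDiff_const.add
    ((f.symm.toContinuousLinearMap.comp L).contDiff.comp (contDiff_id.sub contDiff_const))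
  have hγx : γ x = y₀ := by simp [γ]
  have hd : fderiv ℝ γ x = f.symm.toContinuousLinearMap.comp L := by
    have : HasFDerivAt γ (f.symm.toContinuousLinearMap.comp L) x := by
      have h1 := (f.symm.toContinuousLinearMap.comp L).hasFDerivAt.comp x
        ((hasFDerivAt_id x).sub_const x)
      exact (h1.const_add y₀)
    exact this.fderiv
  refine ⟨c ∘ γ, hc.comp hγ.contMDiff, by simp [hγx, hc1], ?_⟩
  rw [leftDeriv_comp hc hγ, hγx, hd, ← hf]
  ext v
  simp

end MaurerCartan

/-! ### The Maurer–Cartan equation. -/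

section MaurerCartanEquation

variable {E : Type*} [NormedAddCommGroup E] [NormedSpace ℝ E] [FiniteDimensional ℝ E]
  {G : Type*} [TopologicalSpace G] [ChartedSpace E G] [Group G] [LieGroup 𝓘(ℝ, E) ∞ G]

theorem eventually_isInvertible_leftDeriv {m : ℕ} {c : EE m → G}
    (hc : ContMDiff 𝓘(ℝ, EE m) 𝓘(ℝ, E) ∞ c) {y₀ : EE m} (h : (leftDeriv E c y₀).IsInvertible) :
    ∀ᶠ y in 𝓝 y₀, (leftDeriv E c y).IsInvertible := by
  obtain ⟨e, he⟩ := h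
  have h1 := (contDiff_leftDeriv_clm hc).continuous.continuousAt (x := y₀)
  have h2 := e.nhds
  rw [he] at h2
  exact h1.eventually h2

/-- The two vector fields are, near `y₀`, the pull-backs along `c` of the left-invariant fields of
`ξ` and `η`. Pull-back commutes with brackets, and the bracket of left-invariant fields is the
left-invariant field of the Lie algebra bracket. -/
theorem lieBracket_invariantFields {m : ℕ} {c : EE m → G}
    (hc : ContMDiff 𝓘(ℝ, EE m) 𝓘(ℝ, E) ∞ c) {y₀ : EE m} (h : (leftDeriv E c y₀).IsInvertible)
    (ξ η : E) : VectorField.lieBracket ℝ (fun y => (leftDeriv E c y).inverse ξ)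
      (fun y => (leftDeriv E c y).inverse η) y₀ = (leftDeriv E c y₀).inverse (lieBr E G ξ η) := by
  have : CompleteSpace E := FiniteDimensional.complete ℝ E
  have : LieGroup 𝓘(ℝ, E) (minSmoothness ℝ 3) G := by
    rw [minSmoothness_of_isRCLikeNormedField]
    infer_instance
  have : IsManifold 𝓘(ℝ, E) (minSmoothness ℝ 2) G := by
    rw [minSmoothness_of_isRCLikeNormedField]
    exact IsManifold.of_le (n := ∞) ENat.LEInfty.out
  have hfield : ∀ (ζ : GroupLieAlgebra 𝓘(ℝ, E) G), ∀ y, (leftDeriv E c y).IsInvertible →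
      VectorField.mpullback 𝓘(ℝ, EE m) 𝓘(ℝ, E) c (mulInvariantVectorField ζ) y =
        (leftDeriv E c y).inverse ζ := by
    intro ζ y hy
    obtain ⟨e, he⟩ := hy
    have h1 := modelDeriv_eq_leftDeriv hc y
    -- The derivative of `c` is `leftDeriv` followed by the derivative of a left translation, and
    -- both factors are invertible.
    have h2 : (modelDeriv (EE m) E c y).IsInvertible := by
      have hl : (modelDeriv E E (fun h : G => (c y)⁻¹ * h) (c y)).comp
          (modelDeriv E E (fun h : G => c y * h) 1) = ContinuousLinearMap.id ℝ E := by
        rw [← modelDeriv_comp ((contMDiff_mul_const_left _).mdifferentiableAt (by simp))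
          ((contMDiff_mul_const_left _).mdifferentiableAt (by simp)) (mul_one _)]
        rw [show ((fun h : G => (c y)⁻¹ * h) ∘ fun h => c y * h) = id by funext h; simp]
        exact mfderiv_id
      have hr : (modelDeriv E E (fun h : G => c y * h) 1).comp
          (modelDeriv E E (fun h : G => (c y)⁻¹ * h) (c y)) = ContinuousLinearMap.id ℝ E := by
        rw [← modelDeriv_comp ((contMDiff_mul_const_left _).mdifferentiableAt (by simp))
          ((contMDiff_mul_const_left _).mdifferentiableAt (by simp)) (inv_mul_cancel _)]
        rw [show ((fun h : G => c y * h) ∘ fun h => (c y)⁻¹ * h) = id by funext h; simp]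
        exact mfderiv_id
      rw [h1]
      exact (ContinuousLinearMap.IsInvertible.of_inverse hr hl).comp ⟨e, he⟩
    change (modelDeriv (EE m) E c y).inverse (modelDeriv E E (fun h : G => c y * h) 1 ζ) = _
    rw [h2.inverse_apply_eq, h1]
    have h3 : (leftDeriv E c y) ((leftDeriv E c y).inverse ζ) = ζ := by
      rw [← he, ContinuousLinearMap.inverse_equiv]
      exact e.apply_symm_apply ζ
    exact congrArg _ h3.symm
  have h1 := VectorField.mpullback_mlieBracket (I := 𝓘(ℝ, EE m)) (n := ∞)
    (mdifferentiableAt_mulInvariantVectorField (I := 𝓘(ℝ, E)) (ξ : GroupLieAlgebra 𝓘(ℝ, E) G) (g := c y₀))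
    (mdifferentiableAt_mulInvariantVectorField (I := 𝓘(ℝ, E)) (η : GroupLieAlgebra 𝓘(ℝ, E) G) (g := c y₀))
    hc.contMDiffAt (by rw [minSmoothness_of_isRCLikeNormedField]; exact ENat.LEInfty.out)
  have h2 := (hfield _ _ h).symm.trans ((congrArg (fun X =>
    VectorField.mpullback 𝓘(ℝ, EE m) 𝓘(ℝ, E) c X y₀)
    (mulInvariantVector_mlieBracket (I := 𝓘(ℝ, E)) (G := G) ξ η)).trans h1)
  have hev : ∀ ζ : GroupLieAlgebra 𝓘(ℝ, E) G, (fun y => (leftDeriv E c y).inverse ζ) =ᶠ[𝓝 y₀]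
      VectorField.mpullback 𝓘(ℝ, EE m) 𝓘(ℝ, E) c (mulInvariantVectorField ζ) := by
    intro ζ
    filter_upwards [eventually_isInvertible_leftDeriv hc h] with y hy
    exact (hfield ζ y hy).symm
  refine Eq.trans ?_ h2.symm
  -- On a vector space the manifold bracket is the usual one; it depends only on the germs of the
  -- fields, so `hev` suffices.
  rw [← VectorField.mlieBracketWithin_univ, VectorField.mlieBracketWithin_eq_lieBracketWithin,
    ← VectorField.lieBracketWithin_univ]
  simp only [← nhdsWithin_univ] at hev
  exact Filter.EventuallyEq.lieBracketWithin_vectorField_eq_of_mem (hev ξ) (hev η) (Set.mem_univ _)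

theorem extDeriv_one_apply {F V : Type*} [NormedAddCommGroup F] [NormedSpace ℝ F]
    [NormedAddCommGroup V] [NormedSpace ℝ V] {w : F → F [⋀^Fin 1]→L[ℝ] V} {x : F}
    (h : DifferentiableAt ℝ w x) (v : Fin 2 → F) : extDeriv w x v =
      fderiv ℝ (fun y => w y fun _ => v 1) x (v 0) - fderiv ℝ (fun y => w y fun _ => v 0) x (v 1) := by
  rw [extDeriv_apply h, Fin.sum_univ_two]
  have e0 : (0 : Fin 2).removeNth v = fun _ => v 1 := by
    funext i
    fin_cases i
    rfl
  have e1 : (1 : Fin 2).removeNth v = fun _ => v 0 := by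
    funext i
    fin_cases i
    rfl
  simp [e0, e1, sub_eq_add_neg]

/-- In Cartan's formula `dw(X, Y) = X w(Y) - Y w(X) - w([X, Y])` the first two terms vanish when
`w(X)` and `w(Y)` are locally constant. -/
theorem extDeriv_of_eventually_const {F V : Type*} [NormedAddCommGroup F] [NormedSpace ℝ F]
    [NormedAddCommGroup V] [NormedSpace ℝ V] {w : F → F [⋀^Fin 1]→L[ℝ] V} {x : F}
    (h : DifferentiableAt ℝ w x) {W : Fin 2 → F → F} (hW : ∀ i, DifferentiableAt ℝ (W i) x)
    (c : Fin 2 → V) (hc : ∀ i, ∀ᶠ y in 𝓝 x, (w y fun _ => W i y) = c i) :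
    (extDeriv w x fun i => W i x) = - w x fun _ => VectorField.lieBracket ℝ (W 0) (W 1) x := by
  have hconst : ∀ i : Fin 2, fderiv ℝ (fun y => w y (i.removeNth fun j => W j y)) x = 0 := by
    intro i
    have h3 : (fun y => w y (i.removeNth fun j => W j y)) =ᶠ[𝓝 x] fun _ => c (i.succAbove 0) := by
      filter_upwards [hc (i.succAbove 0)] with y hy
      rw [← hy]
      congr 1
      funext j
      rw [Subsingleton.elim j 0]
      rfl
    rw [h3.fderiv_eq]
    exact fderiv_const_apply _
  rw [extDeriv_apply_vectorField h hW]
  simp only [hconst]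
  rw [Fin.sum_univ_one, Finset.sum_eq_single_of_mem (0 : Fin 1) (by simp)
    (fun b _ hb => absurd (Subsingleton.elim b 0) hb)]
  simp only [zero_apply, smul_zero, Finset.sum_const_zero, zero_sub]
  have h1 : ∀ (z : F) (r : Fin 0 → F), Matrix.vecCons z r = fun _ => z := by
    intro z r
    funext i
    rw [Subsingleton.elim i 0]
    rfl
  rw [h1]
  simp

/-- Where the plot is a local diffeomorphism, each vector extends to an invariant field, on which
the Maurer–Cartan form is constant; only the bracket term of Cartan's formula survives. -/
theorem extD_maurerCartan_of_isInvertible {m : ℕ} {c : EE m → G}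
    (hc : ContMDiff 𝓘(ℝ, EE m) 𝓘(ℝ, E) ∞ c) {y₀ : EE m} (h : (leftDeriv E c y₀).IsInvertible)
    (v : Fin 2 → EE m) : (extD (maurerCartan E G)).1 m ⟨c, hc⟩ y₀ v =
      - lieBr E G (leftDeriv E c y₀ (v 0)) (leftDeriv E c y₀ (v 1)) := by
  have hinv := eventually_isInvertible_leftDeriv hc h
  let W : Fin 2 → EE m → EE m := fun i y => (leftDeriv E c y).inverse (leftDeriv E c y₀ (v i))
  have hW : ∀ i, DifferentiableAt ℝ (W i) y₀ := by
    intro i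
    have h1 : ContDiffAt ℝ ∞ (fun y => (leftDeriv E c y).inverse) y₀ :=
      (h.contDiffAt_map_inverse (n := ∞)).comp y₀ (contDiff_leftDeriv_clm hc).contDiffAt
    exact (h1.differentiableAt (by simp)).clm_apply (differentiableAt_const _)
  have hinv' : ∀ y, (leftDeriv E c y).IsInvertible → ∀ ξ,
      leftDeriv E c y ((leftDeriv E c y).inverse ξ) = ξ := by
    rintro y ⟨e, he⟩ ξ
    rw [← he, ContinuousLinearMap.inverse_equiv]
    exact e.apply_symm_apply ξ
  have hW0 : (fun i => W i y₀) = v := by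
    funext i
    simp only [W]
    rw [h.inverse_apply_eq]
  have h2 := extDeriv_of_eventually_const (w := (maurerCartan E G).1 m ⟨c, hc⟩) (x := y₀)
    ((form_smooth (maurerCartan E G) m ⟨c, hc⟩).differentiable (by simp) y₀) hW
    (fun i => leftDeriv E c y₀ (v i)) (fun i => by
      filter_upwards [hinv] with y hy
      exact hinv' y hy _)
  rw [hW0] at h2
  refine Eq.trans h2 (congrArg Neg.neg ?_)
  refine Eq.trans (congrArg (leftDeriv E c y₀) (lieBracket_invariantFields hc h _ _)) ?_
  exact hinv' y₀ h _

/-- The Maurer–Cartan equation. -/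
theorem extD_maurerCartan {m : ℕ} (p : (mfdD E G).plots m) (x : EE m) (v : Fin 2 → EE m) :
    (extD (maurerCartan E G)).1 m p x v =
      - lieBr E G (leftDeriv E p.1 x (v 0)) (leftDeriv E p.1 x (v 1)) := by
  -- A general plot does not allow invariant fields to be pulled back. It factors near `x` through a
  -- plot with invertible derivative, and both sides are natural in the plot.
  obtain ⟨c, y₀, hc, -, hi, hγ⟩ := exists_chartPlot (E := E) (p.1 x)
  obtain ⟨γ, hγ, hγx, hpγ⟩ := hγ m p.1 x p.2 rfl
  have h1 := form_congr_nhds (extD (maurerCartan E G)) (p := p)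
    (q := ⟨c ∘ γ, (mfdD E G).plot_reparam (p := c) hc hγ⟩) hpγ
  have h2 := form_congr_nhds (maurerCartan E G) (p := p)
    (q := ⟨c ∘ γ, (mfdD E G).plot_reparam (p := c) hc hγ⟩) hpγ
  have h3 : ∀ u, leftDeriv E p.1 x u = leftDeriv E c y₀ (fderiv ℝ γ x u) := by
    intro u
    refine Eq.trans (congrArg (fun a : (EE m) [⋀^Fin 1]→L[ℝ] E => a fun _ => u) h2) ?_
    refine Eq.trans (congrArg (fun L : EE m →L[ℝ] E => L u) (leftDeriv_comp hc hγ x)) ?_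
    rw [hγx]
    rfl
  rw [h1, form_compat_mk (extD (maurerCartan E G)) (p := c) hc hγ _ rfl, hγx,
    extD_maurerCartan_of_isInvertible hc hi, h3, h3]

end MaurerCartanEquation

/-! ### Gauge transformations and the derivative of the adjoint action. -/

section Gauge

variable {E : Type*} [NormedAddCommGroup E] [NormedSpace ℝ E] [FiniteDimensional ℝ E]
  {G : Type*} [TopologicalSpace G] [ChartedSpace E G] [Group G] [LieGroup 𝓘(ℝ, E) ∞ G]
  {X : Type*} {D : DiffeologicalSpace X}

theorem lieBr_skew (u v : E) : lieBr E G u v = - lieBr E G v u := by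
  have : CompleteSpace E := FiniteDimensional.complete ℝ E
  have : LieGroup 𝓘(ℝ, E) (minSmoothness ℝ 3) G := by
    rw [minSmoothness_of_isRCLikeNormedField]
    infer_instance
  exact (lie_skew (L := GroupLieAlgebra 𝓘(ℝ, E) G) u v).symm

theorem lieBrL_apply (u v : E) : lieBrL E G u v = lieBr E G u v := rfl

/-- A one-form is linear in the tangent vector, so its value along `ψ (f, g)` splits into the
contributions of the two factors. -/
theorem form_prod_plot {V : Type*} [NormedAddCommGroup V] [NormedSpace ℝ V] [FiniteDimensional ℝ V]
    {a b l : ℕ}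
    (w : Form D 1 V) {ψ : EE a × EE b → X} (hψ : (fun z => ψ (splitE a b z)) ∈ D.plots (a + b))
    {f : EE l → EE a} {g : EE l → EE b} (hf : ContDiff ℝ ∞ f) (hg : ContDiff ℝ ∞ g)
    (h : (fun y => ψ (f y, g y)) ∈ D.plots l) (x : EE l) (v : Fin 1 → EE l) :
    w.1 l ⟨fun y => ψ (f y, g y), h⟩ x v =
      (w.1 (a + b) ⟨_, hψ⟩ ((splitE a b).symm (f x, g x)) fun _ =>
        (splitE a b).symm (fderiv ℝ f x (v 0), 0)) +
      w.1 (a + b) ⟨_, hψ⟩ ((splitE a b).symm (f x, g x)) fun _ =>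
        (splitE a b).symm (0, fderiv ℝ g x (v 0)) := by
  have hF : ContDiff ℝ ∞ fun y => (splitE a b).symm (f y, g y) :=
    (splitE a b).symm.contDiff.comp (hf.prodMk hg)
  rw [form_compat_mk w hψ hF h (by funext y; simp) x v, ← form1_add, ← map_add]
  congr 1
  funext i
  rw [Subsingleton.elim i 0]
  have h1 : HasFDerivAt (fun y => (splitE a b).symm (f y, g y))
      ((splitE a b).symm.toContinuousLinearMap.comp ((fderiv ℝ f x).prod (fderiv ℝ g x))) x :=
    (splitE a b).symm.hasFDerivAt.comp x
      ((hf.differentiable (by simp) x).hasFDerivAt.prodMk (hg.differentiable (by simp) x).hasFDerivAt)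
  rw [h1.fderiv]
  simp

/-- A product rule: on the diagonal a one-form is the sum of the values with one variable frozen,
since a constant factor contributes zero in `form_prod_plot`. -/
theorem form_diag {V : Type*} [NormedAddCommGroup V] [NormedSpace ℝ V] [FiniteDimensional ℝ V]
    {l : ℕ} (w : Form D 1 V)
    {ψ : EE l × EE l → X} (hψ : (fun z => ψ (splitE l l z)) ∈ D.plots (l + l)) (x : EE l)
    (h : (fun y => ψ (y, y)) ∈ D.plots l) (h₁ : (fun y => ψ (y, x)) ∈ D.plots l)
    (h₂ : (fun y => ψ (x, y)) ∈ D.plots l) (v : Fin 1 → EE l) :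
    w.1 l ⟨fun y => ψ (y, y), h⟩ x v =
      w.1 l ⟨fun y => ψ (y, x), h₁⟩ x v + w.1 l ⟨fun y => ψ (x, y), h₂⟩ x v := by
  have hz : ∀ z : EE (l + l), (w.1 (l + l) ⟨_, hψ⟩ z fun _ => (splitE l l).symm (0, 0)) = 0 := by
    intro z
    exact (w.1 (l + l) ⟨_, hψ⟩ z).map_coord_zero 0 (by simp)
  have i : ContDiff ℝ ∞ fun y : EE l => y := contDiff_id
  have c : ContDiff ℝ ∞ fun _ : EE l => x := contDiff_const
  rw [form_prod_plot w hψ i i h, form_prod_plot w hψ i c h₁, form_prod_plot w hψ c i h₂]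
  simp [hz]

/-- The plots `q` and `q'` are related by the gauge transformation `g` with respect to the form
`A`: `A` behaves like a connection form on a principal bundle for `q' = q · g`. -/
def GaugeRel (A : Form D 1 E) {m : ℕ} (q q' : D.plots m) (g : EE m → G) : Prop :=
  ∀ x v, A.1 m q' x v = Ad E (g x)⁻¹ (A.1 m q x v) + leftDeriv E g x (v 0)

/-- Apply `form_diag` to `(y, z) ↦ q(y) g(z)`. Freezing `g` leaves a right translation, governed by
equivariance; freezing `q` leaves an orbit map, on which `θ` is the Maurer–Cartan form. -/
theorem gaugeRel_act {EN : Type*} [NormedAddCommGroup EN] [NormedSpace ℝ EN]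
    [FiniteDimensional ℝ EN] {N : Type*} [TopologicalSpace N] [ChartedSpace EN N]
    [IsManifold 𝓘(ℝ, EN) ∞ N] {EP : Type*} [NormedAddCommGroup EP] [NormedSpace ℝ EP]
    [FiniteDimensional ℝ EP] {P : Type*} [TopologicalSpace P] [ChartedSpace EP P]
    [IsManifold 𝓘(ℝ, EP) ∞ P] {B : PrincipalBundle E G EN N EP P} {θ : Form (mfdD EP P) 1 E}
    (hθ : IsConnection B θ) {m : ℕ} (q : (mfdD EP P).plots m) {g : EE m → G}
    (hg : ContMDiff 𝓘(ℝ, EE m) 𝓘(ℝ, E) ∞ g)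
    (h : (fun y => B.act (q.1 y) (g y)) ∈ (mfdD EP P).plots m) :
    GaugeRel θ q ⟨_, h⟩ g := by
  intro x v
  have hpair : ∀ (l : ℕ) (a b : EE l → EE m), ContDiff ℝ ∞ a → ContDiff ℝ ∞ b →
      (fun y => B.act (q.1 (a y)) (g (b y))) ∈ (mfdD EP P).plots l := by
    intro l a b ha hb
    have hq : ContMDiff 𝓘(ℝ, EE m) 𝓘(ℝ, EP) ∞ q.1 := q.2
    exact B.act_smooth.comp ((hq.comp ha.contMDiff).prodMk (hg.comp hb.contMDiff))
  have h1 := form_diag θ (ψ := fun z : EE m × EE m => B.act (q.1 z.1) (g z.2))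
    (hpair _ _ _ (contDiff_fst.comp (splitE m m).contDiff)
      (contDiff_snd.comp (splitE m m).contDiff)) x h
    (hpair _ _ _ contDiff_id contDiff_const) (hpair _ _ _ contDiff_const contDiff_id) v
  refine h1.trans (congrArg₂ (· + ·) (hθ.equivariant (g x) m q x v) ?_)
  have h2 := congrArg (fun w : Form (mfdD E G) 1 E => w.1 m ⟨g, hg⟩ x v) (hθ.vertical (q.1 x))
  exact h2

/-- The gauge relation for the Maurer–Cartan form on the bundle `G → pt` is exactly this product
rule. -/
theorem leftDeriv_mul {m : ℕ} {h g : EE m → G} (hh : ContMDiff 𝓘(ℝ, EE m) 𝓘(ℝ, E) ∞ h)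
    (hg : ContMDiff 𝓘(ℝ, EE m) 𝓘(ℝ, E) ∞ g) (x v : EE m) :
    leftDeriv E (fun y => h y * g y) x v = Ad E (g x)⁻¹ (leftDeriv E h x v) + leftDeriv E g x v :=
  gaugeRel_act (groupBundle_maurerCartan_isConnection (E := E) (G := G)) ⟨h, hh⟩ hg (hh.mul hg) x
    fun _ => v

/-- Take a map `h` from the plane with partial left derivatives `ξ` and `η` at the origin. The left
derivative of `c h c⁻¹` is `Ad c` of that of `h`, with a constant coefficient, so the Maurer–Cartan
equations of the two maps can be compared. -/
theorem Ad_lieBr (c : G) (ξ η : E) :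
    Ad E c (lieBr E G ξ η) = lieBr E G (Ad E c ξ) (Ad E c η) := by
  let L : EE 2 →L[ℝ] E := (EuclideanSpace.proj (𝕜 := ℝ) (0 : Fin 2)).smulRight ξ +
    (EuclideanSpace.proj (𝕜 := ℝ) (1 : Fin 2)).smulRight η
  obtain ⟨h, hh, -, hL⟩ := exists_plot_leftDeriv (G := G) (0 : EE 2) L
  let v : Fin 2 → EE 2 := fun i => EuclideanSpace.single i 1
  have h0 : leftDeriv E h 0 (v 0) = ξ := by simp [hL, L, v]
  have h1 : leftDeriv E h 0 (v 1) = η := by simp [hL, L, v]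
  have hc : ContMDiff 𝓘(ℝ, EE 2) 𝓘(ℝ, E) ∞ fun y => c * h y * c⁻¹ := (contMDiff_conj c).comp hh
  have e1 := extD_maurerCartan (E := E) ⟨h, hh⟩ 0 v
  have e2 := extD_maurerCartan (E := E) ⟨_, hc⟩ 0 v
  have hd := (form_smooth (maurerCartan E G) 2 ⟨h, hh⟩).differentiable (by simp) 0
  have hd' := (form_smooth (maurerCartan E G) 2 ⟨_, hc⟩).differentiable (by simp) 0
  have e1' := (extDeriv_one_apply hd v).symm.trans e1
  have e2' := (extDeriv_one_apply hd' v).symm.trans e2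
  have hf : ∀ u w, fderiv ℝ (fun y => (maurerCartan E G).1 2 ⟨_, hc⟩ y fun _ => u) 0 w =
      Ad E c (fderiv ℝ (fun y => (maurerCartan E G).1 2 ⟨h, hh⟩ y fun _ => u) 0 w) := by
    intro u w
    have : (fun y => (maurerCartan E G).1 2 ⟨_, hc⟩ y fun _ => u) =
        fun y => Ad E c ((maurerCartan E G).1 2 ⟨h, hh⟩ y fun _ => u) :=
      funext fun y => leftDeriv_conj hh c y u
    rw [this]
    have hu : DifferentiableAt ℝ (fun y => (maurerCartan E G).1 2 ⟨h, hh⟩ y fun _ => u) 0 :=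
      (contDiff_leftDeriv hh u).differentiable (by simp) 0
    have := ((Ad E c).hasFDerivAt.comp (0 : EE 2) hu.hasFDerivAt).fderiv
    exact congrArg (fun L : EE 2 →L[ℝ] E => L w) this
  rw [hf, hf, ← map_sub, e1', map_neg, leftDeriv_conj hh, leftDeriv_conj hh, h0, h1] at e2'
  exact neg_injective e2'

/-- Let `h` be a curve with velocity `ξ` at `0` and pull the Maurer–Cartan form back along `(s, y) ↦
h(s) g(y)`. At `s = 0` its `s`-component is `Ad(g⁻¹) ξ`, which gives smoothness, and its
`y`-component `g⁻¹dg` does not depend on `s`. The Maurer–Cartan equation then is the derivative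
formula. -/
theorem hasFDerivAt_Ad {m : ℕ} {g : EE m → G} (hg : ContMDiff 𝓘(ℝ, EE m) 𝓘(ℝ, E) ∞ g) (ξ : E) :
    ContDiff ℝ ∞ (fun y => Ad E (g y)⁻¹ ξ) ∧ ∀ x v, fderiv ℝ (fun y => Ad E (g y)⁻¹ ξ) x v =
      lieBr E G (Ad E (g x)⁻¹ ξ) (leftDeriv E g x v) := by
  let e : EE 1 := EuclideanSpace.single 0 1
  obtain ⟨h, hh, -, hL⟩ := exists_plot_leftDeriv (G := G) (0 : EE 1)
    ((EuclideanSpace.proj (𝕜 := ℝ) (0 : Fin 1)).smulRight ξ)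
  have hξ : leftDeriv E h 0 e = ξ := by simp [hL, e]
  let s := splitE 1 m
  have s1 : ContDiff ℝ ∞ fun z => (s z).1 := contDiff_fst.comp s.contDiff
  have s2 : ContDiff ℝ ∞ fun z => (s z).2 := contDiff_snd.comp s.contDiff
  have hh1 : ContMDiff 𝓘(ℝ, EE (1 + m)) 𝓘(ℝ, E) ∞ fun z => h (s z).1 := hh.comp s1.contMDiff
  have hg2 : ContMDiff 𝓘(ℝ, EE (1 + m)) 𝓘(ℝ, E) ∞ fun z => g (s z).2 := hg.comp s2.contMDiff
  have d1 : ∀ z u, fderiv ℝ (fun z => (s z).1) z u = (s u).1 := fun z u =>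
    congrArg (fun L : EE (1 + m) →L[ℝ] EE 1 => L u)
      ((ContinuousLinearMap.fst ℝ (EE 1) (EE m)).comp s.toContinuousLinearMap).hasFDerivAt.fderiv
  have d2 : ∀ z u, fderiv ℝ (fun z => (s z).2) z u = (s u).2 := fun z u =>
    congrArg (fun L : EE (1 + m) →L[ℝ] EE m => L u)
      ((ContinuousLinearMap.snd ℝ (EE 1) (EE m)).comp s.toContinuousLinearMap).hasFDerivAt.fderiv
  have hΨ : ContMDiff 𝓘(ℝ, EE (1 + m)) 𝓘(ℝ, E) ∞ fun z => h (s z).1 * g (s z).2 := hh1.mul hg2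
  have hval : ∀ z u, leftDeriv E (fun z => h (s z).1 * g (s z).2) z u =
      Ad E (g (s z).2)⁻¹ (leftDeriv E h (s z).1 (s u).1) + leftDeriv E g (s z).2 (s u).2 := by
    intro z u
    rw [leftDeriv_mul hh1 hg2]
    have c1 := congrArg (fun L : EE (1 + m) →L[ℝ] E => L u) (leftDeriv_comp hh s1 z)
    have c2 := congrArg (fun L : EE (1 + m) →L[ℝ] E => L u) (leftDeriv_comp hg s2 z)
    simp only [ContinuousLinearMap.comp_apply, d1, d2] at c1 c2
    exact congrArg₂ (fun a b => Ad E (g (s z).2)⁻¹ a + b) c1 c2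
  let ι : EE m → EE (1 + m) := fun y => s.symm (0, y)
  have hι : ∀ x, HasFDerivAt ι (s.symm.toContinuousLinearMap.comp
      (ContinuousLinearMap.inr ℝ (EE 1) (EE m))) x := fun x =>
    s.symm.hasFDerivAt.comp x (hasFDerivAt_prodMk_right 0 x)
  have hιs : ContDiff ℝ ∞ ι := s.symm.contDiff.comp (contDiff_const.prodMk contDiff_id)
  have hAd : (fun y => Ad E (g y)⁻¹ ξ) =
      (fun z => leftDeriv E (fun z => h (s z).1 * g (s z).2) z (s.symm (e, 0))) ∘ ι := by
    funext y
    simp [hval, ι, hξ]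
  refine ⟨by rw [hAd]; exact (contDiff_leftDeriv hΨ _).comp hιs, fun x v => ?_⟩
  have hF := (contDiff_leftDeriv hΨ (s.symm (e, 0))).differentiable (by simp) (ι x)
  have h1 : fderiv ℝ (fun y => Ad E (g y)⁻¹ ξ) x v =
      fderiv ℝ (fun z => leftDeriv E (fun z => h (s z).1 * g (s z).2) z (s.symm (e, 0))) (ι x)
        (s.symm (0, v)) := by
    rw [hAd, (hF.hasFDerivAt.comp x (hι x)).fderiv]
    rfl
  -- The component in the direction of `y` is constant in the first variable, so one of the two
  -- terms of the exterior derivative drops out.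
  have h2 : fderiv ℝ (fun z => leftDeriv E (fun z => h (s z).1 * g (s z).2) z (s.symm (0, v))) (ι x)
        (s.symm (e, 0)) = 0 := by
    have : (fun z => leftDeriv E (fun z => h (s z).1 * g (s z).2) z (s.symm (0, v))) =
        (fun y => leftDeriv E g y v) ∘ fun z => (s z).2 := by
      funext z
      simp [hval]
    rw [this]
    have hd := ((contDiff_leftDeriv hg v).differentiable (by simp) (s (ι x)).2).hasFDerivAt.comp
      (ι x) (s2.differentiable (by simp) (ι x)).hasFDerivAt
    rw [hd.fderiv, ContinuousLinearMap.comp_apply, d2]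
    simp
  let V : Fin 2 → EE (1 + m) := ![s.symm (e, 0), s.symm (0, v)]
  have e1 := extD_maurerCartan (E := E) ⟨_, hΨ⟩ (ι x) V
  have hd := (form_smooth (maurerCartan E G) _ ⟨_, hΨ⟩).differentiable (by simp) (ι x)
  have e2 := (extDeriv_one_apply hd V).symm.trans e1
  have e3 : (0 : E) - fderiv ℝ (fun y => Ad E (g y)⁻¹ ξ) x v = -lieBr E G
      (leftDeriv E (fun z => h (s z).1 * g (s z).2) (ι x) (V 0))
      (leftDeriv E (fun z => h (s z).1 * g (s z).2) (ι x) (V 1)) := by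
    rw [h1, ← h2]
    exact e2
  rw [zero_sub, neg_inj] at e3
  rw [e3, hval, hval]
  simp [V, ι, hξ]

theorem contDiff_Ad {m : ℕ} {g : EE m → G} (hg : ContMDiff 𝓘(ℝ, EE m) 𝓘(ℝ, E) ∞ g) :
    ContDiff ℝ ∞ (fun y => Ad E (g y)⁻¹) :=
  contDiff_clm_apply_iff.2 fun ξ => (hasFDerivAt_Ad hg ξ).1

/-- The factor `1/2` absorbs the two equal terms of `[A, A]`, by skew-symmetry. -/
theorem curvature_apply (A : Form D 1 E) {m : ℕ} (q : D.plots m) (x : EE m) (v : Fin 2 → EE m) :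
    (curvature G A).1 m q x v = extDeriv (A.1 m q) x v +
      lieBr E G (A.1 m q x fun _ => v 0) (A.1 m q x fun _ => v 1) := by
  have h : (curvature G A).1 m q x v = extDeriv (A.1 m q) x v + (1 / 2 : ℝ) •
      (lieBr E G (A.1 m q x fun _ => v 0) (A.1 m q x fun _ => v 1) -
        lieBr E G (A.1 m q x fun _ => v 1) (A.1 m q x fun _ => v 0)) := rfl
  have h2 : ∀ a : E, (1 / 2 : ℝ) • (a - -a) = a := by
    intro a
    rw [sub_neg_eq_add, ← two_smul ℝ, smul_smul]
    norm_num
  rw [h, lieBr_skew (A.1 m q x fun _ => v 1), h2]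

end Gauge

/-! ### Gauge invariance, descent and closedness of Chern–Weil forms. -/

section GaugeInvariance

variable {E : Type*} [NormedAddCommGroup E] [NormedSpace ℝ E] [FiniteDimensional ℝ E]
  {G : Type*} [TopologicalSpace G] [ChartedSpace E G] [Group G] [LieGroup 𝓘(ℝ, E) ∞ G]
  {X Y : Type*} {D : DiffeologicalSpace X} {D' : DiffeologicalSpace Y}

theorem lieBr_add_left (u v w : E) : lieBr E G (u + v) w = lieBr E G u w + lieBr E G v w := by
  rw [← lieBrL_apply, map_add]
  rfl

theorem lieBr_add_right (u v w : E) : lieBr E G u (v + w) = lieBr E G u v + lieBr E G u w := by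
  rw [← lieBrL_apply, map_add]
  rfl

/-- The curvature `da + [a, a] / 2` transforms by the adjoint action under gauge transformations. -/
theorem extDeriv_add_lieBr_gauge {m : ℕ} {a a' : EE m → EE m [⋀^Fin 1]→L[ℝ] E}
    (ha : ContDiff ℝ ∞ a) (ha' : ContDiff ℝ ∞ a') {g : EE m → G}
    (hg : ContMDiff 𝓘(ℝ, EE m) 𝓘(ℝ, E) ∞ g)
    (h : ∀ x v, a' x v = Ad E (g x)⁻¹ (a x v) + leftDeriv E g x (v 0)) (x : EE m)
    (v : Fin 2 → EE m) :
    extDeriv a' x v + lieBr E G (a' x fun _ => v 0) (a' x fun _ => v 1) =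
      Ad E (g x)⁻¹ (extDeriv a x v + lieBr E G (a x fun _ => v 0) (a x fun _ => v 1)) := by
  have hd : ∀ u w, fderiv ℝ (fun y => a' y fun _ => u) x w =
      Ad E (g x)⁻¹ (fderiv ℝ (fun y => a y fun _ => u) x w) +
        lieBr E G (Ad E (g x)⁻¹ (a x fun _ => u)) (leftDeriv E g x w) +
        fderiv ℝ (fun y => leftDeriv E g y u) x w := by
    intro u w
    have h1 : (fun y => a' y fun _ => u) =
        fun y => Ad E (g y)⁻¹ (a y fun _ => u) + leftDeriv E g y u := funext fun y => h y _
    have d1 := ((contDiff_Ad hg).differentiable (by simp) x).hasFDerivAt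
    have d2 := ((contDiff_alternating_iff.1 ha fun _ => u).differentiable (by simp) x).hasFDerivAt
    have d3 := ((contDiff_leftDeriv hg u).differentiable (by simp) x).hasFDerivAt
    have d4 : fderiv ℝ (fun y => Ad E (g y)⁻¹ (a x fun _ => u)) x w =
        fderiv ℝ (fun y => Ad E (g y)⁻¹) x w (a x fun _ => u) :=
      congrArg (fun L : EE m →L[ℝ] E => L w)
        (d1.clm_apply (hasFDerivAt_const (a x fun _ => u) x)).fderiv |>.trans (by simp)
    have d5 := congrArg (fun L : EE m →L[ℝ] E => L w) ((d1.clm_apply d2).add d3).fderiv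
    rw [h1, ← (hasFDerivAt_Ad hg _).2, d4]
    exact d5.trans (by simp)
  have hMC := (extDeriv_one_apply ((form_smooth (maurerCartan E G) m ⟨g, hg⟩).differentiable
    (by simp) x) v).symm.trans (extD_maurerCartan ⟨g, hg⟩ x v)
  have hMC' : fderiv ℝ (fun y => leftDeriv E g y (v 1)) x (v 0) -
      fderiv ℝ (fun y => leftDeriv E g y (v 0)) x (v 1) =
        -lieBr E G (leftDeriv E g x (v 0)) (leftDeriv E g x (v 1)) := hMC
  -- After expansion the mixed brackets from the derivative of `Ad` cancel those of `[a', a']`, and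
  -- the Maurer–Cartan equation cancels the bracket of the two logarithmic derivatives.
  rw [extDeriv_one_apply (ha.differentiable (by simp) x),
    extDeriv_one_apply (ha'.differentiable (by simp) x), hd, hd, h, h, map_add, map_sub, Ad_lieBr,
    lieBr_add_left, lieBr_add_right, lieBr_add_right,
    lieBr_skew (Ad E (g x)⁻¹ (a x fun _ => v 1)) (leftDeriv E g x (v 0))]
  rw [sub_eq_iff_eq_add] at hMC'
  rw [hMC']
  abel

variable {W W' : Type*} [NormedAddCommGroup W] [NormedSpace ℝ W] [FiniteDimensional ℝ W]
  [NormedAddCommGroup W'] [NormedSpace ℝ W'] [FiniteDimensional ℝ W'] {k : ℕ}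

/-- The evaluation of a `k`-linear form on an alternating `2`-form at a point. -/
def chernAlt (f : MultilinearMap ℝ (fun _ : Fin k => E) ℝ) (A : W [⋀^Fin 2]→L[ℝ] E) :
    W [⋀^Fin (k * 2)]→L[ℝ] ℝ :=
  contAlt ((1 / 2 ^ k : ℝ) • MultilinearMap.alternatization (pairEval f A))

theorem chernAlt_apply (f : MultilinearMap ℝ (fun _ : Fin k => E) ℝ) (A : W [⋀^Fin 2]→L[ℝ] E)
    (v : Fin (k * 2) → W) : chernAlt f A v = (1 / 2 ^ k : ℝ) *
      ∑ s : Equiv.Perm (Fin (k * 2)), (Equiv.Perm.sign s : ℤ) •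
        f fun i => A fun j => v (s (finProdFinEquiv (i, j))) :=
  congrArg (fun r : ℝ => (1 / 2 ^ k : ℝ) * r) (MultilinearMap.alternatization_apply (pairEval f A) v)

theorem contDiff_chernAlt (f : MultilinearMap ℝ (fun _ : Fin k => E) ℝ) :
    ContDiff ℝ ∞ fun A : W [⋀^Fin 2]→L[ℝ] E => chernAlt f A := by
  refine contDiff_alternating_iff.2 fun v => ?_
  simp only [chernAlt_apply]
  have hf : ContDiff ℝ ∞ f := (⟨f, continuous_multilinear f⟩ :
    ContinuousMultilinearMap ℝ (fun _ : Fin k => E) ℝ).contDiff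
  refine contDiff_const.mul (ContDiff.sum fun s _ => ?_)
  simp only [zsmul_eq_mul]
  refine contDiff_const.mul (hf.comp (contDiff_pi.2 fun i => ?_))
  exact contDiff_alternating_iff.1 contDiff_id _

theorem chernAlt_comp (f : MultilinearMap ℝ (fun _ : Fin k => E) ℝ) (A : W [⋀^Fin 2]→L[ℝ] E)
    (L : W' →L[ℝ] W) : chernAlt f (A.compContinuousLinearMap L) =
      (chernAlt f A).compContinuousLinearMap L := by
  ext v
  rw [chernAlt_apply, ContinuousAlternatingMap.compContinuousLinearMap_apply, chernAlt_apply]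
  rfl

/-- This is the place where the `Ad`-invariance of `f` enters. -/
theorem chernAlt_Ad (f : InvPoly E G k) (c : G) {A A' : W [⋀^Fin 2]→L[ℝ] E}
    (h : ∀ v, A' v = Ad E c (A v)) : chernAlt f.1 A' = chernAlt f.1 A := by
  ext v
  rw [chernAlt_apply, chernAlt_apply]
  congr 1
  refine Finset.sum_congr rfl fun s _ => ?_
  congr 1
  simp only [h]
  exact f.2.2 c _

theorem chernForm_eq (f : InvPoly E G k) (A : Form D 1 E) {m : ℕ} (q : D.plots m) (x : EE m) :
    (chernForm G f A).1 m q x = chernAlt f.1 ((curvature G A).1 m q x) := rfl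

theorem chernForm_eq_of_gaugeRel (f : InvPoly E G k) {A : Form D 1 E} {m : ℕ} {q q' : D.plots m}
    {g : EE m → G} (hg : ContMDiff 𝓘(ℝ, EE m) 𝓘(ℝ, E) ∞ g) (h : GaugeRel A q q' g) :
    (chernForm G f A).1 m q = (chernForm G f A).1 m q' := by
  funext x
  rw [chernForm_eq, chernForm_eq]
  refine (chernAlt_Ad f (g x)⁻¹ fun v => ?_).symm
  rw [curvature_apply, curvature_apply]
  exact extDeriv_add_lieBr_gauge (form_smooth A m q) (form_smooth A m q') hg h x v

/-- Gauge-related plots replace the usual "horizontal and invariant" criterion for basic forms, so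
the argument applies to the spaces `Δₙ × Qₙ` and `Δ₁ × Δₙ × Qₙ` as well as to `P`. -/
theorem descends_chernForm (f : InvPoly E G k) {A : Form D 1 E} {π : X → Y} (hπ : Smooth D D' π)
    (hl : LocallyLifts D D' π)
    (h : ∀ (m : ℕ) (q q' : D.plots m), (∀ y, π (q.1 y) = π (q'.1 y)) →
      ∃ g : EE m → G, ContMDiff 𝓘(ℝ, EE m) 𝓘(ℝ, E) ∞ g ∧ GaugeRel A q q' g) :
    Descends π hπ (chernForm G f A) := by
  refine descends_of_forall_eq hπ hl fun m q q' hq => ?_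
  obtain ⟨g, hg, hA⟩ := h m q q' hq
  exact chernForm_eq_of_gaugeRel f hg hA

/-- `f(da)` is closed: it is a pull-back of a form with constant coefficients. -/
theorem extDeriv_chernAlt_extDeriv (f : MultilinearMap ℝ (fun _ : Fin k => E) ℝ)
    {a : W → W [⋀^Fin 1]→L[ℝ] E} (ha : ContDiff ℝ ∞ a) (x : W) :
    extDeriv (fun y => chernAlt f (extDeriv a y)) x = 0 := by
  let ev : (W [⋀^Fin 1]→L[ℝ] E) →ₗ[ℝ] W →ₗ[ℝ] E :=
    { toFun := fun b =>
        { toFun := fun u => b fun _ => u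
          map_add' := form1_add b
          map_smul' := form1_smul b }
      map_add' := fun _ _ => rfl
      map_smul' := fun _ _ => rfl }
  -- This is the constant-coefficient two-form `((b, u), (b', u')) ↦ b(u') - b'(u)`; its pull-back
  -- along the graph `y ↦ (a y, y)` is `da`.
  let A₀ : ((W [⋀^Fin 1]→L[ℝ] E) × W) [⋀^Fin 2]→L[ℝ] E := contAlt
    { toFun := fun v => ev (v 0).1 (v 1).2 - ev (v 1).1 (v 0).2
      map_update_add' := by
        intro _ v i y z
        fin_cases i <;> simp <;> abel
      map_update_smul' := by
        intro _ v i c y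
        fin_cases i <;> simp [smul_sub]
      map_eq_zero_of_eq' := by
        intro v i j h hij
        have : v 0 = v 1 := by
          fin_cases i <;> fin_cases j <;> simp_all
        simp [this] }
  have hA₀ : ∀ v, A₀ v = ((v 0).1 fun _ => (v 1).2) - (v 1).1 fun _ => (v 0).2 := fun v => rfl
  let Φ : W → (W [⋀^Fin 1]→L[ℝ] E) × W := fun y => (a y, y)
  have hΦ : ContDiff ℝ ∞ Φ := ha.prodMk contDiff_id
  have hd : ∀ y, fderiv ℝ Φ y = (fderiv ℝ a y).prod (ContinuousLinearMap.id ℝ W) := fun y =>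
    ((ha.differentiable (by simp) y).hasFDerivAt.prodMk (hasFDerivAt_id y)).fderiv
  have h1 : (fun y => chernAlt f (extDeriv a y)) =
      fun y => (chernAlt f A₀).compContinuousLinearMap (fderiv ℝ Φ y) := by
    funext y
    rw [← chernAlt_comp]
    congr 1
    ext v
    have hd' : ∀ u w, fderiv ℝ (fun y => a y fun _ => u) y w = (fderiv ℝ a y w) fun _ => u := by
      intro u w
      have := fderiv_continuousAlternatingMap_apply_const_apply (ha.differentiable (by simp) y)
        (fun _ => u) w
      exact this
    rw [extDeriv_one_apply (ha.differentiable (by simp) y), hd', hd',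
      ContinuousAlternatingMap.compContinuousLinearMap_apply, hA₀, hd]
    rfl
  rw [h1]
  have h2 := extDeriv_pullback (x := x) (f := Φ)
    (differentiableAt_const (𝕜 := ℝ) (x := Φ x) (chernAlt f A₀)) hΦ.contDiffAt
    (by rw [minSmoothness_of_isRCLikeNormedField]; exact ENat.LEInfty.out)
  rw [h2]
  ext v
  simp [extDeriv, ContinuousAlternatingMap.alternatizeUncurryFin_apply]

/-- The form `f(Ω)` is closed: after a gauge transformation that kills the connection form at a
point, `f(Ω)` and `f(da)` agree to first order at that point. -/
theorem extD_chernForm (f : InvPoly E G k) (A : Form D 1 E) : extD (chernForm G f A) = 0 := by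
  apply Subtype.ext
  funext m q x
  -- The jet of `g` at `x` is chosen with `g(x) = 1` and `g⁻¹dg = -A`, so that the transformed form
  -- `a'` vanishes at `x`.
  let L : EE m →L[ℝ] E := LinearMap.toContinuousLinearMap
    { toFun := fun u => - A.1 m q x fun _ => u
      map_add' := fun u v => by rw [form1_add, neg_add]
      map_smul' := fun c u => by rw [form1_smul, smul_neg]; rfl }
  obtain ⟨g, hg, hg1, hgL⟩ := exists_plot_leftDeriv (G := G) x L
  let a' : EE m → EE m [⋀^Fin 1]→L[ℝ] E := fun y =>
    (Ad E (g y)⁻¹).compContinuousAlternatingMap (A.1 m q y) +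
      ContinuousAlternatingMap.ofSubsingleton ℝ (EE m) E (0 : Fin 1) (leftDeriv E g y)
  have ha'v : ∀ y v, a' y v = Ad E (g y)⁻¹ (A.1 m q y v) + leftDeriv E g y (v 0) := fun y v => rfl
  have ha' : ContDiff ℝ ∞ a' := contDiff_alternating_iff.2 fun v =>
    ((contDiff_Ad hg).clm_apply (contDiff_alternating_iff.1 (form_smooth A m q) v)).add
      (contDiff_leftDeriv hg (v 0))
  have hAd : Ad E (1 : G) = ContinuousLinearMap.id ℝ E := by
    unfold Ad
    rw [show (fun h : G => 1 * h * 1⁻¹) = id by funext h; simp]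
    exact mfderiv_id
  have ha'x : ∀ u, (a' x fun _ => u) = 0 := by
    intro u
    rw [ha'v, hg1, inv_one, hAd, hgL]
    exact add_neg_cancel _
  let R : EE m → EE m [⋀^Fin 2]→L[ℝ] E := fun y => (1 / 2 : ℝ) • altPair (lieBrL E G) (a' y) (a' y)
  have hRv : ∀ y v, R y v = lieBr E G (a' y fun _ => v 0) (a' y fun _ => v 1) := by
    intro y v
    have h2 : ∀ b : E, (1 / 2 : ℝ) • (b - -b) = b := by
      intro b
      rw [sub_neg_eq_add, ← two_smul ℝ, smul_smul]
      norm_num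
    change (1 / 2 : ℝ) • (lieBr E G (a' y fun _ => v 0) (a' y fun _ => v 1) -
      lieBr E G (a' y fun _ => v 1) (a' y fun _ => v 0)) = _
    rw [lieBr_skew (a' y fun _ => v 1), h2]
  have hB := (LinearMap.toContinuousLinearMap
    ((LinearMap.toContinuousLinearMap (𝕜 := ℝ) (E := E) (F' := E)).toLinearMap.comp
      (lieBrL E G))).isBoundedBilinearMap
  have hRv' : ∀ v, (fun y => R y v) = (fun z : E × E => lieBr E G z.1 z.2) ∘
      fun y => (a' y fun _ => v 0, a' y fun _ => v 1) := fun v => funext fun y => hRv y v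
  have hav : ∀ u, ContDiff ℝ ∞ fun y => a' y fun _ => u := fun u =>
    contDiff_alternating_iff.1 ha' fun _ => u
  have hR : ContDiff ℝ ∞ R := contDiff_alternating_iff.2 fun v => by
    rw [hRv']
    exact (hB.contDiff (n := ∞)).comp ((hav _).prodMk (hav _))
  -- The bracket term is quadratic in `a'`, and `a'` vanishes at `x`; hence its derivative vanishes
  -- there too.
  have hR' : fderiv ℝ R x = 0 := by
    ext w v
    rw [← fderiv_continuousAlternatingMap_apply_const_apply (hR.differentiable (by simp) x), hRv']
    have h3 := (hB.hasFDerivAt (a' x fun _ => v 0, a' x fun _ => v 1)).comp x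
      (((hav (v 0)).differentiable (by simp) x).hasFDerivAt.prodMk
        ((hav (v 1)).differentiable (by simp) x).hasFDerivAt)
    refine (congrArg (fun L : EE m →L[ℝ] E => L w) h3.fderiv).trans ?_
    simp [ha'x]
  have hRx : R x = 0 := by
    ext v
    rw [hRv, ha'x, ha'x, ← lieBrL_apply]
    simp
  have hF : ∀ y, chernAlt f.1 ((curvature G A).1 m q y) = chernAlt f.1 (extDeriv a' y + R y) := by
    intro y
    refine (chernAlt_Ad f (g y)⁻¹ fun v => ?_).symm
    rw [curvature_apply, ContinuousAlternatingMap.add_apply, hRv]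
    exact extDeriv_add_lieBr_gauge (form_smooth A m q) ha' hg ha'v y v
  have hda : ContDiff ℝ ∞ (extDeriv a') := by
    have h1 : ContDiff ℝ ∞ (fderiv ℝ a') := ha'.fderiv_right (by simp)
    exact (ContinuousAlternatingMap.alternatizeUncurryFinCLM ℝ (EE m) E).contDiff.comp h1
  have hdC : ∀ b, HasFDerivAt (fun b : EE m [⋀^Fin 2]→L[ℝ] E => chernAlt f.1 b)
      (fderiv ℝ (fun b : EE m [⋀^Fin 2]→L[ℝ] E => chernAlt f.1 b) b) b := fun b =>
    ((contDiff_chernAlt f.1).differentiable (by simp) b).hasFDerivAt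
  have hda' := (hda.differentiable (by simp) x).hasFDerivAt
  -- The exterior derivative at `x` sees only the first derivative, which by the vanishing of `R`
  -- and its derivative is that of `f(da')`.
  have h5 : fderiv ℝ (fun y => chernAlt f.1 (extDeriv a' y + R y)) x =
      fderiv ℝ (fun y => chernAlt f.1 (extDeriv a' y)) x := by
    have e1 := ((hdC _).comp x (hda'.add (hR.differentiable (by simp) x).hasFDerivAt)).fderiv
    have e2 := ((hdC _).comp x hda').fderiv
    refine e1.trans (Eq.trans ?_ e2.symm)
    rw [hR', Pi.add_apply, hRx, add_zero, add_zero]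
  have h6 : (chernForm G f A).1 m q = fun y => chernAlt f.1 (extDeriv a' y + R y) := funext hF
  change extDeriv ((chernForm G f A).1 m q) x = 0
  rw [h6]
  unfold extDeriv
  refine Eq.trans (congrArg _ h5) ?_
  exact extDeriv_chernAlt_extDeriv f.1 ha' x

end GaugeInvariance

/-! ### Integration over the standard simplex and its faces. -/

section SimplexCalculus

variable {V : Type*} [NormedAddCommGroup V] [NormedSpace ℝ V] [CompleteSpace V] {n : ℕ}

/-- The insertion of a coordinate. -/
def insertCoord (i : Fin (n + 1)) (u : ℝ) (s : EE n) : EE (n + 1) :=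
  WithLp.toLp 2 (i.insertNth (α := fun _ => ℝ) u fun j => s j)

@[simp] theorem insertCoord_same (i : Fin (n + 1)) (u : ℝ) (s : EE n) : insertCoord i u s i = u := by
  simp [insertCoord]

@[simp] theorem insertCoord_succAbove (i : Fin (n + 1)) (u : ℝ) (s : EE n) (j : Fin n) :
    insertCoord i u s (i.succAbove j) = s j := by
  simp [insertCoord]

theorem euclidean_ext_succAbove (i : Fin (n + 1)) {s t : EE (n + 1)} (h : s i = t i)
    (h' : ∀ j, s (i.succAbove j) = t (i.succAbove j)) : s = t := by
  ext j
  rcases Fin.eq_self_or_eq_succAbove i j with rfl | ⟨j, rfl⟩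
  · exact h
  · exact h' j

theorem sum_insertCoord (i : Fin (n + 1)) (u : ℝ) (s : EE n) :
    ∑ j, insertCoord i u s j = u + ∑ j, s j := by
  rw [Fin.sum_univ_succAbove _ i]
  simp

theorem measurePreserving_insertCoord (i : Fin (n + 1)) :
    MeasurePreserving (fun z : ℝ × EE n => insertCoord i z.1 z.2) := by
  have h1 := (volume_preserving_piFinSuccAbove (fun _ : Fin (n + 1) => ℝ) i).symm
  have h2 := (MeasurePreserving.id (volume : Measure ℝ)).prod (PiLp.volume_preserving_ofLp (Fin n))
  exact (PiLp.volume_preserving_toLp (Fin (n + 1))).comp (h1.comp h2)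

theorem contDiff_insertCoord (i : Fin (n + 1)) :
    ContDiff ℝ ∞ fun z : ℝ × EE n => insertCoord i z.1 z.2 := by
  refine contDiff_euclidean.2 fun j => ?_
  rcases Fin.eq_self_or_eq_succAbove i j with rfl | ⟨j, rfl⟩
  · simpa using contDiff_fst
  · simp only [insertCoord_succAbove]
    exact (contDiff_piLp_apply 2).comp contDiff_snd

theorem measurableEmbedding_insertCoord (i : Fin (n + 1)) :
    MeasurableEmbedding fun z : ℝ × EE n => insertCoord i z.1 z.2 := by
  refine (contDiff_insertCoord i).continuous.measurableEmbedding fun z z' h => ?_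
  refine Prod.ext ?_ ?_
  · simpa using congrArg (fun t : EE (n + 1) => t i) h
  · ext j
    simpa using congrArg (fun t : EE (n + 1) => t (i.succAbove j)) h

theorem insertCoord_mem_simplex (i : Fin (n + 1)) (u : ℝ) (s : EE n) :
    insertCoord i u s ∈ simplex (n + 1) ↔ s ∈ simplex n ∧ u ∈ Set.Icc 0 (1 - ∑ j, s j) := by
  simp only [simplex, Set.mem_ofPred_eq, sum_insertCoord, Set.mem_Icc]
  constructor
  · rintro ⟨h, h'⟩
    have h0 := h i
    have h1 := fun j => h (i.succAbove j)
    simp only [insertCoord_same, insertCoord_succAbove] at h0 h1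
    exact ⟨⟨h1, by linarith⟩, h0, by linarith⟩
  · rintro ⟨⟨h, h'⟩, h0, h1⟩
    refine ⟨fun j => ?_, by linarith⟩
    rcases Fin.eq_self_or_eq_succAbove i j with rfl | ⟨j, rfl⟩
    · simpa using h0
    · simpa using h j

/-- Fubini with an arbitrary distinguished coordinate `i`: the slice of the simplex over `s` is the
interval `[0, 1 - ∑ s]`, and it is empty for `s` outside the smaller simplex. -/
theorem setIntegral_simplex_succ (i : Fin (n + 1)) {F : EE (n + 1) → V} (hF : Continuous F) :
    ∫ t in simplex (n + 1), F t =
      ∫ s in simplex n, ∫ u in (0 : ℝ)..(1 - ∑ j, s j), F (insertCoord i u s) := by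
  have hm : MeasurableSet (simplex n) := (isCompact_simplex n).measurableSet
  have hm' : MeasurableSet (simplex (n + 1)) := (isCompact_simplex (n + 1)).measurableSet
  let ι : ℝ × EE n → EE (n + 1) := fun z => insertCoord i z.1 z.2
  have hι : Measurable ι := (contDiff_insertCoord i).continuous.measurable
  have hint : IntegrableOn (fun z => F (ι z)) (ι ⁻¹' simplex (n + 1)) (volume : Measure (ℝ × EE n)) :=
    ((measurePreserving_insertCoord i).integrableOn_comp_preimage
      (measurableEmbedding_insertCoord i)).2
      (hF.continuousOn.integrableOn_compact (isCompact_simplex (n + 1)))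
  rw [← (measurePreserving_insertCoord i).setIntegral_preimage_emb
    (measurableEmbedding_insertCoord i), ← integral_indicator (hι hm'),
    Measure.volume_eq_prod, integral_prod_symm _ ((integrable_indicator_iff (hι hm')).2 hint),
    ← integral_indicator hm]
  congr 1
  funext s
  by_cases hs : s ∈ simplex n
  · rw [Set.indicator_of_mem hs, intervalIntegral.integral_of_le (by have := hs.2; linarith),
      ← integral_Icc_eq_integral_Ioc, ← integral_indicator measurableSet_Icc]
    congr 1
    funext u
    by_cases hu : u ∈ Set.Icc 0 (1 - ∑ j, s j)
    · rw [Set.indicator_of_mem hu, Set.indicator_of_mem]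
      exact (insertCoord_mem_simplex i u s).2 ⟨hs, hu⟩
    · rw [Set.indicator_of_notMem hu, Set.indicator_of_notMem]
      exact fun h => hu ((insertCoord_mem_simplex i u s).1 h).2
  · rw [Set.indicator_of_notMem hs]
    refine (integral_congr_ae (Filter.Eventually.of_forall fun u => ?_)).trans (integral_zero _ _)
    exact Set.indicator_of_notMem (fun h => hs ((insertCoord_mem_simplex i u s).1 h).1) _

theorem insertCoord_add (i : Fin (n + 1)) (u : ℝ) (s : EE n) :
    insertCoord i u s = insertCoord i 0 s + u • EuclideanSpace.single i 1 := by
  refine euclidean_ext_succAbove i ?_ fun j => ?_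
  · simp
  · simp [Fin.succAbove_ne]

/-- Fundamental theorem of calculus in the `i`-th direction; the endpoints lie on the slanted face
and on the face `tᵢ = 0`. -/
theorem setIntegral_simplex_fderiv (i : Fin (n + 1)) {F : EE (n + 1) → V} (hF : ContDiff ℝ ∞ F) :
    ∫ t in simplex (n + 1), fderiv ℝ F t (EuclideanSpace.single i 1) =
      ∫ s in simplex n, (F (insertCoord i (1 - ∑ j, s j) s) - F (insertCoord i 0 s)) := by
  have hF' : Continuous fun t => fderiv ℝ F t (EuclideanSpace.single i 1) :=
    (hF.continuous_fderiv (by simp)).clm_apply continuous_const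
  rw [setIntegral_simplex_succ i hF']
  congr 1
  funext s
  have hc : Continuous fun u : ℝ => insertCoord i u s :=
    (contDiff_insertCoord i).continuous.comp (Continuous.prodMk_left s)
  refine intervalIntegral.integral_eq_sub_of_hasDerivAt (f := fun u => F (insertCoord i u s))
    (fun u _ => ?_) ((hF'.comp hc).intervalIntegrable _ _)
  have h1 : HasDerivAt (fun u : ℝ => insertCoord i u s) (EuclideanSpace.single i 1) u := by
    have := ((hasDerivAt_id u).smul_const (EuclideanSpace.single i (1 : ℝ))).const_add
      (insertCoord i 0 s)
    simp only [id, one_smul] at this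
    refine this.congr_of_eventuallyEq (Filter.Eventually.of_forall fun u => insertCoord_add i u s)
  exact (hF.differentiable (by simp) _).hasFDerivAt.comp_hasDerivAt u h1

theorem insertCoord_castSucc_succ (i : Fin (n + 1)) (u u' : ℝ) (r : EE n) :
    insertCoord i.castSucc u (insertCoord i u' r) = insertCoord i.succ u' (insertCoord i u r) := by
  refine euclidean_ext_succAbove i.castSucc ?_ fun j => ?_
  · have : i.castSucc = i.succ.succAbove i := by simp
    rw [insertCoord_same]
    conv_rhs => rw [this]
    rw [insertCoord_succAbove, insertCoord_same]
  · rw [insertCoord_succAbove]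
    rcases Fin.eq_self_or_eq_succAbove i j with rfl | ⟨j, rfl⟩
    · simp
    · have : i.castSucc.succAbove (i.succAbove j) = i.succ.succAbove (i.succAbove j) := by
        rcases lt_or_ge j.castSucc i with h | h
        · rw [Fin.succAbove_of_castSucc_lt i j h]
          rw [Fin.succAbove_of_castSucc_lt _ _ (by simpa using h), Fin.succAbove_of_castSucc_lt]
          exact lt_trans (by simpa using h) (Fin.castSucc_lt_succ)
        · rw [Fin.succAbove_of_le_castSucc i j h]
          rw [Fin.succAbove_of_le_castSucc _ _ (by
            rw [Fin.le_def] at h ⊢; simp at h ⊢; omega), Fin.succAbove_of_le_castSucc]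
          rw [Fin.le_def] at h ⊢; simp at h ⊢; omega
      rw [insertCoord_succAbove, this, insertCoord_succAbove, insertCoord_succAbove]

/-- Two neighbouring parametrizations of the slanted face differ, with the remaining coordinates `r`
fixed, by the reflection `u ↦ 1 - ∑ r - u` of an interval. -/
theorem setIntegral_simplex_top_succ (i : Fin n) {F : EE (n + 1) → V} (hF : Continuous F) :
    ∫ s in simplex n, F (insertCoord i.succ (1 - ∑ j, s j) s) =
      ∫ s in simplex n, F (insertCoord i.castSucc (1 - ∑ j, s j) s) := by
  obtain _ | n := n
  · exact i.elim0
  have hc : ∀ l : Fin (n + 2), Continuous fun s : EE (n + 1) => F (insertCoord l (1 - ∑ j, s j) s) := by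
    intro l
    refine hF.comp ((contDiff_insertCoord l).continuous.comp (Continuous.prodMk ?_ continuous_id))
    exact continuous_const.sub (continuous_finsetSum _ fun j _ =>
      (EuclideanSpace.proj (𝕜 := ℝ) j).continuous)
  rw [setIntegral_simplex_succ i (hc _), setIntegral_simplex_succ i (hc _)]
  congr 1
  funext r
  have h := intervalIntegral.integral_comp_sub_left (a := 0) (b := 1 - ∑ j, r j)
    (fun u => F (insertCoord i.castSucc (1 - ∑ j, insertCoord i u r j) (insertCoord i u r)))
    (1 - ∑ j, r j)
  rw [sub_self, sub_zero] at h
  rw [← h]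
  congr 1
  funext u
  simp only [sum_insertCoord]
  rw [insertCoord_castSucc_succ]
  have e : 1 - (1 - ∑ j, r j - u + ∑ j, r j) = u := by ring
  rw [e]
  congr 2
  ring

/-- The integral over the slanted face does not depend on which coordinate is solved for, so the
contributions of all directions can be collected on `coface 0`. -/
theorem setIntegral_simplex_top (i : Fin (n + 1)) {F : EE (n + 1) → V} (hF : Continuous F) :
    ∫ s in simplex n, F (insertCoord i (1 - ∑ j, s j) s) =
      ∫ s in simplex n, F (insertCoord 0 (1 - ∑ j, s j) s) := by
  induction i using Fin.induction with
  | zero => rfl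
  | succ i ih => rw [setIntegral_simplex_top_succ i hF, ih]

/-- The coface map `Δₙ → Δₙ₊₁` opposite to the `i`-th vertex. -/
def coface (i : Fin (n + 2)) (s : EE n) : EE (n + 1) :=
  Fin.cases (insertCoord 0 (1 - ∑ j, s j) s) (fun i => insertCoord i 0 s) i

theorem coface_zero (s : EE n) : coface 0 s = insertCoord 0 (1 - ∑ j, s j) s := rfl

theorem coface_succ (i : Fin (n + 1)) (s : EE n) : coface i.succ s = insertCoord i 0 s := rfl

theorem contDiff_coface (i : Fin (n + 2)) : ContDiff ℝ ∞ (coface i : EE n → EE (n + 1)) := by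
  have hs : ContDiff ℝ ∞ fun s : EE n => 1 - ∑ j, s j :=
    contDiff_const.sub (ContDiff.sum fun j _ => contDiff_piLp_apply 2)
  refine Fin.cases ?_ (fun i => ?_) i
  · exact (contDiff_insertCoord 0).comp (hs.prodMk contDiff_id)
  · exact (contDiff_insertCoord i).comp (contDiff_const.prodMk contDiff_id)

theorem bary_coface_self (i : Fin (n + 2)) (s : EE n) : bary i (coface i s) = 0 := by
  refine Fin.cases ?_ (fun i => ?_) i
  · simp [bary, coface_zero, sum_insertCoord]
  · simp [bary, coface_succ]

/-- Together with `bary_coface_self` this describes cofaces in barycentric coordinates as insertion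
of a zero at position `i`, which matches omitting the `i`-th vertex of a string. -/
theorem bary_coface_succAbove (i : Fin (n + 2)) (j : Fin (n + 1)) (s : EE n) :
    bary (i.succAbove j) (coface i s) = bary j s := by
  refine Fin.cases ?_ (fun i => ?_) i
  · rw [Fin.succAbove_zero, coface_zero]
    refine Fin.cases ?_ (fun j => ?_) j
    · exact insertCoord_same 0 _ s
    · have := insertCoord_succAbove 0 (1 - ∑ j, s j) s j
      rw [Fin.succAbove_zero] at this
      simpa [bary] using this
  · rw [coface_succ]
    refine Fin.cases ?_ (fun j => ?_) j
    · simp [bary, sum_insertCoord]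
    · simp [bary]

theorem sum_bary (t : EE n) : ∑ i, bary i t = 1 := by
  rw [Fin.sum_univ_succ]
  simp [bary]

/-- The divergence theorem on the standard simplex. -/
theorem setIntegral_simplex_divergence {F : Fin (n + 1) → EE (n + 1) → V}
    (hF : ∀ i, ContDiff ℝ ∞ (F i)) :
    ∫ t in simplex (n + 1), ∑ i, fderiv ℝ (F i) t (EuclideanSpace.single i 1) =
      (∫ s in simplex n, ∑ i, F i (coface 0 s)) - ∑ i, ∫ s in simplex n, F i (coface i.succ s) := by
  have hi : ∀ {l : ℕ} {H : EE l → V}, Continuous H → IntegrableOn H (simplex l) := fun hH =>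
    hH.continuousOn.integrableOn_compact (isCompact_simplex _)
  have hc : ∀ i l, Continuous fun s => F i (coface l s) := fun i l =>
    (hF i).continuous.comp (contDiff_coface l).continuous
  have hs : Continuous fun s : EE n => 1 - ∑ j, s j :=
    continuous_const.sub (continuous_finsetSum _ fun j _ =>
      (EuclideanSpace.proj (𝕜 := ℝ) j).continuous)
  rw [integral_finsetSum _ fun i _ => hi (((hF i).continuous_fderiv (by simp)).clm_apply
    continuous_const), integral_finsetSum _ fun i _ => hi (hc i 0), ← Finset.sum_sub_distrib]
  refine Finset.sum_congr rfl fun i _ => ?_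
  rw [setIntegral_simplex_fderiv i (hF i), integral_sub, setIntegral_simplex_top i (hF i).continuous]
  · rfl
  · exact hi ((hF i).continuous.comp ((contDiff_insertCoord i).continuous.comp
      (hs.prodMk continuous_id)))
  · exact hi (hc i i.succ)

/-- Used for the coface maps, which are affine: their derivatives are read off from increments. -/
theorem fderiv_apply_eq_of_affine {W : Type*} [NormedAddCommGroup W] [NormedSpace ℝ W] {f : W → V}
    {x v : W} {d : V} (hf : DifferentiableAt ℝ f x) (h : ∀ r : ℝ, f (x + r • v) = f x + r • d) :
    fderiv ℝ f x v = d := by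
  rw [← hf.lineDeriv_eq_fderiv, lineDeriv, funext h]
  simpa using (((hasDerivAt_id (0 : ℝ)).smul_const d).const_add (f x)).deriv

theorem fderiv_coface_succ (i : Fin (n + 1)) (s : EE n) (j : Fin n) :
    fderiv ℝ (coface i.succ) s (EuclideanSpace.single j 1) =
      EuclideanSpace.single (i.succAbove j) 1 := by
  refine fderiv_apply_eq_of_affine ((contDiff_coface i.succ).differentiable (by simp) s) fun r => ?_
  refine euclidean_ext_succAbove i ?_ fun l => ?_
  · simp [coface_succ, (Fin.succAbove_ne i j).symm]
  · simp [coface_succ]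

theorem fderiv_coface_zero (s : EE n) (j : Fin n) :
    fderiv ℝ (coface 0) s (EuclideanSpace.single j 1) =
      EuclideanSpace.single j.succ 1 - EuclideanSpace.single 0 1 := by
  refine fderiv_apply_eq_of_affine ((contDiff_coface 0).differentiable (by simp) s) fun r => ?_
  refine euclidean_ext_succAbove 0 ?_ fun l => ?_
  · simp [coface_zero, Finset.sum_add_distrib]
    ring
  · rw [coface_zero, coface_zero, insertCoord_succAbove, PiLp.add_apply, PiLp.add_apply,
      insertCoord_succAbove]
    simp

end SimplexCalculus

/-! ### Deleting one entry from a frame followed by base vectors. -/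

section FinAppend

variable {α : Type*} {k n q : ℕ}

theorem sum_fin_append {V : Type*} [AddCommMonoid V] (h : k = n + q) (S : Fin k → V) :
    ∑ i, S i = ∑ i : Fin n, S (Fin.cast h.symm (Fin.castAdd q i)) +
      ∑ j : Fin q, S (Fin.cast h.symm (Fin.natAdd n j)) := by
  subst h
  exact Fin.sum_univ_add S

theorem removeNth_append_left (h : k + 1 = n + 1 + q) (hk : k = n + q) (e : Fin (n + 1) → α)
    (v : Fin q → α) (i : Fin (n + 1)) :
    (Fin.cast h.symm (Fin.castAdd q i)).removeNth (Fin.append e v ∘ Fin.cast h) =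
      Fin.append (i.removeNth e) v ∘ Fin.cast hk := by
  subst hk
  funext l
  refine Fin.addCases (fun j => ?_) (fun j => ?_) l
  · have : Fin.cast h ((Fin.cast h.symm (Fin.castAdd q i)).succAbove (Fin.castAdd q j)) =
        Fin.castAdd q (i.succAbove j) := by
      ext
      simp only [Fin.succAbove, Fin.lt_def, Fin.val_cast, Fin.val_castAdd, Fin.val_castSucc]
      split_ifs <;> simp
    refine (congrArg (Fin.append e v) this).trans ?_
    simp [Fin.removeNth]
  · have : Fin.cast h ((Fin.cast h.symm (Fin.castAdd q i)).succAbove (Fin.natAdd n j)) =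
        Fin.natAdd (n + 1) j := by
      ext
      simp only [Fin.succAbove, Fin.lt_def, Fin.val_cast, Fin.val_castAdd, Fin.val_castSucc,
        Fin.val_natAdd]
      split_ifs <;> simp <;> omega
    refine (congrArg (Fin.append e v) this).trans ?_
    simp

theorem removeNth_append_right (h : k + 1 = n + (q + 1)) (hk : k = n + q) (e : Fin n → α)
    (v : Fin (q + 1) → α) (j : Fin (q + 1)) :
    (Fin.cast h.symm (Fin.natAdd n j)).removeNth (Fin.append e v ∘ Fin.cast h) =
      Fin.append e (j.removeNth v) ∘ Fin.cast hk := by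
  subst hk
  funext l
  refine Fin.addCases (fun i => ?_) (fun i => ?_) l
  · have : Fin.cast h ((Fin.cast h.symm (Fin.natAdd n j)).succAbove (Fin.castAdd q i)) =
        Fin.castAdd (q + 1) i := by
      ext
      simp only [Fin.succAbove, Fin.lt_def, Fin.val_cast, Fin.val_castAdd, Fin.val_castSucc,
        Fin.val_natAdd]
      split_ifs <;> simp; omega
    refine (congrArg (Fin.append e v) this).trans ?_
    simp
  · have : Fin.cast h ((Fin.cast h.symm (Fin.natAdd n j)).succAbove (Fin.natAdd n i)) =
        Fin.natAdd n (j.succAbove i) := by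
      ext
      simp only [Fin.succAbove, Fin.lt_def, Fin.val_cast, Fin.val_castSucc,
        Fin.val_natAdd]
      split_ifs <;> simp <;> omega
    refine (congrArg (Fin.append e v) this).trans ?_
    simp [Fin.removeNth]

end FinAppend

/-! ### Alternating forms on the edges of a simplex. -/

section AlternatingFace

variable {W V : Type*} [NormedAddCommGroup W] [NormedSpace ℝ W]
  [NormedAddCommGroup V] [NormedSpace ℝ V] {n q k : ℕ}

/-- Each subtraction of the fixed argument `z i` adds a term with a repeated argument, which is
zero. -/
theorem alternating_sub_of_mem {ι : Type*} [DecidableEq ι] (K : W [⋀^ι]→L[ℝ] V) (z : ι → W) (i : ι)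
    (S : Finset ι) (hi : i ∉ S) : K (fun j => if j ∈ S then z j - z i else z j) = K z := by
  induction S using Finset.induction_on with
  | empty => simp
  | insert l S hl ih =>
    have hil : l ≠ i := fun h => hi (by simp [h])
    have hi' : i ∉ S := fun h => hi (by simp [h])
    rw [← ih hi']
    have h1 : (fun j => if j ∈ insert l S then z j - z i else z j) =
        Function.update (fun j => if j ∈ S then z j - z i else z j) l (z l - z i) := by
      funext j
      by_cases hj : j = l
      · subst hj; simp
      · simp [hj]
    have h2 : (fun j => if j ∈ S then z j - z i else z j) =
        Function.update (fun j => if j ∈ S then z j - z i else z j) l (z l) := by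
      simp [hl]
    rw [h1, K.map_update_sub, ← h2, sub_eq_self]
    refine K.map_eq_zero_of_eq _ (i := l) (j := i) ?_ hil
    simp [hi', hil.symm]

theorem neg_one_pow_zsmul {V : Type*} [AddCommGroup V] [Module ℝ V] (n : ℕ) (x : V) :
    (-1 : ℤ) ^ n • x = (-1 : ℝ) ^ n • x := by
  rw [← Int.cast_smul_eq_zsmul ℝ]
  simp

/-- The value of an alternating form on the edges of a simplex at its first vertex, as an
alternating sum over the faces. -/
theorem alternating_edges (hk : k = n + q) (g : W [⋀^Fin k]→L[ℝ] V) (l : W →L[ℝ] ℝ)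
    (e : Fin (n + 1) → W) (v : Fin q → W) (he : ∀ i, l (e i) = 1) (hv : ∀ j, l (v j) = 0) :
    g (Fin.append (fun j : Fin n => e j.succ - e 0) v ∘ Fin.cast hk) =
      ∑ i : Fin (n + 1), (-1 : ℝ) ^ (i : ℕ) •
        g (Fin.append (i.removeNth e) v ∘ Fin.cast hk) := by
  have h : k + 1 = n + 1 + q := by omega
  -- `K` is the exterior product of `l` and `g`. On `e` it is the alternating sum; on `e₀, e₁ - e₀,
  -- …` the functional `l` is nonzero only on `e₀`, which leaves the value of `g` on the edges. The
  -- two values of `K` agree by `alternating_sub_of_mem`.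
  let K : W [⋀^Fin (k + 1)]→L[ℝ] V :=
    ContinuousAlternatingMap.alternatizeUncurryFin (l.smulRight g)
  have hK : ∀ (e : Fin (n + 1) → W), K (Fin.append e v ∘ Fin.cast h) =
      ∑ i : Fin (n + 1), (-1 : ℝ) ^ (i : ℕ) • l (e i) •
        g (Fin.append (i.removeNth e) v ∘ Fin.cast hk) := by
    intro e
    rw [ContinuousAlternatingMap.alternatizeUncurryFin_apply, sum_fin_append h]
    simp only [removeNth_append_left h hk]
    simp only [ContinuousLinearMap.smulRight_apply, ContinuousAlternatingMap.smul_apply,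
      Function.comp_apply, Fin.cast_cast, Fin.cast_eq_self, Fin.append_left, Fin.append_right, hv,
      zero_smul, Fin.val_cast, Fin.val_castAdd, neg_one_pow_zsmul]
    simp
  have h1 := hK e
  simp only [he, one_smul] at h1
  rw [← h1]
  have h2 := hK (Fin.cons (e 0) fun j => e j.succ - e 0)
  rw [Fin.sum_univ_succ] at h2
  simp [he] at h2
  rw [← h2]
  let S : Finset (Fin (k + 1)) := Finset.univ.filter fun i => 0 < (i : ℕ) ∧ (i : ℕ) < n + 1
  have hS : ∀ i, i ∈ S ↔ 0 < (i : ℕ) ∧ (i : ℕ) < n + 1 := fun i => by simp [S]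
  refine Eq.trans ?_ (alternating_sub_of_mem K (Fin.append e v ∘ Fin.cast h)
    (Fin.cast h.symm (Fin.castAdd q 0)) S fun hi => absurd ((hS _).1 hi).1 (lt_irrefl 0))
  refine congrArg K (funext fun i => ?_)
  obtain ⟨i, rfl⟩ := (finCongr h.symm).surjective i
  refine Fin.addCases (fun i => ?_) (fun i => ?_) i
  · refine Fin.cases ?_ (fun i => ?_) i
    · rw [if_neg fun hi => absurd ((hS _).1 hi).1 (lt_irrefl 0)]
      simp
    · rw [if_pos ((hS _).2 ⟨Nat.succ_pos i, i.succ.2⟩)]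
      simp
  · rw [if_neg fun hi => by have := ((hS _).1 hi).2; simp at this; omega]
    simp

end AlternatingFace

/-! ### Differentiation under the integral sign over a compact set. -/

section SetIntegral

/-- The dominating function is the constant bound of the partial derivative on the compact set `K ×
closedBall x 1`. -/
theorem hasFDerivAt_setIntegral {n m : ℕ} {K : Set (EE n)} (hK : IsCompact K) {V : Type*}
    [NormedAddCommGroup V] [NormedSpace ℝ V] {F : EE n × EE m → V}
    (hF : ContDiff ℝ ∞ F) (x : EE m) : HasFDerivAt (fun x => ∫ t in K, F (t, x))
      (∫ t in K, (fderiv ℝ F (t, x)).comp (ContinuousLinearMap.inr ℝ (EE n) (EE m))) x := by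
  have hF' : Continuous fun z : EE n × EE m =>
      (fderiv ℝ F z).comp (ContinuousLinearMap.inr ℝ (EE n) (EE m)) :=
    (hF.continuous_fderiv (by simp)).clm_comp continuous_const
  obtain ⟨C, hC⟩ := (hK.prod (isCompact_closedBall x 1)).exists_bound_of_continuousOn
    hF'.continuousOn
  refine hasFDerivAt_integral_of_dominated_of_fderiv_le (bound := fun _ => C)
    (F' := fun x t => (fderiv ℝ F (t, x)).comp (ContinuousLinearMap.inr ℝ (EE n) (EE m)))
    (Metric.closedBall_mem_nhds x one_pos) ?_ ?_ ?_ ?_ ?_ ?_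
  · exact Filter.Eventually.of_forall fun y =>
      (hF.continuous.comp (Continuous.prodMk_left y)).aestronglyMeasurable
  · exact ((hF.continuous.comp (Continuous.prodMk_left x)).continuousOn).integrableOn_compact hK
  · have : SecondCountableTopologyEither (EE n) (EE m →L[ℝ] V) := ⟨Or.inl inferInstance⟩
    exact (hF'.comp (Continuous.prodMk_left x)).aestronglyMeasurable
  · refine (ae_restrict_iff' hK.measurableSet).2 (Filter.Eventually.of_forall fun t ht y hy => ?_)
    exact hC (t, y) ⟨ht, hy⟩
  · exact continuousOn_const.integrableOn_compact hK
  · refine Filter.Eventually.of_forall fun t y _ => ?_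
    have h1 := (hF.differentiable (by simp) (t, y)).hasFDerivAt
    exact h1.comp y (hasFDerivAt_prodMk_right t y)

theorem fderiv_setIntegral_apply {n m : ℕ} {K : Set (EE n)} (hK : IsCompact K) {V : Type*}
    [NormedAddCommGroup V] [NormedSpace ℝ V] [CompleteSpace V] {F : EE n × EE m → V}
    (hF : ContDiff ℝ ∞ F) (x v : EE m) : fderiv ℝ (fun x => ∫ t in K, F (t, x)) x v =
      ∫ t in K, fderiv ℝ F (t, x) (0, v) := by
  have hF' : Continuous fun z : EE n × EE m =>
      (fderiv ℝ F z).comp (ContinuousLinearMap.inr ℝ (EE n) (EE m)) :=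
    (hF.continuous_fderiv (by simp)).clm_comp continuous_const
  rw [(hasFDerivAt_setIntegral hK hF x).fderiv, ContinuousLinearMap.integral_apply]
  · simp
  · exact ((hF'.comp (Continuous.prodMk_left x)).continuousOn).integrableOn_compact hK

end SetIntegral

/-! ### Stokes' theorem for integration over simplex fibres. -/

section Stokes

variable {X : Type*} {D : DiffeologicalSpace X} {V : Type*} [NormedAddCommGroup V]
  [NormedSpace ℝ V] {n q k m : ℕ}

/-- The coordinate vectors of the first factor of `ℝⁿ × ℝᵐ`. -/
def simplexFrame (n m : ℕ) (i : Fin n) : EE (n + m) :=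
  (splitE n m).symm (EuclideanSpace.single i 1, 0)

/-- The inclusion of the second factor of `ℝⁿ × ℝᵐ`. -/
def baseVec (n : ℕ) {m : ℕ} (v : EE m) : EE (n + m) := (splitE n m).symm (0, v)

/-- The plot `id × p`. -/
def prodPlot (n : ℕ) (p : D.plots m) : (prodD (mfdD (EE n) (EE n)) D).plots (n + m) :=
  ⟨idProd n p.1, idProd_mem D n p⟩

variable [FiniteDimensional ℝ V]

/-- Evaluation on `v` is a continuous linear map, so it passes under the integral of alternating
maps. -/
theorem simplexIntegral_apply (w : Form (prodD (mfdD (EE n) (EE n)) D) (n + q) V)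
    (p : D.plots m) (x : EE m) (v : Fin q → EE m) : (simplexIntegral n q w).1 m p x v =
      ∫ t in simplex n, w.1 (n + m) (prodPlot n p) ((splitE n m).symm (t, x))
        (Fin.append (simplexFrame n m) fun j => baseVec n (v j)) := by
  have : CompleteSpace V := FiniteDimensional.complete ℝ V
  let L : (EE m [⋀^Fin q]→L[ℝ] V) →L[ℝ] V := LinearMap.toContinuousLinearMap
    ({ toFun := fun f => f v, map_add' := fun _ _ => rfl, map_smul' := fun _ _ => rfl } :
      (EE m [⋀^Fin q]→L[ℝ] V) →ₗ[ℝ] V)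
  exact (L.integral_comp_comm ((((contDiff_insertFrame w p).continuous.comp
    (Continuous.prodMk_left x)).continuousOn).integrableOn_compact (isCompact_simplex n))).symm

theorem simplexIntegral_castDeg_apply (h : k = n + q)
    (w : Form (prodD (mfdD (EE n) (EE n)) D) k V) (p : D.plots m) (x : EE m) (v : Fin q → EE m) :
    (simplexIntegral n q (castDeg h w)).1 m p x v =
      ∫ t in simplex n, w.1 (n + m) (prodPlot n p) ((splitE n m).symm (t, x))
        (Fin.append (simplexFrame n m) (fun j => baseVec n (v j)) ∘ Fin.cast h) := by
  subst h
  exact simplexIntegral_apply w p x v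

theorem contDiff_form_split (w : Form (prodD (mfdD (EE n) (EE n)) D) k V) (p : D.plots m)
    (z : Fin k → EE (n + m)) : ContDiff ℝ ∞ fun y : EE n × EE m =>
      w.1 (n + m) (prodPlot n p) ((splitE n m).symm y) z :=
  (contDiff_alternating_iff.1 (form_smooth w _ _) z).comp (splitE n m).symm.contDiff

theorem fderiv_form_split (w : Form (prodD (mfdD (EE n) (EE n)) D) k V) (p : D.plots m)
    (z : Fin k → EE (n + m)) (y : EE n × EE m) (u : EE n × EE m) :
    fderiv ℝ (fun y => w.1 (n + m) (prodPlot n p) ((splitE n m).symm y) z) y u =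
      fderiv ℝ (fun y => w.1 (n + m) (prodPlot n p) y z) ((splitE n m).symm y)
        ((splitE n m).symm u) := by
  have h1 : DifferentiableAt ℝ (fun y => w.1 (n + m) (prodPlot n p) y z) ((splitE n m).symm y) :=
    ((contDiff_alternating_iff.1 (form_smooth w _ (prodPlot n p)) z).differentiable (by simp)) _
  have h2 : HasFDerivAt (fun y => w.1 (n + m) (prodPlot n p) ((splitE n m).symm y) z) _ y :=
    h1.hasFDerivAt.comp y (splitE n m).symm.hasFDerivAt
  rw [h2.fderiv]
  rfl

theorem fderiv_comp_prodMk_left {F : EE n × EE m → V} (hF : ContDiff ℝ ∞ F) (t : EE n) (x : EE m)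
    (u : EE n) : fderiv ℝ (fun t => F (t, x)) t u = fderiv ℝ F (t, x) (u, 0) := by
  have h : HasFDerivAt (fun t => F (t, x)) _ t :=
    (hF.differentiable (by simp) (t, x)).hasFDerivAt.comp t (hasFDerivAt_prodMk_left (𝕜 := ℝ) t x)
  rw [h.fderiv]
  simp

/-- The exterior derivative of a form on `ℝⁿ × X`, evaluated on the coordinate vectors of `ℝⁿ` and
vectors of the second factor. -/
theorem extD_prod_apply {N : ℕ} (h : k + 1 = N + q) (w : Form (prodD (mfdD (EE N) (EE N)) D) k V)
    (p : D.plots m) (t : EE N) (x : EE m) (v : Fin q → EE m) :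
    (extD w).1 (N + m) (prodPlot N p) ((splitE N m).symm (t, x))
        (Fin.append (simplexFrame N m) (fun j => baseVec N (v j)) ∘ Fin.cast h) =
      (∑ i : Fin N, (-1 : ℝ) ^ (i : ℕ) • fderiv ℝ (fun t => w.1 (N + m) (prodPlot N p)
        ((splitE N m).symm (t, x)) ((Fin.cast h.symm (Fin.castAdd q i)).removeNth
          (Fin.append (simplexFrame N m) (fun j => baseVec N (v j)) ∘ Fin.cast h))) t
            (EuclideanSpace.single i 1)) +
      ∑ j : Fin q, (-1 : ℝ) ^ (N + j : ℕ) • fderiv ℝ (fun z : EE N × EE m =>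
        w.1 (N + m) (prodPlot N p) ((splitE N m).symm z)
          ((Fin.cast h.symm (Fin.natAdd N j)).removeNth
          (Fin.append (simplexFrame N m) (fun j => baseVec N (v j)) ∘ Fin.cast h))) (t, x)
            (0, v j) := by
  refine (extDeriv_apply ((form_smooth w _ (prodPlot N p)).differentiable (by simp) _) _).trans ?_
  rw [sum_fin_append h]
  congr 1
  · refine Finset.sum_congr rfl fun i _ => ?_
    rw [neg_one_pow_zsmul]
    refine Eq.trans ?_ (congrArg ((-1 : ℝ) ^ (i : ℕ) • ·)
      (fderiv_comp_prodMk_left (contDiff_form_split w p _) t x _).symm)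
    refine Eq.trans ?_ (congrArg ((-1 : ℝ) ^ (i : ℕ) • ·) (fderiv_form_split w p _ _ _).symm)
    simp [simplexFrame]
  · refine Finset.sum_congr rfl fun j _ => ?_
    rw [neg_one_pow_zsmul]
    refine Eq.trans ?_ (congrArg ((-1 : ℝ) ^ (N + j : ℕ) • ·) (fderiv_form_split w p _ _ _).symm)
    simp [baseVec]

/-- The terms of `extD_prod_apply` in the direction of `X`, integrated over the simplex. -/
theorem integral_base_terms {N : ℕ} (hk : k = N + q) (h : k + 1 = N + (q + 1))
    (w : Form (prodD (mfdD (EE N) (EE N)) D) k V)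
    (p : D.plots m) (x : EE m) (v : Fin (q + 1) → EE m) :
    ∫ t in simplex N, ∑ j : Fin (q + 1), (-1 : ℝ) ^ (N + j : ℕ) • fderiv ℝ (fun z : EE N × EE m =>
        w.1 (N + m) (prodPlot N p) ((splitE N m).symm z)
          ((Fin.cast h.symm (Fin.natAdd N j)).removeNth
          (Fin.append (simplexFrame N m) (fun j => baseVec N (v j)) ∘ Fin.cast h))) (t, x)
            (0, v j) =
      (-1 : ℝ) ^ N • (extD (simplexIntegral N q (castDeg hk w))).1 m p x v := by
  have : CompleteSpace V := FiniteDimensional.complete ℝ V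
  have hi : ∀ {H : EE N → V}, Continuous H → IntegrableOn H (simplex N) := fun hH =>
    hH.continuousOn.integrableOn_compact (isCompact_simplex _)
  rw [integral_finsetSum]
  · refine Eq.trans ?_ (congrArg ((-1 : ℝ) ^ N • ·) (extDeriv_apply
      ((form_smooth (simplexIntegral N q (castDeg hk w)) m p).differentiable (by simp) _) v)).symm
    rw [Finset.smul_sum]
    refine Finset.sum_congr rfl fun j _ => ?_
    rw [integral_smul, neg_one_pow_zsmul, smul_smul, ← pow_add]
    congr 1
    -- Deleting a base vector leaves the simplex frame intact, so each term is a derivative under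
    -- the integral; the sign `(-1)^N` records that the base vectors come after the `N` frame
    -- vectors.
    have h1 : (fun x => (simplexIntegral N q (castDeg hk w)).1 m p x (j.removeNth v)) = fun x =>
        ∫ t in simplex N, w.1 (N + m) (prodPlot N p) ((splitE N m).symm (t, x))
          ((Fin.cast h.symm (Fin.natAdd N j)).removeNth
            (Fin.append (simplexFrame N m) (fun j => baseVec N (v j)) ∘ Fin.cast h)) := by
      funext x
      rw [removeNth_append_right h hk]
      exact simplexIntegral_castDeg_apply hk w p x _
    exact (fderiv_setIntegral_apply (isCompact_simplex N) (contDiff_form_split w p _) x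
      (v j)).symm.trans (congrArg (fun F => fderiv ℝ F x (v j)) h1.symm)
  · intro j _
    refine hi (Continuous.const_smul ?_ _)
    exact (((contDiff_form_split w p _).continuous_fderiv (by simp)).comp
      (Continuous.prodMk_left x)).clm_apply continuous_const

/-- Integration over the `0`-simplex commutes with the exterior derivative. -/
theorem simplexIntegral_zero_extD (hk : k = 0 + q) (h : k + 1 = 0 + (q + 1))
    (w : Form (prodD (mfdD (EE 0) (EE 0)) D) k V) :
    simplexIntegral 0 (q + 1) (castDeg h (extD w)) =
      extD (simplexIntegral 0 q (castDeg hk w)) := by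
  refine form_ext fun m p x v => ?_
  refine (simplexIntegral_castDeg_apply h (extD w) p x v).trans ?_
  simp only [extD_prod_apply h]
  refine Eq.trans ?_ ((integral_base_terms hk h w p x v).trans (by simp))
  simp

theorem smooth_coface (i : Fin (n + 2)) :
    Smooth (mfdD (EE n) (EE n)) (mfdD (EE (n + 1)) (EE (n + 1))) (coface i) :=
  smooth_of_contMDiff (contDiff_coface i).contMDiff

theorem cofaceProd_smooth (D : DiffeologicalSpace X) (i : Fin (n + 2)) :
    Smooth (prodD (mfdD (EE n) (EE n)) D) (prodD (mfdD (EE (n + 1)) (EE (n + 1))) D)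
      (Prod.map (coface i) id) := smooth_prodMap (smooth_coface i) (smooth_id D)

/-- The restriction of a form on `Δₙ₊₁ × X` to the `i`-th face of the simplex. -/
def restrictFace (i : Fin (n + 2)) :
    Form (prodD (mfdD (EE (n + 1)) (EE (n + 1))) D) k V →ₗ[ℝ]
      Form (prodD (mfdD (EE n) (EE n)) D) k V :=
  pullback (Prod.map (coface i) id) (cofaceProd_smooth D i)

theorem restrictFace_apply (i : Fin (n + 2)) (w : Form (prodD (mfdD (EE (n + 1)) (EE (n + 1))) D) k V)
    (p : D.plots m) (s : EE n) (x : EE m) (z : Fin k → EE n × EE m) :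
    (restrictFace i w).1 (n + m) (prodPlot n p) ((splitE n m).symm (s, x))
        (fun j => (splitE n m).symm (z j)) =
      w.1 (n + 1 + m) (prodPlot (n + 1) p) ((splitE (n + 1) m).symm (coface i s, x))
        (fun j => (splitE (n + 1) m).symm (fderiv ℝ (coface i) s (z j).1, (z j).2)) := by
  let f : EE (n + m) → EE (n + 1 + m) := fun y =>
    (splitE (n + 1) m).symm (coface i (splitE n m y).1, (splitE n m y).2)
  have hf : ContDiff ℝ ∞ f := (splitE (n + 1) m).symm.contDiff.comp
    (((contDiff_coface i).comp (contDiff_fst.comp (splitE n m).contDiff)).prodMk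
      (contDiff_snd.comp (splitE n m).contDiff))
  have hq : Prod.map (coface i) id ∘ idProd n p.1 = idProd (n + 1) p.1 ∘ f := by
    funext y
    simp [idProd, f]
  refine (form_compat_mk w (idProd_mem D (n + 1) p) hf _ hq _ _).trans ?_
  have hx : f ((splitE n m).symm (s, x)) = (splitE (n + 1) m).symm (coface i s, x) := by simp [f]
  rw [hx]
  refine congrArg _ (funext fun j => ?_)
  have hd : HasFDerivAt f ((splitE (n + 1) m).symm.toContinuousLinearMap.comp
      (((fderiv ℝ (coface i) s).comp ((ContinuousLinearMap.fst ℝ _ _).comp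
        (splitE n m).toContinuousLinearMap)).prod
        ((ContinuousLinearMap.snd ℝ _ _).comp (splitE n m).toContinuousLinearMap)))
        ((splitE n m).symm (s, x)) := by
    refine (splitE (n + 1) m).symm.hasFDerivAt.comp _ (HasFDerivAt.prodMk ?_ ?_)
    · have h1 : HasFDerivAt (coface i) (fderiv ℝ (coface i) s)
          (splitE n m ((splitE n m).symm (s, x))).1 := by
        simpa using ((contDiff_coface i).differentiable (by simp) s).hasFDerivAt
      exact HasFDerivAt.comp (g := coface i) (f := fun z => (splitE n m z).1)
        ((splitE n m).symm (s, x)) h1 ((ContinuousLinearMap.fst ℝ _ _).comp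
          (splitE n m).toContinuousLinearMap).hasFDerivAt
    · exact ((ContinuousLinearMap.snd ℝ _ _).comp
        (splitE n m).toContinuousLinearMap).hasFDerivAt
  rw [hd.fderiv]
  simp

/-- The coface acts only on the simplex factor, so frame vectors are mapped by its derivative and
base vectors are unchanged. -/
theorem restrictFace_frame (i : Fin (n + 2)) (hk : k = n + q)
    (w : Form (prodD (mfdD (EE (n + 1)) (EE (n + 1))) D) k V)
    (p : D.plots m) (s : EE n) (x : EE m) (v : Fin q → EE m) :
    (restrictFace i w).1 (n + m) (prodPlot n p) ((splitE n m).symm (s, x))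
        (Fin.append (simplexFrame n m) (fun j => baseVec n (v j)) ∘ Fin.cast hk) =
      w.1 (n + 1 + m) (prodPlot (n + 1) p) ((splitE (n + 1) m).symm (coface i s, x))
        (Fin.append (fun j => (splitE (n + 1) m).symm
          (fderiv ℝ (coface i) s (EuclideanSpace.single j 1), 0))
          (fun j => baseVec (n + 1) (v j)) ∘ Fin.cast hk) := by
  refine Eq.trans (congrArg _ (funext fun l => ?_)) ((restrictFace_apply i w p s x
    (Fin.append (fun j => (EuclideanSpace.single j 1, 0)) (fun j => (0, v j)) ∘
      Fin.cast hk)).trans (congrArg _ (funext fun l => ?_)))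
  · subst hk
    refine Fin.addCases (fun j => ?_) (fun j => ?_) l <;> simp [simplexFrame, baseVec]
  · subst hk
    refine Fin.addCases (fun j => ?_) (fun j => ?_) l <;> simp [baseVec]

/-- The fibre derivative terms of `extD_prod_apply`, integrated over the simplex. -/
theorem integral_fibre_terms (hk : k = n + q) (h : k + 1 = n + 1 + q)
    (w : Form (prodD (mfdD (EE (n + 1)) (EE (n + 1))) D) k V)
    (p : D.plots m) (x : EE m) (v : Fin q → EE m) :
    ∫ t in simplex (n + 1), ∑ i : Fin (n + 1), (-1 : ℝ) ^ (i : ℕ) • fderiv ℝ (fun t =>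
        w.1 (n + 1 + m) (prodPlot (n + 1) p) ((splitE (n + 1) m).symm (t, x))
          ((Fin.cast h.symm (Fin.castAdd q i)).removeNth
          (Fin.append (simplexFrame (n + 1) m) (fun j => baseVec (n + 1) (v j)) ∘ Fin.cast h))) t
            (EuclideanSpace.single i 1) =
      ∑ i : Fin (n + 2), (-1 : ℝ) ^ (i : ℕ) •
        (simplexIntegral n q (castDeg hk (restrictFace i w))).1 m p x v := by
  have : CompleteSpace V := FiniteDimensional.complete ℝ V
  -- The signed components with the `i`-th frame vector deleted form a vector field on the simplex
  -- whose divergence is the fibre part of the exterior derivative.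
  let F : Fin (n + 1) → EE (n + 1) → V := fun i t => (-1 : ℝ) ^ (i : ℕ) •
    w.1 (n + 1 + m) (prodPlot (n + 1) p) ((splitE (n + 1) m).symm (t, x))
      ((Fin.cast h.symm (Fin.castAdd q i)).removeNth
      (Fin.append (simplexFrame (n + 1) m) (fun j => baseVec (n + 1) (v j)) ∘ Fin.cast h))
  have hF' : ∀ i, ContDiff ℝ ∞ fun t =>
      w.1 (n + 1 + m) (prodPlot (n + 1) p) ((splitE (n + 1) m).symm (t, x))
      ((Fin.cast h.symm (Fin.castAdd q i)).removeNth
      (Fin.append (simplexFrame (n + 1) m) (fun j => baseVec (n + 1) (v j)) ∘ Fin.cast h)) :=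
    fun i => (contDiff_form_split w p _).comp (contDiff_id.prodMk contDiff_const)
  have hF : ∀ i, ContDiff ℝ ∞ (F i) := fun i => (hF' i).const_smul _
  refine Eq.trans ?_ ((setIntegral_simplex_divergence hF).trans ?_)
  · refine integral_congr_ae (Filter.Eventually.of_forall fun t => ?_)
    refine Finset.sum_congr rfl fun i _ => ?_
    exact (congrArg (fun L : EE (n + 1) →L[ℝ] V => L (EuclideanSpace.single i 1))
      (fderiv_fun_const_smul ((hF' i).differentiable (by simp) t) ((-1 : ℝ) ^ (i : ℕ)))).symm
  · rw [Fin.sum_univ_succ (n := n + 1), sub_eq_add_neg, ← Finset.sum_neg_distrib]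
    congr 1
    · rw [Fin.val_zero, pow_zero, one_smul]
      refine Eq.trans ?_ (simplexIntegral_castDeg_apply hk (restrictFace 0 w) p x v).symm
      refine integral_congr_ae (Filter.Eventually.of_forall fun s => ?_)
      refine Eq.trans ?_ (restrictFace_frame 0 hk w p s x v).symm
      -- On the slanted face all components contribute. The sum of the simplex coordinates is `1` on
      -- frame vectors and `0` on base vectors, so `alternating_edges` combines them into the value
      -- on the tangent frame `eⱼ₊₁ - e₀` of that face.
      let l : EE (n + 1 + m) →L[ℝ] ℝ := ∑ i : Fin (n + 1), (EuclideanSpace.proj (𝕜 := ℝ) i).comp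
        ((ContinuousLinearMap.fst ℝ _ _).comp (splitE (n + 1) m).toContinuousLinearMap)
      have he := alternating_edges hk
        (w.1 (n + 1 + m) (prodPlot (n + 1) p) ((splitE (n + 1) m).symm (coface 0 s, x))) l
        (simplexFrame (n + 1) m) (fun j => baseVec (n + 1) (v j))
        (fun i => by simp [l, simplexFrame]) (fun j => by simp [l, baseVec])
      simp only [fderiv_coface_zero]
      refine Eq.trans ?_ (he.symm.trans ?_)
      · refine Finset.sum_congr rfl fun i _ => ?_
        simp only [F, removeNth_append_left h hk]
      · refine congrArg _ (congrArg (· ∘ Fin.cast hk) (congrArg (Fin.append · _) ?_))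
        funext j
        simp [simplexFrame, ← map_sub]
    · refine Finset.sum_congr rfl fun i _ => ?_
      refine Eq.trans ?_ (congrArg ((-1 : ℝ) ^ (i.succ : ℕ) • ·)
        (simplexIntegral_castDeg_apply hk (restrictFace i.succ w) p x v).symm)
      -- The face `tᵢ = 0` enters the divergence theorem with a minus sign, which turns `(-1)^i`
      -- into the sign `(-1)^(i+1)` of its vertex.
      rw [Fin.val_succ, pow_succ, mul_neg_one, neg_smul, ← integral_smul]
      congr 1
      refine integral_congr_ae (Filter.Eventually.of_forall fun s => ?_)
      refine congrArg ((-1 : ℝ) ^ (i : ℕ) • ·) ?_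
      refine Eq.trans ?_ (restrictFace_frame i.succ hk w p s x v).symm
      simp only [removeNth_append_left h hk, fderiv_coface_succ]
      rfl

theorem form_sum_smul_apply {ι : Type*} (s : Finset ι) (c : ι → ℝ) (w : ι → Form D k V)
    (p : D.plots m) (x : EE m) (v : Fin k → EE m) :
    (∑ i ∈ s, c i • w i).1 m p x v = ∑ i ∈ s, c i • (w i).1 m p x v :=
  form_sum_apply s (fun i => c i • w i) p x v

theorem simplexIntegral_extD_apply {N : ℕ} (h : k + 1 = N + q)
    (w : Form (prodD (mfdD (EE N) (EE N)) D) k V) (p : D.plots m) (x : EE m) (v : Fin q → EE m) :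
    (simplexIntegral N q (castDeg h (extD w))).1 m p x v =
      (∫ t in simplex N, ∑ i : Fin N, (-1 : ℝ) ^ (i : ℕ) • fderiv ℝ (fun t =>
        w.1 (N + m) (prodPlot N p)
        ((splitE N m).symm (t, x)) ((Fin.cast h.symm (Fin.castAdd q i)).removeNth
          (Fin.append (simplexFrame N m) (fun j => baseVec N (v j)) ∘ Fin.cast h))) t
            (EuclideanSpace.single i 1)) +
      ∫ t in simplex N, ∑ j : Fin q, (-1 : ℝ) ^ (N + j : ℕ) • fderiv ℝ (fun z : EE N × EE m =>
        w.1 (N + m) (prodPlot N p) ((splitE N m).symm z)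
          ((Fin.cast h.symm (Fin.natAdd N j)).removeNth
          (Fin.append (simplexFrame N m) (fun j => baseVec N (v j)) ∘ Fin.cast h))) (t, x)
            (0, v j) := by
  have hi : ∀ {H : EE N → V}, Continuous H → IntegrableOn H (simplex N) := fun hH =>
    hH.continuousOn.integrableOn_compact (isCompact_simplex _)
  refine (simplexIntegral_castDeg_apply h (extD w) p x v).trans ?_
  simp only [extD_prod_apply h]
  refine integral_add (hi ?_) (hi ?_)
  · refine continuous_finsetSum _ fun i _ => Continuous.const_smul ?_ _
    exact (((contDiff_form_split w p _).comp
      (contDiff_id.prodMk contDiff_const)).continuous_fderiv (by simp)).clm_apply continuous_const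
  · refine continuous_finsetSum _ fun i _ => Continuous.const_smul ?_ _
    exact (((contDiff_form_split w p _).continuous_fderiv (by simp)).comp
      (Continuous.prodMk_left x)).clm_apply continuous_const

/-- Stokes' theorem for the integration over the fibres of `Δₙ₊₁ × X → X`. -/
theorem simplexIntegral_succ_extD (hN : k = n + (q + 1)) (hk : k = n + 1 + q)
    (h : k + 1 = n + 1 + (q + 1)) (w : Form (prodD (mfdD (EE (n + 1)) (EE (n + 1))) D) k V) :
    simplexIntegral (n + 1) (q + 1) (castDeg h (extD w)) =
      ∑ i : Fin (n + 2), (-1 : ℝ) ^ (i : ℕ) •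
        simplexIntegral n (q + 1) (castDeg hN (restrictFace i w)) +
      (-1 : ℝ) ^ (n + 1) • extD (simplexIntegral (n + 1) q (castDeg hk w)) := by
  refine form_ext fun m p x v => ?_
  refine (simplexIntegral_extD_apply h w p x v).trans ?_
  refine (congrArg₂ (· + ·) (integral_fibre_terms hN h w p x v)
    (integral_base_terms hk h w p x v)).trans ?_
  refine Eq.trans ?_ (map_add (formEval p x v) _ _).symm
  exact congrArg₂ (· + ·) (form_sum_smul_apply _ _ _ p x v).symm
    rfl

/-- Stokes' theorem for the integration over the fibres of `Δₙ₊₁ × X → X`, in degree zero. -/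
theorem simplexIntegral_top_extD (hN : k = n + 0)
    (h : k + 1 = n + 1 + 0) (w : Form (prodD (mfdD (EE (n + 1)) (EE (n + 1))) D) k V) :
    simplexIntegral (n + 1) 0 (castDeg h (extD w)) =
      ∑ i : Fin (n + 2), (-1 : ℝ) ^ (i : ℕ) •
        simplexIntegral n 0 (castDeg hN (restrictFace i w)) := by
  refine form_ext fun m p x v => ?_
  refine (simplexIntegral_extD_apply h w p x v).trans ?_
  refine (congrArg₂ (· + ·) (integral_fibre_terms hN h w p x v) ?_).trans (add_zero _) |>.trans
    (form_sum_smul_apply _ _ _ p x v).symm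
  simp

end Stokes

/-! ### Fibre integration as a linear and natural operator. -/

section IntegralOperator

variable {X Y : Type*} {D : DiffeologicalSpace X} {D' : DiffeologicalSpace Y} {V : Type*}
  [NormedAddCommGroup V] [NormedSpace ℝ V] [FiniteDimensional ℝ V] {n q k : ℕ}

/-- The integration over the fibres of `Δₙ × X → X` as a linear map. -/
def simplexInt (n q : ℕ) (h : k = n + q) :
    Form (prodD (mfdD (EE n) (EE n)) D) k V →ₗ[ℝ] Form D q V where
  toFun w := simplexIntegral n q (castDeg h w)
  map_add' w w' := by
    refine form_ext fun m p x v => ?_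
    refine (simplexIntegral_castDeg_apply h _ p x v).trans ?_
    refine Eq.trans ?_ (congrArg₂ (· + ·) (simplexIntegral_castDeg_apply h w p x v)
      (simplexIntegral_castDeg_apply h w' p x v)).symm
    have hi : ∀ w : Form (prodD (mfdD (EE n) (EE n)) D) k V, IntegrableOn (fun t =>
        w.1 (n + m) (prodPlot n p) ((splitE n m).symm (t, x))
          (Fin.append (simplexFrame n m) (fun j => baseVec n (v j)) ∘ Fin.cast h)) (simplex n) :=
      fun w => (((contDiff_form_split w p _).continuous.comp
        (Continuous.prodMk_left x)).continuousOn).integrableOn_compact (isCompact_simplex n)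
    exact integral_add (hi w) (hi w')
  map_smul' c w := by
    refine form_ext fun m p x v => ?_
    refine (simplexIntegral_castDeg_apply h _ p x v).trans ?_
    refine Eq.trans ?_ (congrArg (c • ·) (simplexIntegral_castDeg_apply h w p x v)).symm
    exact integral_smul c _

theorem prodMap_id_smooth (n : ℕ) {g : Y → X} (hg : Smooth D' D g) :
    Smooth (prodD (mfdD (EE n) (EE n)) D') (prodD (mfdD (EE n) (EE n)) D) (Prod.map id g) :=
  smooth_prodMap (smooth_id _) hg

/-- After identification of the degrees this is definitional, because the integral is computed in
each plot `id × p`. -/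
theorem simplexInt_pullback (h : k = n + q) {g : Y → X} (hg : Smooth D' D g)
    (w : Form (prodD (mfdD (EE n) (EE n)) D) k V) :
    simplexInt n q h (pullback (Prod.map id g) (prodMap_id_smooth n hg) w) =
      pullback g hg (simplexInt n q h w) := by
  subst h
  rfl

theorem simplex_zero : simplex 0 = Set.univ := by
  ext t
  simp [simplex]

/-- The volume of `ℝ⁰` is the Dirac measure, which normalizes integration over `Δ₀` to evaluation at
the point. -/
theorem volume_simplex_zero : (volume : Measure (EE 0)) (simplex 0) = 1 := by
  rw [simplex_zero]
  simp [volume_euclideanSpace_eq_dirac]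

theorem constProd_smooth (D : DiffeologicalSpace X) {n : ℕ} (t : EE n) :
    Smooth D (prodD (mfdD (EE n) (EE n)) D) (Prod.mk t) := fun _ _ hp =>
  mem_plots_prodD.2 ⟨contMDiff_const, hp⟩

/-- Integration over the point `Δ₀`. -/
theorem simplexInt_zero (h : q = 0 + q) (w : Form (prodD (mfdD (EE 0) (EE 0)) D) q V) :
    simplexInt 0 q h w = pullback (Prod.mk 0) (constProd_smooth D 0) w := by
  have : CompleteSpace V := FiniteDimensional.complete ℝ V
  refine form_ext fun m p x v => ?_
  refine (simplexIntegral_castDeg_apply h w p x v).trans ?_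
  have hp : Prod.mk (0 : EE 0) ∘ p.1 = idProd 0 p.1 ∘ fun x => (splitE 0 m).symm (0, x) := by
    funext x
    simp [idProd]
  have hf : ContDiff ℝ ∞ fun x : EE m => (splitE 0 m).symm (0, x) :=
    (splitE 0 m).symm.contDiff.comp (contDiff_const.prodMk contDiff_id)
  have h1 := form_compat_mk w (idProd_mem D 0 p) hf (constProd_smooth D 0 m p.1 p.2) hp x v
  refine Eq.trans ?_ h1.symm
  have hd : fderiv ℝ (fun x : EE m => (splitE 0 m).symm (0, x)) x =
      (splitE 0 m).symm.toContinuousLinearMap.comp (ContinuousLinearMap.inr ℝ _ _) :=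
    ((splitE 0 m).symm.hasFDerivAt.comp x (hasFDerivAt_prodMk_right 0 x)).fderiv
  have h2 : ∀ t : EE 0, w.1 (0 + m) (prodPlot 0 p) ((splitE 0 m).symm (t, x))
      (Fin.append (simplexFrame 0 m) (fun j => baseVec 0 (v j)) ∘ Fin.cast h) =
      w.1 (0 + m) ⟨idProd 0 p.1, idProd_mem D 0 p⟩ ((splitE 0 m).symm (0, x)) (fun i =>
        fderiv ℝ (fun x : EE m => (splitE 0 m).symm (0, x)) x (v i)) := by
    intro t
    obtain rfl : t = 0 := Subsingleton.elim _ _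
    refine congrArg _ (funext fun i => ?_)
    rw [hd]
    have h3 : Fin.cast h i = Fin.natAdd 0 i := by ext; simp
    exact (congrArg (Fin.append (simplexFrame 0 m) fun j => baseVec 0 (v j)) h3).trans
      (Fin.append_right _ _ i)
  rw [integral_congr_ae (Filter.Eventually.of_forall h2), setIntegral_const, Measure.real,
    volume_simplex_zero]
  simp

end IntegralOperator

/-! ### Simplicial forms and the chain map property of integration. -/

section SimplicialForms

variable {EΓ : Type*} [NormedAddCommGroup EΓ] [NormedSpace ℝ EΓ] [FiniteDimensional ℝ EΓ]
  {Γ : Type*} [TopologicalSpace Γ] [ChartedSpace EΓ Γ] [IsManifold 𝓘(ℝ, EΓ) ∞ Γ]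
  {E₀ : Type*} [NormedAddCommGroup E₀] [NormedSpace ℝ E₀] [FiniteDimensional ℝ E₀]
  {Γ₀ : Type*} [TopologicalSpace Γ₀] [ChartedSpace E₀ Γ₀] [IsManifold 𝓘(ℝ, E₀) ∞ Γ₀]
  {Gd : LieGroupoid EΓ Γ E₀ Γ₀} {k : ℕ}

theorem totD_totInc (n q : ℕ) (w : Form (nerveD Gd n) q ℝ) :
    totD Gd (totInc Gd n q w) =
      (-1 : ℝ) ^ n • totInc Gd n (q + 1) (extD w) + totInc Gd (n + 1) q (simplD Gd n q w) :=
  DirectSum.toModule_lof (R := ℝ) (φ := fun a : ℕ × ℕ =>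
    (-1 : ℝ) ^ a.1 • (totInc Gd a.1 (a.2 + 1) ∘ₗ extD) +
      totInc Gd (a.1 + 1) a.2 ∘ₗ simplD Gd a.1 a.2) (n, q) w

/-- A family of forms on `Δₙ × Γₙ` is a simplicial form if its restrictions to the faces of the
simplices are the pull-backs along the face maps of the nerve. -/
def IsSimplicialForm (c : ∀ n, Form (prodD (mfdD (EE n) (EE n)) (nerveD Gd n)) k ℝ) : Prop :=
  ∀ (n : ℕ) (i : Fin (n + 2)), restrictFace i (c (n + 1)) =
    pullback (Prod.map id (face Gd i)) (prodMap_id_smooth n (face_smooth Gd i)) (c n)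

/-- The component in `Ω^q(Γₙ)` of the integral of a simplicial form. -/
def intPart (c : ∀ n, Form (prodD (mfdD (EE n) (EE n)) (nerveD Gd n)) k ℝ) (n q : ℕ)
    (h : k = n + q) : TotForm Gd := totInc Gd n q (simplexInt n q h (c n))

/-- The component in `Ω^{k-n}(Γₙ)` of the integral of a simplicial form. -/
def intTerm (c : ∀ n, Form (prodD (mfdD (EE n) (EE n)) (nerveD Gd n)) k ℝ) (n : ℕ) : TotForm Gd :=
  if h : n ≤ k then intPart c n (k - n) (Nat.add_sub_of_le h).symm else 0

/-- Any `q` with `k = n + q` may stand for the truncated difference `k - n` in the form degree. -/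
theorem intTerm_eq (c : ∀ n, Form (prodD (mfdD (EE n) (EE n)) (nerveD Gd n)) k ℝ) {n q : ℕ}
    (h : k = n + q) : intTerm c n = intPart c n q h := by
  obtain rfl : q = k - n := by omega
  exact dif_pos (by omega)

/-- The integral of a simplicial form over the simplices. -/
def intTotal (c : ∀ n, Form (prodD (mfdD (EE n) (EE n)) (nerveD Gd n)) k ℝ) : TotForm Gd :=
  ∑ n ∈ Finset.range (k + 1), intTerm c n

theorem integrateSimplices_eq {k : ℕ}
    (c : ∀ n, Form (prodD (mfdD (EE n) (EE n)) (nerveD Gd n)) (k * 2) ℝ) :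
    integrateSimplices c = intTotal c := by
  rw [intTotal, ← Fin.sum_univ_eq_sum_range]
  exact Finset.sum_congr rfl fun n _ => (intTerm_eq c _).symm

theorem intTotal_sub (c c' : ∀ n, Form (prodD (mfdD (EE n) (EE n)) (nerveD Gd n)) k ℝ) :
    intTotal (fun n => c n - c' n) = intTotal c - intTotal c' := by
  rw [intTotal, intTotal, intTotal, ← Finset.sum_sub_distrib]
  refine Finset.sum_congr rfl fun n hn => ?_
  have h : k = n + (k - n) := by have := Finset.mem_range.1 hn; omega
  rw [intTerm_eq _ h, intTerm_eq _ h, intTerm_eq _ h, intPart, map_sub, map_sub]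
  rfl

/-- For a simplicial form the simplicial differential of the integral in column `n` is the boundary
term of Stokes' theorem in column `n + 1`. -/
theorem simplD_simplexInt {c : ∀ n, Form (prodD (mfdD (EE n) (EE n)) (nerveD Gd n)) k ℝ}
    (hc : IsSimplicialForm c) (n q : ℕ) (h : k = n + q) :
    simplD Gd n q (simplexInt n q h (c n)) =
      ∑ i : Fin (n + 2), (-1 : ℝ) ^ (i : ℕ) • simplexInt n q h (restrictFace i (c (n + 1))) := by
  refine (LinearMap.sum_apply _ _ _).trans (Finset.sum_congr rfl fun i _ => ?_)
  rw [hc n i]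
  exact congrArg ((-1 : ℝ) ^ (i : ℕ) • ·) (simplexInt_pullback h (face_smooth Gd i) (c n)).symm

/-- Column-by-column induction: the outgoing simplicial term of column `n` is the boundary term that
column `n + 1` of the integral of the exterior derivative requires, so one outgoing term remains at
each stage. -/
theorem sum_totD_intTerm {c : ∀ n, Form (prodD (mfdD (EE n) (EE n)) (nerveD Gd n)) k ℝ}
    (hc : IsSimplicialForm c) (n : ℕ) : ∀ (q : ℕ) (h : k = n + q),
    ∑ l ∈ Finset.range (n + 1), totD Gd (intTerm c l) =
      ∑ l ∈ Finset.range (n + 1), intTerm (fun n => extD (c n)) l +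
        totInc Gd (n + 1) q (simplD Gd n q (simplexInt n q h (c n))) := by
  induction n with
  | zero =>
    intro q h
    rw [Finset.sum_range_one, Finset.sum_range_one, intTerm_eq c h, intPart, totD_totInc,
      intTerm_eq _ (show k + 1 = 0 + (q + 1) by omega), intPart, pow_zero, one_smul]
    exact congrArg (fun x => totInc Gd 0 (q + 1) x + _)
      (simplexIntegral_zero_extD h _ (c 0)).symm
  | succ n ih =>
    intro q h
    have h' : k = n + (q + 1) := by omega
    rw [Finset.sum_range_succ, Finset.sum_range_succ _ (n + 1), ih (q + 1) h',
      intTerm_eq c h, intPart, totD_totInc,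
      intTerm_eq _ (show k + 1 = n + 1 + (q + 1) by omega), intPart]
    have hs : simplexInt (n + 1) (q + 1) (show k + 1 = n + 1 + (q + 1) by omega)
        (extD (c (n + 1))) = ∑ i : Fin (n + 2), (-1 : ℝ) ^ (i : ℕ) •
          simplexInt n (q + 1) h' (restrictFace i (c (n + 1))) +
        (-1 : ℝ) ^ (n + 1) • extD (simplexInt (n + 1) q h (c (n + 1))) :=
      simplexIntegral_succ_extD h' h _ (c (n + 1))
    rw [hs, map_add, map_smul, simplD_simplexInt hc n (q + 1) h']
    abel

/-- The integration of simplicial forms over the simplices is compatible with the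
differentials. -/
theorem totD_intTotal {c : ∀ n, Form (prodD (mfdD (EE n) (EE n)) (nerveD Gd n)) k ℝ}
    (hc : IsSimplicialForm c) : totD Gd (intTotal c) = intTotal (fun n => extD (c n)) := by
  -- The remaining outgoing term, from column `k`, is the extra column `k + 1` of the integral of
  -- the exterior derivative, by Stokes in fibre-top degree.
  rw [intTotal, map_sum, sum_totD_intTerm hc k 0 rfl, intTotal, Finset.sum_range_succ _ (k + 1),
    intTerm_eq _ (show k + 1 = k + 1 + 0 from rfl), simplD_simplexInt hc, intPart]
  exact congrArg (fun x => _ + totInc Gd (k + 1) 0 x)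
    (simplexIntegral_top_extD rfl rfl (c (k + 1))).symm

end SimplicialForms

/-! ### Local sections and gauge maps of principal bundles. -/

section PrincipalBundles

variable {E : Type*} [NormedAddCommGroup E] [NormedSpace ℝ E] [FiniteDimensional ℝ E]
  {G : Type*} [TopologicalSpace G] [ChartedSpace E G] [Group G] [LieGroup 𝓘(ℝ, E) ∞ G]
  {EN : Type*} [NormedAddCommGroup EN] [NormedSpace ℝ EN] [FiniteDimensional ℝ EN]
  {N : Type*} [TopologicalSpace N] [ChartedSpace EN N] [IsManifold 𝓘(ℝ, EN) ∞ N]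
  {EP : Type*} [NormedAddCommGroup EP] [NormedSpace ℝ EP] [FiniteDimensional ℝ EP]
  {P : Type*} [TopologicalSpace P] [ChartedSpace EP P] [IsManifold 𝓘(ℝ, EP) ∞ P]
  (B : PrincipalBundle E G EN N EP P) {m : ℕ}

/-- Compose with the local section `y ↦ ψ(y, 1)` of a trivialization, after a localizer has moved
the plot into its base. -/
theorem proj_locallyLifts : LocallyLifts (mfdD EP P) (mfdD EN N) B.proj := by
  intro m p hp x
  have hp : ContMDiff 𝓘(ℝ, EE m) 𝓘(ℝ, EN) ∞ p := hp
  obtain ⟨U, φ, ψ, hU, hx, -, hψ, h1, -, -⟩ := B.locally_trivial (p x)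
  obtain ⟨β, hβ, hβU, hβx⟩ := exists_localizer (hp.continuous.continuousAt.preimage_mem_nhds
    (hU.mem_nhds hx))
  refine ⟨fun y => ψ (p (β y), 1), ?_, ?_⟩
  · exact hψ.comp_contMDiff ((hp.comp hβ.contMDiff).prodMk contMDiff_const)
      fun y => ⟨hβU y, Set.mem_univ _⟩
  · filter_upwards [hβx] with y hy
    rw [(h1 _ (hβU y) 1).1, hy]

theorem act_injective (p : P) : Function.Injective (B.act p) := by
  intro g g' h
  obtain ⟨U, φ, ψ, hU, hx, -, -, -, -, h3⟩ := B.locally_trivial (B.proj p)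
  have := congrArg φ h
  rw [h3 p g hx, h3 p g' hx] at this
  exact mul_left_cancel this

theorem act_trivialization {U : Set N} {φ : P → G} {ψ : N × G → P}
    (h2 : ∀ p, B.proj p ∈ U → ψ (B.proj p, φ p) = p)
    (h3 : ∀ p g, B.proj p ∈ U → φ (B.act p g) = φ p * g) {p p' : P} (hp : B.proj p ∈ U)
    (h : B.proj p = B.proj p') : p' = B.act p ((φ p)⁻¹ * φ p') := by
  have hU : B.proj (B.act p ((φ p)⁻¹ * φ p')) ∈ U := by rwa [B.proj_act]
  rw [← h2 _ hU, h3 _ _ hp, B.proj_act, mul_inv_cancel_left, h, h2 p' (h ▸ hp)]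

/-- Two smooth families of points in the same fibres differ by a smooth gauge transformation. -/
theorem exists_gauge {q q' : EE m → P} (hq : ContMDiff 𝓘(ℝ, EE m) 𝓘(ℝ, EP) ∞ q)
    (hq' : ContMDiff 𝓘(ℝ, EE m) 𝓘(ℝ, EP) ∞ q') (h : ∀ y, B.proj (q y) = B.proj (q' y)) :
    ∃ g : EE m → G, ContMDiff 𝓘(ℝ, EE m) 𝓘(ℝ, E) ∞ g ∧ ∀ y, q' y = B.act (q y) (g y) := by
  have hex : ∀ y, ∃ g, q' y = B.act (q y) g := by
    intro y
    obtain ⟨U, φ, ψ, hU, hx, -, -, -, h2, h3⟩ := B.locally_trivial (B.proj (q y))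
    exact ⟨_, act_trivialization B h2 h3 hx (h y)⟩
  -- The group elements are chosen pointwise, but the action is free, so near each point `g` must be
  -- the smooth function `φ(q)⁻¹ φ(q')` of a trivialization.
  choose g hg using hex
  refine ⟨g, fun x => ?_, hg⟩
  obtain ⟨U, φ, ψ, hU, hx, hφ, -, -, h2, h3⟩ := B.locally_trivial (B.proj (q x))
  have hopen : IsOpen (B.proj ⁻¹' U) := hU.preimage B.proj_smooth.continuous
  have hx' : q' x ∈ B.proj ⁻¹' U := by
    change B.proj (q' x) ∈ U
    rwa [← h x]
  have h4 : ContMDiffAt 𝓘(ℝ, EE m) 𝓘(ℝ, E) ∞ (fun y => (φ (q y))⁻¹ * φ (q' y)) x :=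
    (((hφ.contMDiffAt (hopen.mem_nhds hx)).comp x hq.contMDiffAt).inv).mul
      ((hφ.contMDiffAt (hopen.mem_nhds hx')).comp x hq'.contMDiffAt)
  refine h4.congr_of_eventuallyEq ?_
  filter_upwards [hq.continuous.continuousAt.preimage_mem_nhds (hopen.mem_nhds hx)] with y hy
  exact act_injective B (q y) ((hg y).symm.trans (act_trivialization B h2 h3 hy (h y)))

end PrincipalBundles

/-! ### Gauge behaviour of affine combinations of connections. -/

section GaugeCombinations

variable {X Y : Type*} {D : DiffeologicalSpace X} {D' : DiffeologicalSpace Y}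
  {E : Type*} [NormedAddCommGroup E] [NormedSpace ℝ E] [FiniteDimensional ℝ E]
  {G : Type*} [TopologicalSpace G] [ChartedSpace E G] [Group G] [LieGroup 𝓘(ℝ, E) ∞ G]

/-- Affine combinations of connections have the same gauge transformations. -/
theorem GaugeRel.sum {ι : Type*} [Fintype ι] {h : ι → X → ℝ} (hh : ∀ i, Smooth D (mfdD ℝ ℝ) (h i))
    (hsum : ∀ x, ∑ i, h i x = 1) {A : ι → Form D 1 E} {m : ℕ} {q q' : D.plots m} {g : EE m → G}
    (hA : ∀ i, GaugeRel (A i) q q' g) (hq : ∀ i y, h i (q.1 y) = h i (q'.1 y)) :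
    GaugeRel (∑ i, fnMul (h i) (hh i) (A i)) q q' g := by
  intro x v
  refine (form_sum_apply _ _ q' x v).trans ?_
  refine Eq.trans ?_ (congrArg (fun a => Ad E (g x)⁻¹ a + leftDeriv E g x (v 0))
    (form_sum_apply Finset.univ (fun i => fnMul (h i) (hh i) (A i)) q x v)).symm
  have h1 : ∀ i, (fnMul (h i) (hh i) (A i)).1 m q' x v =
      h i (q.1 x) • Ad E (g x)⁻¹ ((A i).1 m q x v) + h i (q'.1 x) • leftDeriv E g x (v 0) := by
    intro i
    refine (congrArg (h i (q'.1 x) • ·) (hA i x v)).trans ?_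
    rw [smul_add, hq i x]
  refine (Finset.sum_congr rfl fun i _ => h1 i).trans ?_
  -- The inhomogeneous term `g⁻¹dg` is common to all summands, and the coefficients add up to `1`.
  rw [Finset.sum_add_distrib, ← Finset.sum_smul, hsum, one_smul, map_sum]
  congr 1
  refine Finset.sum_congr rfl fun i _ => ?_
  exact (map_smul (Ad E (g x)⁻¹) _ _).symm

theorem simplexForm_apply {n m : ℕ} {P Q : Type*} {DP : DiffeologicalSpace P}
    {DQ : DiffeologicalSpace Q} (v : Fin (n + 1) → Q → P)
    (hv : ∀ i, Smooth DQ DP (v i)) (θ : Form DP 1 E)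
    (p : (prodD (mfdD (EE n) (EE n)) DQ).plots m) (x : EE m) (u : Fin 1 → EE m) :
    (simplexForm v hv θ).1 m p x u = ∑ i, bary i (p.1 x).1 •
      θ.1 m ⟨fun y => v i (p.1 y).2, hv i m _ (mem_plots_prodD.1 p.2).2⟩ x u :=
  form_sum_apply _ _ p x u

end GaugeCombinations

/-! ### Lifts and gauge transformations on the nerve of the transformation groupoid. -/

section BundleNerves

variable {E : Type*} [NormedAddCommGroup E] [NormedSpace ℝ E] [FiniteDimensional ℝ E]
  {G : Type*} [TopologicalSpace G] [ChartedSpace E G] [Group G] [LieGroup 𝓘(ℝ, E) ∞ G]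
  {EΓ : Type*} [NormedAddCommGroup EΓ] [NormedSpace ℝ EΓ] [FiniteDimensional ℝ EΓ]
  {Γ : Type*} [TopologicalSpace Γ] [ChartedSpace EΓ Γ] [IsManifold 𝓘(ℝ, EΓ) ∞ Γ]
  {E₀ : Type*} [NormedAddCommGroup E₀] [NormedSpace ℝ E₀] [FiniteDimensional ℝ E₀]
  {Γ₀ : Type*} [TopologicalSpace Γ₀] [ChartedSpace E₀ Γ₀] [IsManifold 𝓘(ℝ, E₀) ∞ Γ₀]
  {Gd : LieGroupoid EΓ Γ E₀ Γ₀}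
  {EP : Type*} [NormedAddCommGroup EP] [NormedSpace ℝ EP] [FiniteDimensional ℝ EP]
  {P : Type*} [TopologicalSpace P] [ChartedSpace EP P] [IsManifold 𝓘(ℝ, EP) ∞ P]
  (B : GroupoidBundle E G Gd EP P)

theorem mem_plots_bundleNerveD {n m : ℕ} {p : EE m → BundleNerve B n} :
    p ∈ (bundleNerveD B n).plots m ↔ (fun x => (p x).1.1) ∈ (nerveD Gd n).plots m ∧
      ∀ i, ContMDiff 𝓘(ℝ, EE m) 𝓘(ℝ, EP) ∞ fun x => (p x).1.2 i :=
  mem_plots_prodD.trans (and_congr Iff.rfl mem_plots_piD)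

/-- The vertices in `P` of the lift of a string of arrows, determined by the last one. -/
def liftVertex {n m : ℕ} (s : (nerveD Gd n).plots m) (r : EE m → P)
    (hr : ContMDiff 𝓘(ℝ, EE m) 𝓘(ℝ, EP) ∞ r) (h : ∀ y, B.proj (r y) = (s.1 y).1.1 (Fin.last n))
    (i : Fin (n + 1)) : {f : EE m → P // ContMDiff 𝓘(ℝ, EE m) 𝓘(ℝ, EP) ∞ f ∧
      ∀ y, B.proj (f y) = (s.1 y).1.1 i} :=
  Fin.reverseInduction (motive := fun i => {f : EE m → P // ContMDiff 𝓘(ℝ, EE m) 𝓘(ℝ, EP) ∞ f ∧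
      ∀ y, B.proj (f y) = (s.1 y).1.1 i}) ⟨r, hr, h⟩
    (fun i f => ⟨fun y => B.gact ((s.1 y).1.2 i) (f.1 y),
      B.gact_smooth m _ _ (((mem_plots_nerveD Gd).1 s.2).2 i) f.2.1 fun y => by
        rw [f.2.2 y, ((s.1 y).2 i).2],
      fun y => by
        rw [B.proj_gact _ _ (by rw [f.2.2 y, ((s.1 y).2 i).2]), ((s.1 y).2 i).1]⟩) i

/-- A lift of the last vertex to `P` determines the whole string in `Qₙ`: the arrows act on it
backwards to give the other vertices. -/
theorem bundleNerveProj_locallyLifts (n : ℕ) :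
    LocallyLifts (bundleNerveD B n) (nerveD Gd n) (bundleNerveProj B n) := by
  intro m p hp x
  obtain ⟨r, hr, hrx⟩ := proj_locallyLifts B.toPrincipalBundle m _
    (((mem_plots_nerveD Gd).1 hp).1 (Fin.last n)) x
  obtain ⟨β, hβ, hβU, hβx⟩ := exists_localizer hrx
  let s : (nerveD Gd n).plots m := ⟨p ∘ β, (nerveD Gd n).plot_reparam hp hβ⟩
  have hrβ : ContMDiff 𝓘(ℝ, EE m) 𝓘(ℝ, EP) ∞ (r ∘ β) := ContMDiff.comp hr hβ.contMDiff
  let l := liftVertex B s (r ∘ β) hrβ fun y => hβU y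
  refine ⟨fun y => ⟨(p (β y), fun i => (l i).1 y), fun i => (l i).2.2 y, fun i => ?_⟩,
    (mem_plots_bundleNerveD B).2 ⟨s.2, fun i => (l i).2.1⟩, ?_⟩
  · have : l i.castSucc = _ := Fin.reverseInduction_castSucc i
    exact congrFun (congrArg Subtype.val this) y
  · filter_upwards [hβx] with y hy
    exact congrArg p hy

/-- The gauge map is found at the last vertex. As the arrows agree and the groupoid action commutes
with that of `G`, the same map relates all other vertices. -/
theorem exists_gauge_bundleNerve {n m : ℕ} {q q' : EE m → BundleNerve B n}
    (hq : q ∈ (bundleNerveD B n).plots m) (hq' : q' ∈ (bundleNerveD B n).plots m)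
    (h : ∀ y, bundleNerveProj B n (q y) = bundleNerveProj B n (q' y)) :
    ∃ g : EE m → G, ContMDiff 𝓘(ℝ, EE m) 𝓘(ℝ, E) ∞ g ∧
      ∀ i y, (q' y).1.2 i = B.act ((q y).1.2 i) (g y) := by
  obtain ⟨g, hg, hgq⟩ := exists_gauge B.toPrincipalBundle
    (((mem_plots_bundleNerveD B).1 hq).2 (Fin.last n))
    (((mem_plots_bundleNerveD B).1 hq').2 (Fin.last n)) fun y => by
      rw [(q y).2.1, (q' y).2.1]
      exact congrArg (fun s : Nerve Gd n => s.1.1 (Fin.last n)) (h y)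
  refine ⟨g, hg, fun i => ?_⟩
  induction i using Fin.reverseInduction with
  | last => exact hgq
  | cast i ih =>
    intro y
    rw [(q y).2.2 i, (q' y).2.2 i, ih y, ← B.gact_act]
    · exact congrArg (fun s : Nerve Gd n => B.gact (s.1.2 i) _) (h y).symm
    · rw [(q y).2.1, ((q y).1.1.2 i).2]

variable {B} {θ : Form (mfdD EP P) 1 E}

/-- `θ̃` is an affine combination, by barycentric coordinates, of the forms `pᵢ^* θ`, all of which
transform by the same `g`. -/
theorem gaugeRel_thetaTilde (hθ : IsConnection B.toPrincipalBundle θ) {n m : ℕ} {g : EE m → G}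
    (hg : ContMDiff 𝓘(ℝ, EE m) 𝓘(ℝ, E) ∞ g)
    (q q' : (prodD (mfdD (EE n) (EE n)) (bundleNerveD B n)).plots m)
    (h₁ : ∀ y, (q.1 y).1 = (q'.1 y).1)
    (h₂ : ∀ i y, (q'.1 y).2.1.2 i = B.act ((q.1 y).2.1.2 i) (g y)) :
    GaugeRel (thetaTilde B θ n) q q' g := by
  refine GaugeRel.sum (X := EE n × BundleNerve B n) (h := fun i => bary i ∘ Prod.fst)
    (A := fun i => pullback (bundleVertex B n i ∘ Prod.snd)
      (smooth_comp (bundleVertex_smooth B n i) (smooth_snd _ _)) θ)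
    (fun i => smooth_comp (bary_smooth i) (smooth_fst _ _))
    (fun x => sum_bary x.1) (fun i => ?_) fun i y => ?_
  · have hr := (mem_plots_bundleNerveD B).1 (mem_plots_prodD.1 q.2).2
    have hr' := (mem_plots_bundleNerveD B).1 (mem_plots_prodD.1 q'.2).2
    have he : (fun y => (q'.1 y).2.1.2 i) = fun y => B.act ((q.1 y).2.1.2 i) (g y) :=
      funext (h₂ i)
    have h1 := gaugeRel_act hθ ⟨fun y => (q.1 y).2.1.2 i, hr.2 i⟩ hg (he ▸ hr'.2 i)
    have h2 : (⟨_, hr'.2 i⟩ : (mfdD EP P).plots m) = ⟨_, he ▸ hr'.2 i⟩ := Subtype.ext he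
    intro x v
    exact (congrArg (fun r => θ.1 m r x v) h2).trans (h1 x v)
  · exact congrArg (bary i) (h₁ y)

theorem simplexProj_locallyLifts (B : GroupoidBundle E G Gd EP P) (n : ℕ) :
    LocallyLifts (prodD (mfdD (EE n) (EE n)) (bundleNerveD B n))
      (prodD (mfdD (EE n) (EE n)) (nerveD Gd n)) (simplexProj B n) :=
  (bundleNerveProj_locallyLifts B n).prodMap

theorem descends_chernForm_thetaTilde (hθ : IsConnection B.toPrincipalBundle θ) {k : ℕ}
    (f : InvPoly E G k) (n : ℕ) :
    Descends (simplexProj B n) (simplexProj_smooth B n) (chernForm G f (thetaTilde B θ n)) := by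
  refine descends_chernForm f _ (simplexProj_locallyLifts B n) fun m q q' h => ?_
  obtain ⟨g, hg, hgq⟩ := exists_gauge_bundleNerve B (mem_plots_prodD.1 q.2).2
    (mem_plots_prodD.1 q'.2).2 fun y => congrArg (fun z : EE n × Nerve Gd n => z.2) (h y)
  exact ⟨g, hg, gaugeRel_thetaTilde hθ hg q q'
    (fun y => congrArg (fun z : EE n × Nerve Gd n => z.1) (h y)) hgq⟩

end BundleNerves

/-! ### The Chern–Weil forms as a closed simplicial form; the cocycle property. -/

section BundleFaces

variable {E : Type*} [NormedAddCommGroup E] [NormedSpace ℝ E] [FiniteDimensional ℝ E]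
  {G : Type*} [TopologicalSpace G] [ChartedSpace E G] [Group G] [LieGroup 𝓘(ℝ, E) ∞ G]
  {EΓ : Type*} [NormedAddCommGroup EΓ] [NormedSpace ℝ EΓ] [FiniteDimensional ℝ EΓ]
  {Γ : Type*} [TopologicalSpace Γ] [ChartedSpace EΓ Γ] [IsManifold 𝓘(ℝ, EΓ) ∞ Γ]
  {E₀ : Type*} [NormedAddCommGroup E₀] [NormedSpace ℝ E₀] [FiniteDimensional ℝ E₀]
  {Γ₀ : Type*} [TopologicalSpace Γ₀] [ChartedSpace E₀ Γ₀] [IsManifold 𝓘(ℝ, E₀) ∞ Γ₀]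
  {Gd : LieGroupoid EΓ Γ E₀ Γ₀}
  {EP : Type*} [NormedAddCommGroup EP] [NormedSpace ℝ EP] [FiniteDimensional ℝ EP]
  {P : Type*} [TopologicalSpace P] [ChartedSpace EP P] [IsManifold 𝓘(ℝ, EP) ∞ P]
  (B : GroupoidBundle E G Gd EP P)

/-- The face maps of the nerve of the transformation groupoid. -/
def bundleFace {n : ℕ} (i : Fin (n + 2)) (s : BundleNerve B (n + 1)) : BundleNerve B n :=
  ⟨(face Gd i s.1.1, fun j => s.1.2 (i.succAbove j)), fun j => s.2.1 _, fun k => by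
    have h0 := s.2.2 k.castSucc
    have h1 := s.2.2 k.succ
    have g0 := s.1.1.2 k.castSucc
    have g1 := s.1.1.2 k.succ
    have hm : Gd.src (s.1.1.1.2 k.castSucc) = Gd.tgt (s.1.1.1.2 k.succ) := by
      rw [g0.2, g1.1, Fin.succ_castSucc]
    dsimp only [face]
    split_ifs with ha hb
    · have e0 : i.succAbove k.castSucc = k.castSucc.castSucc := by
        ext; simp only [Fin.succAbove, Fin.lt_def]; split_ifs <;> simp at * <;> omega
      have e1 : i.succAbove k.succ = k.castSucc.succ := by
        ext; simp only [Fin.succAbove, Fin.lt_def]; split_ifs <;> simp at * <;> omega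
      rw [e0, e1, h0]
    · have e0 : i.succAbove k.castSucc = k.castSucc.castSucc := by
        ext; simp only [Fin.succAbove, Fin.lt_def]; split_ifs <;> simp at * <;> omega
      have e1 : i.succAbove k.succ = k.succ.succ := by
        ext; simp only [Fin.succAbove, Fin.lt_def]; split_ifs <;> simp at * <;> omega
      rw [e0, e1, h0, B.mul_gact _ _ _ hm (by rw [g1.2, s.2.1]), ← h1, Fin.succ_castSucc]
    · have e0 : i.succAbove k.castSucc = k.succ.castSucc := by
        ext; simp only [Fin.succAbove, Fin.lt_def]; split_ifs <;> simp at * <;> omega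
      have e1 : i.succAbove k.succ = k.succ.succ := by
        ext; simp only [Fin.succAbove, Fin.lt_def]; split_ifs <;> simp at * <;> omega
      rw [e0, e1, h1]⟩

theorem bundleFace_smooth {n : ℕ} (i : Fin (n + 2)) :
    Smooth (bundleNerveD B (n + 1)) (bundleNerveD B n) (bundleFace B i) := fun m _ hp =>
  (mem_plots_bundleNerveD B).2 ⟨face_smooth Gd i m _ ((mem_plots_bundleNerveD B).1 hp).1,
    fun j => ((mem_plots_bundleNerveD B).1 hp).2 (i.succAbove j)⟩

/-- On the `i`-th face the coordinate of vertex `i` is zero, so its summand drops out; the remaining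
coordinates and vertices are re-indexed in the same way. -/
theorem restrictFace_thetaTilde (θ : Form (mfdD EP P) 1 E) {n : ℕ} (i : Fin (n + 2)) :
    restrictFace i (thetaTilde B θ (n + 1)) =
      pullback (Prod.map id (bundleFace B i)) (prodMap_id_smooth n (bundleFace_smooth B i))
        (thetaTilde B θ n) := by
  refine form_ext fun m p x v => ?_
  refine (simplexForm_apply (bundleVertex B (n + 1)) (bundleVertex_smooth B (n + 1)) θ
    ⟨Prod.map (coface i) id ∘ p.1, cofaceProd_smooth _ i m _ p.2⟩ x v).trans ?_
  refine Eq.trans ?_ (simplexForm_apply (bundleVertex B n) (bundleVertex_smooth B n) θ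
    ⟨Prod.map id (bundleFace B i) ∘ p.1,
      prodMap_id_smooth n (bundleFace_smooth B i) m _ p.2⟩ x v).symm
  rw [Fin.sum_univ_succAbove _ i]
  refine (congrArg₂ (· + ·) (congrArg (· • _) (bary_coface_self i _)) rfl).trans ?_
  rw [zero_smul, zero_add]
  refine Finset.sum_congr rfl fun j _ => ?_
  exact congrArg (· • _) (bary_coface_succAbove i j _)

/-- The form on `Δₙ × Γₙ` that `f(Ω̃)` is the pull-back of. -/
def chernSimplex (θ : Form (mfdD EP P) 1 E) {k : ℕ} (f : InvPoly E G k) (n : ℕ) :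
    Form (prodD (mfdD (EE n) (EE n)) (nerveD Gd n)) (k * 2) ℝ :=
  descend (simplexProj B n) (simplexProj_smooth B n) (chernForm G f (thetaTilde B θ n))

theorem zHom_eq (θ : Form (mfdD EP P) 1 E) {k : ℕ} (f : InvPoly E G k) :
    zHom B θ f = intTotal (chernSimplex B θ f) := integrateSimplices_eq _

variable {B} {θ : Form (mfdD EP P) 1 E} {k : ℕ}

theorem pullback_chernSimplex (hθ : IsConnection B.toPrincipalBundle θ) (f : InvPoly E G k)
    (n : ℕ) : pullback (simplexProj B n) (simplexProj_smooth B n) (chernSimplex B θ f n) =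
      chernForm G f (thetaTilde B θ n) :=
  pullback_descend (descends_chernForm_thetaTilde hθ f n)

theorem simplexProj_injective (n k : ℕ) : Function.Injective
    (pullback (k := k) (V := ℝ) (simplexProj B n) (simplexProj_smooth B n)) :=
  pullback_injective _ (simplexProj_locallyLifts B n)

theorem extD_chernSimplex (hθ : IsConnection B.toPrincipalBundle θ) (f : InvPoly E G k) (n : ℕ) :
    extD (chernSimplex B θ f n) = 0 := by
  refine simplexProj_injective (B := B) n _ ?_
  refine (pullback_extD (simplexProj_smooth B n) _).trans ?_
  exact ((congrArg extD (pullback_chernSimplex hθ f n)).trans (extD_chernForm f _)).trans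
    (map_zero _).symm

theorem restrictFace_chernForm {X : Type*} {D : DiffeologicalSpace X} {n : ℕ} (i : Fin (n + 2))
    (f : InvPoly E G k) (A : Form (prodD (mfdD (EE (n + 1)) (EE (n + 1))) D) 1 E) :
    restrictFace i (chernForm G f A) = chernForm G f (restrictFace i A) := rfl

/-- The identity is checked on `Δₙ × Qₙ₊₁`, where pull-back is injective and it reduces to that of
`θ̃`; face maps of `Qₙ₊₁` cover those of `Γₙ₊₁`. -/
theorem isSimplicialForm_chernSimplex (hθ : IsConnection B.toPrincipalBundle θ)
    (f : InvPoly E G k) : IsSimplicialForm (chernSimplex B θ f) := by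
  intro n i
  refine pullback_injective (prodMap_id_smooth n (bundleNerveProj_smooth B (n + 1)))
    ((bundleNerveProj_locallyLifts B (n + 1)).prodMap) ?_
  have h1 : restrictFace i (pullback (simplexProj B (n + 1)) (simplexProj_smooth B (n + 1))
      (chernSimplex B θ f (n + 1))) = pullback (Prod.map id (bundleFace B i))
        (prodMap_id_smooth n (bundleFace_smooth B i)) (pullback (simplexProj B n)
          (simplexProj_smooth B n) (chernSimplex B θ f n)) := by
    rw [pullback_chernSimplex hθ, pullback_chernSimplex hθ]
    rw [restrictFace_chernForm, restrictFace_thetaTilde]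
    exact (pullback_chernForm (prodMap_id_smooth n (bundleFace_smooth B i)) f _).symm
  exact h1

theorem intTotal_eq_zero {k : ℕ} {c : ∀ n, Form (prodD (mfdD (EE n) (EE n)) (nerveD Gd n)) k ℝ}
    (h : ∀ n, c n = 0) : intTotal c = 0 := by
  rw [intTotal]
  refine Finset.sum_eq_zero fun n hn => ?_
  have hk : k = n + (k - n) := by have := Finset.mem_range.1 hn; omega
  rw [intTerm_eq c hk, intPart, h, map_zero, map_zero]

/-- Integration is a chain map on simplicial forms, and the simplicial form here is closed. -/
theorem totD_zHom (hθ : IsConnection B.toPrincipalBundle θ) (f : InvPoly E G k) :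
    totD Gd (zHom B θ f) = 0 := by
  rw [zHom_eq, totD_intTotal (isSimplicialForm_chernSimplex hθ f)]
  exact intTotal_eq_zero fun n => extD_chernSimplex hθ f n

theorem totD_zMap (hθ : IsConnection B.toPrincipalBundle θ) (f : InvPolys E G) :
    totD Gd (zMap B θ f) = 0 := by
  rw [zMap, map_sum]
  exact Finset.sum_eq_zero fun k _ => totD_zHom hθ (f k)

end BundleFaces

/-! ### Interpolation between two connections. -/

section MixedForms

variable {X Y : Type*} {D : DiffeologicalSpace X} {D' : DiffeologicalSpace Y}
  {E : Type*} [NormedAddCommGroup E] [NormedSpace ℝ E] [FiniteDimensional ℝ E]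
  {G : Type*} [TopologicalSpace G] [ChartedSpace E G] [Group G] [LieGroup 𝓘(ℝ, E) ∞ G]

/-- The form `∑ₛ tₛ Aₛ` on `Δ₁ × X`. -/
def mixForm (A : Fin 2 → Form D 1 E) : Form (prodD (mfdD (EE 1) (EE 1)) D) 1 E :=
  ∑ s, fnMul (bary s ∘ Prod.fst) (smooth_comp (bary_smooth s) (smooth_fst _ _))
    (pullback Prod.snd (smooth_snd _ _) (A s))

theorem mixForm_apply (A : Fin 2 → Form D 1 E) {m : ℕ}
    (p : (prodD (mfdD (EE 1) (EE 1)) D).plots m) (x : EE m) (u : Fin 1 → EE m) :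
    (mixForm A).1 m p x u = ∑ s, bary s (p.1 x).1 •
      (A s).1 m ⟨fun y => (p.1 y).2, (mem_plots_prodD.1 p.2).2⟩ x u :=
  form_sum_apply _ _ p x u

theorem pullback_mixForm (A : Fin 2 → Form D 1 E) {g : Y → X} (hg : Smooth D' D g) :
    pullback (Prod.map id g) (prodMap_id_smooth 1 hg) (mixForm A) =
      mixForm fun s => pullback g hg (A s) :=
  form_ext fun m p x u => (mixForm_apply A ⟨_, prodMap_id_smooth 1 hg m _ p.2⟩ x u).trans
    (mixForm_apply (fun s => pullback g hg (A s)) p x u).symm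

/-- `coface i` is the vertex opposite to `i`, so `i = 0` gives `A 1` and `i = 1` gives `A 0`. -/
theorem pullback_vertex_mixForm (A : Fin 2 → Form D 1 E) (i : Fin 2) :
    pullback (Prod.mk (coface i 0)) (constProd_smooth D _) (mixForm A) =
      A (i.succAbove 0) := by
  refine form_ext fun m p x u => (mixForm_apply A ⟨_, constProd_smooth D _ m _ p.2⟩ x u).trans ?_
  rw [Fin.sum_univ_succAbove _ i]
  refine (congrArg₂ (· + ·) (congrArg (· • _) (bary_coface_self i _)) rfl).trans ?_
  rw [zero_smul, zero_add, Fin.sum_univ_one]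
  refine (congrArg (· • _) (bary_coface_succAbove i 0 _)).trans ?_
  simp [bary]

theorem GaugeRel.mix {A : Fin 2 → Form D 1 E} {m : ℕ}
    {q q' : (prodD (mfdD (EE 1) (EE 1)) D).plots m} {g : EE m → G}
    (h₁ : ∀ y, (q.1 y).1 = (q'.1 y).1)
    (hA : ∀ s, GaugeRel (A s) ⟨fun y => (q.1 y).2, (mem_plots_prodD.1 q.2).2⟩
      ⟨fun y => (q'.1 y).2, (mem_plots_prodD.1 q'.2).2⟩ g) : GaugeRel (mixForm A) q q' g :=
  GaugeRel.sum (h := fun s => bary s ∘ Prod.fst)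
    (A := fun s => pullback Prod.snd (smooth_snd _ _) (A s))
    (fun s => smooth_comp (bary_smooth s) (smooth_fst _ _))
    (fun x => sum_bary x.1) hA fun s y => congrArg (bary s) (h₁ y)

end MixedForms

/-! ### Homotopies obtained by integrating over the one-simplex. -/

section Homotopies

variable {EΓ : Type*} [NormedAddCommGroup EΓ] [NormedSpace ℝ EΓ] [FiniteDimensional ℝ EΓ]
  {Γ : Type*} [TopologicalSpace Γ] [ChartedSpace EΓ Γ] [IsManifold 𝓘(ℝ, EΓ) ∞ Γ]
  {E₀ : Type*} [NormedAddCommGroup E₀] [NormedSpace ℝ E₀] [FiniteDimensional ℝ E₀]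
  {Γ₀ : Type*} [TopologicalSpace Γ₀] [ChartedSpace E₀ Γ₀] [IsManifold 𝓘(ℝ, E₀) ∞ Γ₀]
  {Gd : LieGroupoid EΓ Γ E₀ Γ₀} {k q : ℕ}

/-- Stokes on `Δ₁` for a closed form: the exterior derivative of the fibre integral is the
difference of the restrictions to the two endpoints. -/
theorem extD_simplexInt_one {X : Type*} {D : DiffeologicalSpace X} {V : Type*}
    [NormedAddCommGroup V] [NormedSpace ℝ V] [FiniteDimensional ℝ V]
    {w : Form (prodD (mfdD (EE 1) (EE 1)) D) (q + 1) V} (hw : extD w = 0) :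
    extD (simplexInt 1 q (Nat.add_comm q 1) w) =
      pullback (Prod.mk (coface 0 0)) (constProd_smooth D _) w -
        pullback (Prod.mk (coface 1 0)) (constProd_smooth D _) w := by
  have h0 : q + 1 = 0 + (q + 1) := by omega
  have h := simplexIntegral_succ_extD (n := 0) (q := q) h0 (Nat.add_comm q 1)
    (show q + 1 + 1 = 0 + 1 + (q + 1) by omega) w
  have h1 : simplexIntegral (0 + 1) (q + 1) (castDeg (show q + 1 + 1 = 0 + 1 + (q + 1) by omega)
      (extD w)) = 0 := by
    rw [hw]
    exact map_zero (simplexInt (0 + 1) (q + 1) (show q + 1 + 1 = 0 + 1 + (q + 1) by omega))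
  rw [h1, Fin.sum_univ_two] at h
  have h2 : ∀ i : Fin 2, simplexIntegral 0 (q + 1) (castDeg h0 (restrictFace i w)) =
      pullback (Prod.mk (coface i 0)) (constProd_smooth D _) w := fun i =>
    simplexInt_zero h0 (restrictFace i w)
  rw [h2, h2] at h
  have h3 : (0 : Form D (q + 1) V) = pullback (Prod.mk (coface 0 0)) (constProd_smooth D _) w -
      pullback (Prod.mk (coface 1 0)) (constProd_smooth D _) w -
        extD (simplexInt 1 q (Nat.add_comm q 1) w) := by
    refine h.trans ?_
    simp only [Fin.val_zero, Fin.val_one, pow_zero, one_smul, zero_add, pow_one, neg_smul,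
      sub_eq_add_neg]
    rfl
  exact (sub_eq_zero.1 h3.symm).symm

/-- A closed simplicial form on `Δ₁ × Δₙ × Γₙ` gives a homotopy between the integrals of the
simplicial forms at its two ends. -/
theorem exists_totD_eq_sub (hk : k = q + 1)
    {e : ∀ n, Form (prodD (mfdD (EE 1) (EE 1)) (prodD (mfdD (EE n) (EE n)) (nerveD Gd n))) k ℝ}
    (he : ∀ n, extD (e n) = 0)
    (hs : ∀ (n : ℕ) (i : Fin (n + 2)),
      pullback (Prod.map id (Prod.map (coface i) id))
        (prodMap_id_smooth 1 (cofaceProd_smooth (nerveD Gd (n + 1)) i)) (e (n + 1)) =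
      pullback (Prod.map id (Prod.map id (face Gd i)))
        (prodMap_id_smooth 1 (prodMap_id_smooth n (face_smooth Gd i))) (e n)) :
    ∃ b, totD Gd b =
      intTotal (fun n => pullback (Prod.mk (coface 0 0)) (constProd_smooth _ _) (e n)) -
        intTotal (fun n => pullback (Prod.mk (coface 1 0)) (constProd_smooth _ _) (e n)) := by
  subst hk
  -- Integrating out `Δ₁` commutes with pull-back in the other factors, so the result is again a
  -- simplicial form, of degree one less; its total integral is the primitive.
  have hc : IsSimplicialForm fun n => simplexInt 1 q (Nat.add_comm q 1) (e n) := by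
    intro n i
    refine (simplexInt_pullback (Nat.add_comm q 1) (cofaceProd_smooth (nerveD Gd (n + 1)) i)
      (e (n + 1))).symm.trans ?_
    rw [hs]
    exact simplexInt_pullback (Nat.add_comm q 1) (prodMap_id_smooth n (face_smooth Gd i)) (e n)
  refine ⟨_, (totD_intTotal hc).trans ?_⟩
  rw [← intTotal_sub]
  exact congrArg intTotal (funext fun n => extD_simplexInt_one (he n))

end Homotopies

/-! ### Independence of the connection. -/

section Independence

variable {E : Type*} [NormedAddCommGroup E] [NormedSpace ℝ E] [FiniteDimensional ℝ E]
  {G : Type*} [TopologicalSpace G] [ChartedSpace E G] [Group G] [LieGroup 𝓘(ℝ, E) ∞ G]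
  {EΓ : Type*} [NormedAddCommGroup EΓ] [NormedSpace ℝ EΓ] [FiniteDimensional ℝ EΓ]
  {Γ : Type*} [TopologicalSpace Γ] [ChartedSpace EΓ Γ] [IsManifold 𝓘(ℝ, EΓ) ∞ Γ]
  {E₀ : Type*} [NormedAddCommGroup E₀] [NormedSpace ℝ E₀] [FiniteDimensional ℝ E₀]
  {Γ₀ : Type*} [TopologicalSpace Γ₀] [ChartedSpace E₀ Γ₀] [IsManifold 𝓘(ℝ, E₀) ∞ Γ₀]
  {Gd : LieGroupoid EΓ Γ E₀ Γ₀}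
  {EP : Type*} [NormedAddCommGroup EP] [NormedSpace ℝ EP] [FiniteDimensional ℝ EP]
  {P : Type*} [TopologicalSpace P] [ChartedSpace EP P] [IsManifold 𝓘(ℝ, EP) ∞ P]
  {B : GroupoidBundle E G Gd EP P} {k : ℕ}

theorem mixProj_locallyLifts (B : GroupoidBundle E G Gd EP P) (n : ℕ) :
    LocallyLifts (prodD (mfdD (EE 1) (EE 1)) (prodD (mfdD (EE n) (EE n)) (bundleNerveD B n)))
      (prodD (mfdD (EE 1) (EE 1)) (prodD (mfdD (EE n) (EE n)) (nerveD Gd n)))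
      (Prod.map id (simplexProj B n)) :=
  (simplexProj_locallyLifts B n).prodMap

/-- The form on `Δ₁ × Δₙ × Γₙ` whose pull-back is the Chern–Weil form of the connection
interpolating between two connections. -/
def chernMix (B : GroupoidBundle E G Gd EP P) (θ : Fin 2 → Form (mfdD EP P) 1 E)
    (f : InvPoly E G k) (n : ℕ) :
    Form (prodD (mfdD (EE 1) (EE 1)) (prodD (mfdD (EE n) (EE n)) (nerveD Gd n))) (k * 2) ℝ :=
  descend (Prod.map id (simplexProj B n)) (prodMap_id_smooth 1 (simplexProj_smooth B n))
    (chernForm G f (mixForm fun s => thetaTilde B (θ s) n))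

variable {θ : Fin 2 → Form (mfdD EP P) 1 E}

/-- The gauge map between two lifts depends only on the lifts and not on the connection, so it
serves both connections and their interpolation. -/
theorem pullback_chernMix (hθ : ∀ s, IsConnection B.toPrincipalBundle (θ s)) (f : InvPoly E G k)
    (n : ℕ) : pullback (Prod.map id (simplexProj B n))
      (prodMap_id_smooth 1 (simplexProj_smooth B n)) (chernMix B θ f n) =
        chernForm G f (mixForm fun s => thetaTilde B (θ s) n) := by
  refine pullback_descend (descends_chernForm f _ (mixProj_locallyLifts B n) fun m q q' h => ?_)
  have h' : ∀ y, simplexProj B n (q.1 y).2 = simplexProj B n (q'.1 y).2 := fun y =>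
    congrArg (fun z : EE 1 × EE n × Nerve Gd n => z.2) (h y)
  have hq := (mem_plots_prodD.1 q.2).2
  have hq' := (mem_plots_prodD.1 q'.2).2
  obtain ⟨g, hg, hgq⟩ := exists_gauge_bundleNerve B (mem_plots_prodD.1 hq).2
    (mem_plots_prodD.1 hq').2 fun y => congrArg (fun z : EE n × Nerve Gd n => z.2) (h' y)
  refine ⟨g, hg, GaugeRel.mix (fun y => congrArg (fun z : EE 1 × EE n × Nerve Gd n => z.1) (h y))
    fun s => gaugeRel_thetaTilde (hθ s) hg ⟨_, hq⟩ ⟨_, hq'⟩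
      (fun y => congrArg (fun z : EE n × Nerve Gd n => z.1) (h' y)) hgq⟩

theorem extD_chernMix (hθ : ∀ s, IsConnection B.toPrincipalBundle (θ s)) (f : InvPoly E G k)
    (n : ℕ) : extD (chernMix B θ f n) = 0 := by
  refine pullback_injective (prodMap_id_smooth 1 (simplexProj_smooth B n))
    (mixProj_locallyLifts B n) ?_
  refine (pullback_extD (prodMap_id_smooth 1 (simplexProj_smooth B n)) _).trans ?_
  exact ((congrArg extD (pullback_chernMix hθ f n)).trans (extD_chernForm f _)).trans
    (map_zero _).symm

theorem pullback_vertex_chernMix (hθ : ∀ s, IsConnection B.toPrincipalBundle (θ s))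
    (f : InvPoly E G k) (n : ℕ) (i : Fin 2) :
    pullback (Prod.mk (coface i 0)) (constProd_smooth _ _) (chernMix B θ f n) =
      chernSimplex B (θ (i.succAbove 0)) f n := by
  refine simplexProj_injective (B := B) n _ ?_
  rw [pullback_chernSimplex (hθ _)]
  have h1 : pullback (Prod.mk (coface i (0 : EE 0))) (constProd_smooth _ _)
      (pullback (Prod.map id (simplexProj B n)) (prodMap_id_smooth 1 (simplexProj_smooth B n))
        (chernMix B θ f n)) = chernForm G f (thetaTilde B (θ (i.succAbove 0)) n) := by
    rw [pullback_chernMix hθ, pullback_chernForm, pullback_vertex_mixForm]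
  exact h1

/-- Again checked upstairs: interpolation is natural under pull-back, and each `θ̃` is compatible
with faces. -/
theorem chernMix_simplicial (hθ : ∀ s, IsConnection B.toPrincipalBundle (θ s)) (f : InvPoly E G k)
    (n : ℕ) (i : Fin (n + 2)) : pullback (Prod.map id (Prod.map (coface i) id))
        (prodMap_id_smooth 1 (cofaceProd_smooth (nerveD Gd (n + 1)) i)) (chernMix B θ f (n + 1)) =
      pullback (Prod.map id (Prod.map id (face Gd i)))
        (prodMap_id_smooth 1 (prodMap_id_smooth n (face_smooth Gd i))) (chernMix B θ f n) := by
  refine pullback_injective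
    (prodMap_id_smooth 1 (prodMap_id_smooth n (bundleNerveProj_smooth B (n + 1))))
    ((bundleNerveProj_locallyLifts B (n + 1)).prodMap.prodMap) ?_
  have h1 : pullback (Prod.map id (Prod.map (coface i) id))
      (prodMap_id_smooth 1 (cofaceProd_smooth (bundleNerveD B (n + 1)) i))
      (pullback (Prod.map id (simplexProj B (n + 1)))
        (prodMap_id_smooth 1 (simplexProj_smooth B (n + 1))) (chernMix B θ f (n + 1))) =
      pullback (Prod.map id (Prod.map id (bundleFace B i)))
        (prodMap_id_smooth 1 (prodMap_id_smooth n (bundleFace_smooth B i)))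
        (pullback (Prod.map id (simplexProj B n))
          (prodMap_id_smooth 1 (simplexProj_smooth B n)) (chernMix B θ f n)) := by
    rw [pullback_chernMix hθ, pullback_chernMix hθ, pullback_chernForm, pullback_chernForm,
      pullback_mixForm _ (cofaceProd_smooth _ i),
      pullback_mixForm _ (prodMap_id_smooth n (bundleFace_smooth B i))]
    exact congrArg (fun A => chernForm G f (mixForm A))
      (funext fun s => restrictFace_thetaTilde B (θ s) i)
  exact h1

theorem chernForm_degree_zero {X : Type*} {D : DiffeologicalSpace X} (f : InvPoly E G 0)
    (A A' : Form D 1 E) : chernForm G f A = chernForm G f A' := by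
  refine form_ext fun m p x v => ?_
  refine (chernAlt_apply f.1 _ v).trans (Eq.trans ?_ (chernAlt_apply f.1 _ v).symm)
  refine congrArg _ (Finset.sum_congr rfl fun s _ => congrArg _ ?_)
  exact congrArg f.1 (Subsingleton.elim _ _)

theorem exists_totD_eq_zHom_sub (hθ : ∀ s, IsConnection B.toPrincipalBundle (θ s))
    (f : InvPoly E G k) : ∃ b, totD Gd b = zHom B (θ 1) f - zHom B (θ 0) f := by
  -- For degree zero the homotopy would have form degree `-1`. There the Chern–Weil form is a
  -- constant independent of the connection, so the cochains are equal.
  obtain _ | k := k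
  · refine ⟨0, ?_⟩
    have h : chernSimplex B (θ 1) f = chernSimplex B (θ 0) f := funext fun n =>
      congrArg (descend _ _) (chernForm_degree_zero f _ _)
    rw [zHom_eq, zHom_eq, h, sub_self, map_zero]
  · obtain ⟨b, hb⟩ := exists_totD_eq_sub (show (k + 1) * 2 = k * 2 + 1 + 1 by ring)
      (fun n => extD_chernMix hθ f n) (fun n i => chernMix_simplicial hθ f n i)
    refine ⟨b, hb.trans ?_⟩
    rw [zHom_eq, zHom_eq]
    exact congrArg₂ (fun c c' => intTotal c - intTotal c')
      (funext fun n => pullback_vertex_chernMix hθ f n 0)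
      (funext fun n => pullback_vertex_chernMix hθ f n 1)

theorem cohClass_eq_of_sub {C : Type*} [AddCommGroup C] [Module ℝ C] {d : C →ₗ[ℝ] C} {c c' : C}
    (hc : d c = 0) (hc' : d c' = 0) (h : ∃ b, d b = c - c') : cohClass d c = cohClass d c' := by
  unfold cohClass
  rw [dif_pos hc, dif_pos hc']
  refine (Submodule.Quotient.eq _).2 ?_
  obtain ⟨b, hb⟩ := h
  exact ⟨b, hb⟩

open Classical in
/-- The class `w_θ(f)` is independent of the connection. -/
theorem wMap_eq {θ₀ θ₁ : Form (mfdD EP P) 1 E} (h₀ : IsConnection B.toPrincipalBundle θ₀)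
    (h₁ : IsConnection B.toPrincipalBundle θ₁) (f : InvPolys E G) : wMap B θ₁ f = wMap B θ₀ f := by
  refine cohClass_eq_of_sub (totD_zMap h₁ f) (totD_zMap h₀ f) ?_
  have h : ∀ s, IsConnection B.toPrincipalBundle (![θ₀, θ₁] s) := by
    intro s
    fin_cases s
    · exact h₀
    · exact h₁
  choose b hb using fun k => exists_totD_eq_zHom_sub h (f k)
  refine ⟨∑ k ∈ DFinsupp.support f, b k, ?_⟩
  rw [map_sum, zMap, zMap, ← Finset.sum_sub_distrib]
  exact Finset.sum_congr rfl fun k _ => hb k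

end Independence

/-! ### Deformation retractions and cohomology. -/

section CohomologyEquiv

variable {C C' : Type*} [AddCommGroup C] [Module ℝ C] [AddCommGroup C'] [Module ℝ C']

/-- A deformation retraction of complexes induces an isomorphism on cohomology. -/
theorem exists_cohomology_equiv {d : C →ₗ[ℝ] C} {d' : C' →ₗ[ℝ] C'} {i : C →ₗ[ℝ] C'}
    {r : C' →ₗ[ℝ] C} {h : C' →ₗ[ℝ] C'} (hi : ∀ c, d' (i c) = i (d c))
    (hr : ∀ c, d (r c) = r (d' c)) (hri : ∀ c, r (i c) = c)
    (hh : ∀ c, d' (h c) + h (d' c) = c - i (r c)) :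
    ∃ Φ : Cohomology d ≃ₗ[ℝ] Cohomology d',
      ∀ c, d c = 0 → Φ (cohClass d c) = cohClass d' (i c) := by
  let I : LinearMap.ker d →ₗ[ℝ] LinearMap.ker d' := i.restrict fun c hc => by
    rw [LinearMap.mem_ker] at hc ⊢
    rw [hi, hc, map_zero]
  have hI : (LinearMap.range d).submoduleOf (LinearMap.ker d) ≤
      ((LinearMap.range d').submoduleOf (LinearMap.ker d')).comap I := by
    rintro c ⟨b, hb⟩
    exact ⟨i b, (hi b).trans (congrArg i hb)⟩
  let F : Cohomology d →ₗ[ℝ] Cohomology d' := Submodule.mapQ _ _ I hI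
  have hF : Function.Bijective F := by
    constructor
    · rw [← LinearMap.ker_eq_bot, LinearMap.ker_eq_bot']
      intro x hx
      obtain ⟨c, rfl⟩ := Submodule.Quotient.mk_surjective _ x
      have hx' : Submodule.Quotient.mk (I c) = (0 : Cohomology d') := hx
      obtain ⟨b, hb⟩ := (Submodule.Quotient.mk_eq_zero _).1 hx'
      refine (Submodule.Quotient.mk_eq_zero _).2 ⟨r b, ?_⟩
      -- Injectivity: if `i c = d' b`, then `c = r (i c) = d (r b)`.
      rw [hr, hb]
      exact hri c.1
    · intro x
      obtain ⟨c, rfl⟩ := Submodule.Quotient.mk_surjective _ x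
      have hc : d' c.1 = 0 := c.2
      have hrc : d (r c.1) = 0 := by rw [hr, hc, map_zero]
      refine ⟨Submodule.Quotient.mk ⟨r c.1, hrc⟩, ?_⟩
      change (Submodule.Quotient.mk (I ⟨r c.1, hrc⟩) : Cohomology d') = Submodule.Quotient.mk c
      refine (Submodule.Quotient.eq _).2 ?_
      -- Surjectivity: on a cocycle the homotopy identity reads `d' (h c) = c - i (r c)`, and the
      -- sign accounts for the order of the difference.
      refine ⟨-h c.1, ?_⟩
      have := hh c.1
      rw [hc, map_zero, add_zero] at this
      rw [map_neg, this, neg_sub]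
      rfl
  refine ⟨LinearEquiv.ofBijective F hF, fun c hc => ?_⟩
  have hic : d' (i c) = 0 := by rw [hi, hc, map_zero]
  unfold cohClass
  rw [dif_pos hc, dif_pos hic]
  rfl

end CohomologyEquiv

/-! ### The total complex of a manifold with only unit arrows. -/

section UnitGroupoid

variable {EM : Type*} [NormedAddCommGroup EM] [NormedSpace ℝ EM] [FiniteDimensional ℝ EM]
  {M : Type*} [TopologicalSpace M] [ChartedSpace EM M] [IsManifold 𝓘(ℝ, EM) ∞ M] {n q : ℕ}

variable (EM M) in
/-- The constant string at a point. -/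
def unitDiag (n : ℕ) (x : M) : Nerve (unitGroupoid EM M) n :=
  ⟨(fun _ => x, fun _ => x), fun _ => ⟨rfl, rfl⟩⟩

variable (EM M) in
theorem unitDiag_smooth (n : ℕ) :
    Smooth (mfdD EM M) (nerveD (unitGroupoid EM M) n) (unitDiag EM M n) := fun _ _ hp =>
  (mem_plots_nerveD _).2 ⟨fun _ => hp, fun _ => hp⟩

variable (EM M) in
/-- The first vertex of a string. -/
def unitVertex (n : ℕ) (s : Nerve (unitGroupoid EM M) n) : M := s.1.1 0

variable (EM M) in
theorem unitVertex_smooth (n : ℕ) :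
    Smooth (nerveD (unitGroupoid EM M) n) (mfdD EM M) (unitVertex EM M n) := fun _ _ hp =>
  ((mem_plots_nerveD _).1 hp).1 0

/-- Source and target of an arrow are the arrow itself, so consecutive vertices coincide and the
string is constant. -/
theorem unitDiag_unitVertex (s : Nerve (unitGroupoid EM M) n) :
    unitDiag EM M n (unitVertex EM M n s) = s := by
  have h0 : ∀ i, s.1.1 i = s.1.1 0 := by
    intro i
    induction i using Fin.induction with
    | zero => rfl
    | succ i ih => rw [← ih, ← (s.2 i).1, ← (s.2 i).2]; rfl
  refine Subtype.ext (Prod.ext (funext fun i => (h0 i).symm) (funext fun i => ?_))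
  exact ((s.2 i).1.trans (h0 _)).symm

theorem unitVertex_face (i : Fin (n + 2)) (s : Nerve (unitGroupoid EM M) (n + 1)) :
    unitVertex EM M n (face _ i s) = unitVertex EM M (n + 1) s := by
  obtain ⟨x, rfl⟩ : ∃ x, unitDiag EM M (n + 1) x = s := ⟨_, unitDiag_unitVertex s⟩
  rfl

/-- The form on `Mₙ` corresponding to a form on `M`. -/
def unitPull (n q : ℕ) : Form (mfdD EM M) q ℝ →ₗ[ℝ] Form (nerveD (unitGroupoid EM M) n) q ℝ :=
  pullback (unitVertex EM M n) (unitVertex_smooth EM M n)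

/-- The form on `M` corresponding to a form on `Mₙ`. -/
def unitRestrict (n q : ℕ) : Form (nerveD (unitGroupoid EM M) n) q ℝ →ₗ[ℝ] Form (mfdD EM M) q ℝ :=
  pullback (unitDiag EM M n) (unitDiag_smooth EM M n)

theorem unitPull_unitRestrict (w : Form (nerveD (unitGroupoid EM M) n) q ℝ) :
    unitPull n q (unitRestrict n q w) = w :=
  pullback_congr (g := id) (funext fun s => unitDiag_unitVertex s)
    (smooth_comp (unitDiag_smooth EM M n) (unitVertex_smooth EM M n)) (smooth_id _) w

theorem unitRestrict_unitPull (w : Form (mfdD EM M) q ℝ) :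
    unitRestrict n q (unitPull n q w) = w := rfl

/-- All `n + 2` faces pull `w` back to the same form, so only the alternating sum of `n + 2` signs
remains. -/
theorem simplD_unitPull (w : Form (mfdD EM M) q ℝ) :
    simplD (unitGroupoid EM M) n q (unitPull n q w) =
      (if Odd n then (1 : ℝ) else 0) • unitPull (n + 1) q w := by
  refine (LinearMap.sum_apply _ _ _).trans ?_
  have h : ∀ i : Fin (n + 2), pullback (face (unitGroupoid EM M) i) (face_smooth _ i)
      (unitPull n q w) = unitPull (n + 1) q w := fun i =>
    pullback_congr (funext fun s => unitVertex_face i s)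
      (smooth_comp (unitVertex_smooth EM M n) (face_smooth _ i)) (unitVertex_smooth EM M (n + 1)) w
  have h' : ∀ i : Fin (n + 2), ((-1 : ℝ) ^ (i : ℕ) • pullback (face (unitGroupoid EM M) i)
      (face_smooth _ i)) (unitPull n q w) = (-1 : ℝ) ^ (i : ℕ) • unitPull (n + 1) q w := fun i =>
    congrArg ((-1 : ℝ) ^ (i : ℕ) • ·) (h i)
  rw [Finset.sum_congr rfl fun i _ => h' i, ← Finset.sum_smul,
    Fin.sum_univ_eq_sum_range (fun i => (-1 : ℝ) ^ i) (n + 2), neg_one_geom_sum]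
  congr 1
  by_cases hn : Odd n
  · rw [if_pos hn, if_neg]
    rw [Nat.even_add, Nat.not_even_iff_odd.2 hn |> eq_false]
    simp
  · rw [if_neg hn, if_pos]
    exact (Nat.not_odd_iff_even.1 hn).add even_two

variable (EM M) in
/-- The projection of the total complex of `M ⇉ M` to the column `n = 0`. -/
def unitRetract : TotForm (unitGroupoid EM M) →ₗ[ℝ] DeRham (mfdD EM M) :=
  DirectSum.toModule ℝ (ℕ × ℕ) (DeRham (mfdD EM M)) fun a =>
    (if a.1 = 0 then (1 : ℝ) else 0) • (deRhamInc (mfdD EM M) a.2 ∘ₗ unitRestrict a.1 a.2)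

theorem unitRetract_totInc (w : Form (nerveD (unitGroupoid EM M) n) q ℝ) :
    unitRetract EM M (totInc _ n q w) =
      (if n = 0 then (1 : ℝ) else 0) • deRhamInc (mfdD EM M) q (unitRestrict n q w) :=
  DirectSum.toModule_lof (R := ℝ) (φ := fun a : ℕ × ℕ => (if a.1 = 0 then (1 : ℝ) else 0) •
    (deRhamInc (mfdD EM M) a.2 ∘ₗ unitRestrict a.1 a.2)) (n, q) w

variable (EM M) in
/-- The homotopy between the identity and the projection to the column `n = 0`. -/
def unitHomotopy : TotForm (unitGroupoid EM M) →ₗ[ℝ] TotForm (unitGroupoid EM M) :=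
  DirectSum.toModule ℝ (ℕ × ℕ) (TotForm (unitGroupoid EM M)) fun a =>
    -- Nonzero only on even columns `n ≥ 2`, where it inverts the simplicial differential. In column
    -- `0` the truncated difference `0 - 1 = 0` is even, so the homotopy vanishes there.
    (if Odd (a.1 - 1) then (1 : ℝ) else 0) •
      (totInc _ (a.1 - 1) a.2 ∘ₗ unitPull (a.1 - 1) a.2 ∘ₗ unitRestrict a.1 a.2)

theorem unitHomotopy_totInc (w : Form (nerveD (unitGroupoid EM M) n) q ℝ) :
    unitHomotopy EM M (totInc _ n q w) = (if Odd (n - 1) then (1 : ℝ) else 0) •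
      totInc _ (n - 1) q (unitPull (n - 1) q (unitRestrict n q w)) :=
  DirectSum.toModule_lof (R := ℝ) (φ := fun a : ℕ × ℕ => (if Odd (a.1 - 1) then (1 : ℝ) else 0) •
      (totInc _ (a.1 - 1) a.2 ∘ₗ unitPull (a.1 - 1) a.2 ∘ₗ unitRestrict a.1 a.2)) (n, q) w

theorem deRhamD_deRhamInc {X : Type*} {D : DiffeologicalSpace X} (w : Form D q ℝ) :
    deRhamD D (deRhamInc D q w) = deRhamInc D (q + 1) (extD w) :=
  DirectSum.toModule_lof (R := ℝ) (φ := fun k => deRhamInc D (k + 1) ∘ₗ extD) q w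

theorem columnZero_deRhamInc (w : Form (mfdD EM M) q ℝ) :
    columnZero (unitGroupoid EM M) (deRhamInc _ q w) = totInc _ 0 q (unitPull 0 q w) :=
  DirectSum.toModule_lof (R := ℝ) (φ := fun q => totInc (unitGroupoid EM M) 0 q ∘ₗ
    pullback (fun s : Nerve (unitGroupoid EM M) 0 => s.1.1 0) (nerveZero_smooth _)) q w

theorem deRham_hom_ext {X : Type*} {D : DiffeologicalSpace X} {C : Type*} [AddCommGroup C]
    [Module ℝ C] {F F' : DeRham D →ₗ[ℝ] C}
    (h : ∀ q (w : Form D q ℝ), F (deRhamInc D q w) = F' (deRhamInc D q w)) (c : DeRham D) :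
    F c = F' c :=
  LinearMap.congr_fun (DirectSum.linearMap_ext ℝ fun q => LinearMap.ext fun w => h q w) c

/-- Every form on `Mₙ` is pulled back from `M`, so linear maps out of the total complex need only be
compared on such forms. -/
theorem totForm_hom_ext {C : Type*} [AddCommGroup C]
    [Module ℝ C] {F F' : TotForm (unitGroupoid EM M) →ₗ[ℝ] C}
    (h : ∀ n q (w : Form (mfdD EM M) q ℝ), F (totInc _ n q (unitPull n q w)) =
      F' (totInc _ n q (unitPull n q w))) (c : TotForm (unitGroupoid EM M)) : F c = F' c :=
  LinearMap.congr_fun (DirectSum.linearMap_ext ℝ fun a => LinearMap.ext fun w => by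
    have := h a.1 a.2 (unitRestrict a.1 a.2 w)
    rwa [unitPull_unitRestrict] at this) c

theorem totD_unitPull (w : Form (mfdD EM M) q ℝ) :
    totD (unitGroupoid EM M) (totInc _ n q (unitPull n q w)) =
      (-1 : ℝ) ^ n • totInc _ n (q + 1) (unitPull n (q + 1) (extD w)) +
        (if Odd n then (1 : ℝ) else 0) • totInc _ (n + 1) q (unitPull (n + 1) q w) := by
  rw [totD_totInc, simplD_unitPull, map_smul]
  rfl

theorem totD_columnZero (c : DeRham (mfdD EM M)) :
    totD (unitGroupoid EM M) (columnZero _ c) = columnZero _ (deRhamD _ c) := by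
  refine deRham_hom_ext (F := totD (unitGroupoid EM M) ∘ₗ columnZero _)
    (F' := columnZero _ ∘ₗ deRhamD _) (fun q w => ?_) c
  rw [LinearMap.comp_apply, LinearMap.comp_apply, columnZero_deRhamInc, totD_unitPull,
    deRhamD_deRhamInc, columnZero_deRhamInc]
  simp

/-- The simplicial differential never lands in column zero, so projecting to that column is a chain
map. -/
theorem deRhamD_unitRetract (c : TotForm (unitGroupoid EM M)) :
    deRhamD _ (unitRetract EM M c) = unitRetract EM M (totD _ c) := by
  refine totForm_hom_ext (F := deRhamD _ ∘ₗ unitRetract EM M)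
    (F' := unitRetract EM M ∘ₗ totD _) (fun n q w => ?_) c
  rw [LinearMap.comp_apply, LinearMap.comp_apply, unitRetract_totInc, totD_unitPull, map_add,
    map_smul, map_smul, map_smul, unitRetract_totInc, unitRetract_totInc, deRhamD_deRhamInc,
    unitRestrict_unitPull, unitRestrict_unitPull]
  by_cases hn : n = 0
  · subst hn
    simp
  · simp [hn]

theorem unitRetract_columnZero (c : DeRham (mfdD EM M)) :
    unitRetract EM M (columnZero _ c) = c := by
  refine deRham_hom_ext (F := unitRetract EM M ∘ₗ columnZero _)
    (F' := LinearMap.id) (fun q w => ?_) c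
  rw [LinearMap.comp_apply, columnZero_deRhamInc, unitRetract_totInc, unitRestrict_unitPull]
  simp

theorem unitHomotopy_spec (c : TotForm (unitGroupoid EM M)) :
    totD _ (unitHomotopy EM M c) + unitHomotopy EM M (totD _ c) =
      c - columnZero _ (unitRetract EM M c) := by
  refine totForm_hom_ext (F := totD _ ∘ₗ unitHomotopy EM M + unitHomotopy EM M ∘ₗ totD _)
    (F' := LinearMap.id - columnZero _ ∘ₗ unitRetract EM M) (fun n q w => ?_) c
  rw [LinearMap.add_apply, LinearMap.sub_apply, LinearMap.comp_apply, LinearMap.comp_apply,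
    LinearMap.comp_apply, LinearMap.id_apply, unitHomotopy_totInc, totD_unitPull, map_add,
    map_smul, map_smul, map_smul, unitHomotopy_totInc, unitHomotopy_totInc, unitRetract_totInc,
    unitRestrict_unitPull, unitRestrict_unitPull, unitRestrict_unitPull, totD_unitPull, map_smul,
    columnZero_deRhamInc, Nat.add_sub_cancel]
  -- Column zero is fixed by the retraction. In column `n + 1` with `n` odd, the identity comes from
  -- the differential after the homotopy, and the two `d`-terms cancel by sign; with `n` even it
  -- comes from the homotopy after the simplicial differential.
  obtain _ | n := n
  · simp
  · rw [Nat.add_sub_cancel]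
    by_cases hn : Odd n
    · have h1 : ¬ Odd (n + 1) := by rw [Nat.odd_add_one]; simpa using hn
      simp [hn, h1, pow_succ, Odd.neg_one_pow hn]
    · have h1 : Odd (n + 1) := by rw [Nat.odd_add_one]; simpa using hn
      simp [hn, h1]

end UnitGroupoid

/-! ### Comparison with the classical Chern–Weil map. -/

section ClassicalMap

variable {E : Type*} [NormedAddCommGroup E] [NormedSpace ℝ E] [FiniteDimensional ℝ E]
  {G : Type*} [TopologicalSpace G] [ChartedSpace E G] [Group G] [LieGroup 𝓘(ℝ, E) ∞ G]
  {EM : Type*} [NormedAddCommGroup EM] [NormedSpace ℝ EM] [FiniteDimensional ℝ EM]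
  {M : Type*} [TopologicalSpace M] [ChartedSpace EM M] [IsManifold 𝓘(ℝ, EM) ∞ M]
  {EP : Type*} [NormedAddCommGroup EP] [NormedSpace ℝ EP] [FiniteDimensional ℝ EP]
  {P : Type*} [TopologicalSpace P] [ChartedSpace EP P] [IsManifold 𝓘(ℝ, EP) ∞ P] {k : ℕ}

theorem descends_classical {B : PrincipalBundle E G EM M EP P} {θ : Form (mfdD EP P) 1 E}
    (hθ : IsConnection B θ) (f : InvPoly E G k) :
    Descends B.proj (proj_dsmooth B) (chernForm G f θ) := by
  refine descends_chernForm f _ (proj_locallyLifts B) fun m q q' h => ?_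
  obtain ⟨g, hg, hgq⟩ := exists_gauge B q.2 q'.2 h
  have he : q'.1 = fun y => B.act (q.1 y) (g y) := funext hgq
  have h1 := gaugeRel_act hθ q hg (he ▸ q'.2)
  have h2 : q' = ⟨_, he ▸ q'.2⟩ := Subtype.ext he
  exact ⟨g, hg, fun x v => (congrArg (fun r => θ.1 m r x v) h2).trans (h1 x v)⟩

theorem extD_classical {B : PrincipalBundle E G EM M EP P} {θ : Form (mfdD EP P) 1 E}
    (hθ : IsConnection B θ) (f : InvPoly E G k) :
    extD (descend B.proj (proj_dsmooth B) (chernForm G f θ)) = 0 := by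
  refine pullback_injective (proj_dsmooth B) (proj_locallyLifts B) ?_
  refine (pullback_extD (proj_dsmooth B) _).trans ?_
  exact ((congrArg extD (pullback_descend (descends_classical hθ f))).trans
    (extD_chernForm f _)).trans (map_zero _).symm

theorem deRhamD_classicalForm {B : PrincipalBundle E G EM M EP P} {θ : Form (mfdD EP P) 1 E}
    (hθ : IsConnection B θ) (f : InvPolys E G) :
    deRhamD (mfdD EM M) (classicalForm B θ f) = 0 := by
  rw [classicalForm, map_sum]
  refine Finset.sum_eq_zero fun k _ => ?_
  rw [deRhamD_deRhamInc, extD_classical hθ, map_zero]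

variable (B : GroupoidBundle E G (unitGroupoid EM M) EP P) {θ : Form (mfdD EP P) 1 E}

/-- The point of `Q₀` over a point of `P`. -/
def bundlePoint (p : P) : BundleNerve B 0 :=
  ⟨(unitDiag EM M 0 (B.proj p), fun _ => p), fun _ => rfl, fun i => i.elim0⟩

theorem bundlePoint_smooth : Smooth (mfdD EP P) (bundleNerveD B 0) (bundlePoint B) :=
  fun m p hp => (mem_plots_bundleNerveD B).2
    ⟨unitDiag_smooth EM M 0 m _ (proj_dsmooth B.toPrincipalBundle m p hp), fun _ => hp⟩

/-- Over the point `Δ₀` the only barycentric coordinate is `1`, and `Q₀` is `P`. -/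
theorem pullback_thetaTilde_zero : pullback (bundlePoint B) (bundlePoint_smooth B)
    (pullback (Prod.mk 0) (constProd_smooth _ 0) (thetaTilde B θ 0)) = θ := by
  refine form_ext fun m p x v => (simplexForm_apply (bundleVertex B 0) (bundleVertex_smooth B 0) θ
    ⟨_, constProd_smooth _ 0 m _ (bundlePoint_smooth B m _ p.2)⟩ x v).trans ?_
  rw [Fin.sum_univ_one]
  refine (congrArg (· • _) (?_ : bary 0 (0 : EE 0) = 1)).trans (one_smul ℝ _)
  simp [bary]

variable {B}

/-- Only the summand `n = 0` survives, and integration over `Δ₀` is evaluation. The resulting form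
on `M` pulls back to `f(Ω)` on `P`, so it is the classical one by uniqueness. -/
theorem unitRetract_zHom (hθ : IsConnection B.toPrincipalBundle θ) (f : InvPoly E G k) :
    unitRetract EM M (zHom B θ f) = deRhamInc (mfdD EM M) (k * 2)
      (descend B.proj (proj_dsmooth B.toPrincipalBundle) (chernForm G f θ)) := by
  have h0 : k * 2 = 0 + k * 2 := by omega
  rw [zHom_eq, intTotal, map_sum, Finset.sum_eq_single 0]
  · rw [intTerm_eq _ h0, intPart, unitRetract_totInc, if_pos rfl, one_smul, simplexInt_zero]
    congr 1
    refine (descend_eq (proj_locallyLifts B.toPrincipalBundle) ?_).symm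
    have h : pullback (bundlePoint B) (bundlePoint_smooth B) (pullback (Prod.mk 0)
        (constProd_smooth _ 0) (pullback (simplexProj B 0) (simplexProj_smooth B 0)
          (chernSimplex B θ f 0))) = chernForm G f θ := by
      rw [pullback_chernSimplex hθ, pullback_chernForm, pullback_chernForm,
        pullback_thetaTilde_zero]
    exact h
  · intro n hn hn0
    have hk : k * 2 = n + (k * 2 - n) := by have := Finset.mem_range.1 hn; omega
    rw [intTerm_eq _ hk, intPart, unitRetract_totInc, if_neg hn0, zero_smul]
  · intro h
    exact absurd (Finset.mem_range.2 (Nat.succ_pos _)) h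

theorem unitRetract_zMap (hθ : IsConnection B.toPrincipalBundle θ) (f : InvPolys E G) :
    unitRetract EM M (zMap B θ f) = classicalForm B.toPrincipalBundle θ f := by
  rw [zMap, map_sum]
  exact Finset.sum_congr rfl fun k _ => unitRetract_zHom hθ (f k)

/-- For a cocycle `z` the homotopy identity exhibits `z - i (r z)` as a coboundary, and `r z` is the
classical form. -/
theorem totClass_columnZero_classicalForm (hθ : IsConnection B.toPrincipalBundle θ)
    (f : InvPolys E G) : wMap B θ f =
      totClass (unitGroupoid EM M) (columnZero _ (classicalForm B.toPrincipalBundle θ f)) := by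
  have hz := totD_zMap hθ f
  refine cohClass_eq_of_sub hz ?_ ⟨unitHomotopy EM M (zMap B θ f), ?_⟩
  · rw [totD_columnZero, deRhamD_classicalForm hθ, map_zero]
  · rw [← unitRetract_zMap hθ, ← unitHomotopy_spec, hz, map_zero, add_zero]

variable (EM M) in
/-- The inclusion of the column `n = 0` induces an isomorphism on cohomology. -/
theorem exists_columnZero_equiv :
    ∃ Φ : DeRhamCohomology (mfdD EM M) ≃ₗ[ℝ] TotCohomology (unitGroupoid EM M),
      ∀ c : DeRham (mfdD EM M), deRhamD (mfdD EM M) c = 0 →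
        Φ (deRhamClass (mfdD EM M) c) = totClass (unitGroupoid EM M) (columnZero _ c) :=
  exists_cohomology_equiv totD_columnZero deRhamD_unitRetract unitRetract_columnZero
    unitHomotopy_spec

end ClassicalMap

/-! ### Comparison with the Bott–Shulman map. -/

section BottShulmanMap

variable {E : Type*} [NormedAddCommGroup E] [NormedSpace ℝ E] [FiniteDimensional ℝ E]
  {G : Type*} [TopologicalSpace G] [ChartedSpace E G] [Group G] [LieGroup 𝓘(ℝ, E) ∞ G] {n k : ℕ}

variable (E G) in
/-- The string in the transformation groupoid `G × G ⇉ G` with given vertices. -/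
def universalString (n : ℕ) (g : Fin (n + 1) → G) : BundleNerve (groupBundle E G) n :=
  ⟨(universalProj E G n g, g), fun _ => rfl, fun _ => (inv_mul_cancel_right _ _).symm⟩

variable (E G) in
theorem universalString_smooth (n : ℕ) : Smooth (piD (Fin (n + 1)) (mfdD E G))
    (bundleNerveD (groupBundle E G) n) (universalString E G n) := fun m _ hp =>
  (mem_plots_bundleNerveD _).2 ⟨universalProj_smooth E G n m _ hp, mem_plots_piD.1 hp⟩

/-- The vertices of a local lift to `Qₙ` form a lift to `Gⁿ⁺¹`, since each arrow is recovered as `gᵢ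
gᵢ₊₁⁻¹`. -/
theorem universalProj_locallyLifts : LocallyLifts (piD (Fin (n + 1)) (mfdD E G))
    (nerveD (groupGroupoid E G) n) (universalProj E G n) := by
  intro m p hp x
  obtain ⟨q, hq, hqx⟩ := bundleNerveProj_locallyLifts (groupBundle E G) n m p hp x
  refine ⟨fun y => (q y).1.2, mem_plots_piD.2 ((mem_plots_bundleNerveD _).1 hq).2, ?_⟩
  filter_upwards [hqx] with y hy
  rw [← hy]
  refine Subtype.ext (Prod.ext (funext fun i => Subsingleton.elim _ _) (funext fun i => ?_))
  exact mul_inv_eq_of_eq_mul ((q y).2.2 i)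

theorem pullback_thetaTilde_universal :
    pullback (Prod.map id (universalString E G n))
      (prodMap_id_smooth n (universalString_smooth E G n))
      (thetaTilde (groupBundle E G) (maurerCartan E G) n) = universalConnection E G n :=
  form_ext fun m p x v => (simplexForm_apply (bundleVertex (groupBundle E G) n)
    (bundleVertex_smooth (groupBundle E G) n) (maurerCartan E G)
    ⟨_, prodMap_id_smooth n (universalString_smooth E G n) m _ p.2⟩ x v).trans
      (simplexForm_apply _ (fun i => smooth_eval _ i) (maurerCartan E G) p x v).symm

/-- The projection `Gⁿ⁺¹ → Gⁿ` factors through `Qₙ` by `universalString`, under which `θ̃` becomes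
the universal connection; so the form that `f(Ω̃)` descends to also solves the Bott–Shulman descent
problem. -/
theorem pullback_chernSimplex_universal (f : InvPoly E G k) :
    pullback (simplexUniversalProj E G n) (simplexUniversalProj_smooth E G n)
      (chernSimplex (groupBundle E G) (maurerCartan E G) f n) =
        chernForm G f (universalConnection E G n) := by
  have h : pullback (Prod.map id (universalString E G n))
      (prodMap_id_smooth n (universalString_smooth E G n))
      (pullback (simplexProj (groupBundle E G) n) (simplexProj_smooth (groupBundle E G) n)
        (chernSimplex (groupBundle E G) (maurerCartan E G) f n)) =
          chernForm G f (universalConnection E G n) := by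
    rw [pullback_chernSimplex (groupBundle_maurerCartan_isConnection), pullback_chernForm,
      pullback_thetaTilde_universal]
  exact h

theorem simplexUniversalProj_locallyLifts :
    LocallyLifts (prodD (mfdD (EE n) (EE n)) (piD (Fin (n + 1)) (mfdD E G)))
      (prodD (mfdD (EE n) (EE n)) (nerveD (groupGroupoid E G) n)) (simplexUniversalProj E G n) :=
  universalProj_locallyLifts.prodMap

theorem descends_universal (f : InvPoly E G k) (n : ℕ) :
    Descends (simplexUniversalProj E G n) (simplexUniversalProj_smooth E G n)
      (chernForm G f (universalConnection E G n)) :=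
  ⟨_, pullback_chernSimplex_universal f, fun _ h =>
    pullback_injective _ simplexUniversalProj_locallyLifts
      (h.trans (pullback_chernSimplex_universal f).symm)⟩

theorem zHom_maurerCartan (f : InvPoly E G k) :
    zHom (groupBundle E G) (maurerCartan E G) f = bottShulmanHom f :=
  congrArg integrateSimplices (funext fun _ =>
    (descend_eq simplexUniversalProj_locallyLifts (pullback_chernSimplex_universal f)).symm)

theorem zMap_maurerCartan (f : InvPolys E G) :
    zMap (groupBundle E G) (maurerCartan E G) f = bottShulmanForm f :=
  Finset.sum_congr rfl fun k _ => zHom_maurerCartan (f k)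

/-- On cochains the agreement holds for the Maurer–Cartan connection; on classes, independence
extends it to every connection. -/
theorem wMap_eq_bottShulmanMap {θ : Form (mfdD E G) 1 E}
    (hθ : IsConnection (groupBundle E G).toPrincipalBundle θ) (f : InvPolys E G) :
    wMap (groupBundle E G) θ f = bottShulmanMap f :=
  (wMap_eq (groupBundle_maurerCartan_isConnection) hθ f).trans
    (congrArg (totClass _) (zMap_maurerCartan f))

end BottShulmanMap

end ChernWeil

end

theorem theoremB (E : Type*) [NormedAddCommGroup E] [NormedSpace ℝ E] [FiniteDimensional ℝ E]
    (G : Type*) [TopologicalSpace G] [ChartedSpace E G] [Group G] [LieGroup 𝓘(ℝ, E) ∞ G] :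
    (∀ (EM : Type*) [NormedAddCommGroup EM] [NormedSpace ℝ EM] [FiniteDimensional ℝ EM]
        (M : Type*) [TopologicalSpace M] [ChartedSpace EM M] [IsManifold 𝓘(ℝ, EM) ∞ M]
        (EP : Type*) [NormedAddCommGroup EP] [NormedSpace ℝ EP] [FiniteDimensional ℝ EP]
        (P : Type*) [TopologicalSpace P] [ChartedSpace EP P] [IsManifold 𝓘(ℝ, EP) ∞ P]
        (B : GroupoidBundle E G (unitGroupoid EM M) EP P),
      (∀ θ : Form (mfdD EP P) 1 E, IsConnection B.toPrincipalBundle θ →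
        (∀ (k : ℕ) (f : InvPoly E G k),
          (∀ n, Descends (simplexProj B n) (simplexProj_smooth B n)
            (chernForm G f (thetaTilde B θ n))) ∧
          Descends B.proj (proj_dsmooth B.toPrincipalBundle) (chernForm G f θ)) ∧
        ∀ f : InvPolys E G, totD (unitGroupoid EM M) (zMap B θ f) = 0 ∧
          deRhamD (mfdD EM M) (classicalForm B.toPrincipalBundle θ f) = 0) ∧
      ∃ Φ : DeRhamCohomology (mfdD EM M) ≃ₗ[ℝ] TotCohomology (unitGroupoid EM M),
        (∀ c : DeRham (mfdD EM M), deRhamD (mfdD EM M) c = 0 →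
          totD (unitGroupoid EM M) (columnZero (unitGroupoid EM M) c) = 0 ∧
          Φ (deRhamClass (mfdD EM M) c) =
            totClass (unitGroupoid EM M) (columnZero (unitGroupoid EM M) c)) ∧
        ∀ θ θ' : Form (mfdD EP P) 1 E, IsConnection B.toPrincipalBundle θ →
          IsConnection B.toPrincipalBundle θ' → ∀ f : InvPolys E G,
            wMap B θ f = Φ (classicalMap B.toPrincipalBundle θ' f)) ∧
    IsConnection (groupBundle E G).toPrincipalBundle (maurerCartan E G) ∧
    (∀ (k : ℕ) (f : InvPoly E G k) (n : ℕ),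
      Descends (simplexProj (groupBundle E G) n) (simplexProj_smooth (groupBundle E G) n)
        (chernForm G f (thetaTilde (groupBundle E G) (maurerCartan E G) n)) ∧
      Descends (simplexUniversalProj E G n) (simplexUniversalProj_smooth E G n)
        (chernForm G f (universalConnection E G n))) ∧
    (∀ f : InvPolys E G,
      totD (groupGroupoid E G) (zMap (groupBundle E G) (maurerCartan E G) f) = 0 ∧
      zMap (groupBundle E G) (maurerCartan E G) f = bottShulmanForm f) ∧
    ∀ θ : Form (mfdD E G) 1 E, IsConnection (groupBundle E G).toPrincipalBundle θ →
      ∀ f : InvPolys E G, wMap (groupBundle E G) θ f = bottShulmanMap f := by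
  refine ⟨fun EM _ _ _ M _ _ _ EP _ _ _ P _ _ _ B => ⟨fun θ hθ => ⟨fun k f =>
    ⟨descends_chernForm_thetaTilde hθ f, descends_classical hθ f⟩, fun f =>
      ⟨totD_zMap hθ f, deRhamD_classicalForm hθ f⟩⟩, ?_⟩,
    groupBundle_maurerCartan_isConnection, fun k f n =>
      ⟨descends_chernForm_thetaTilde groupBundle_maurerCartan_isConnection f n,
        descends_universal f n⟩, fun f =>
      ⟨totD_zMap (groupBundle_maurerCartan_isConnection) f, zMap_maurerCartan f⟩,
    fun θ hθ f => wMap_eq_bottShulmanMap hθ f⟩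
  obtain ⟨Φ, hΦ⟩ := exists_columnZero_equiv EM M
  refine ⟨Φ, fun c hc => ⟨?_, hΦ c hc⟩, fun θ θ' hθ hθ' f => ?_⟩
  · rw [totD_columnZero, hc, map_zero]
  -- Replacing `θ` by `θ'` on the groupoid side reduces the comparison to a single connection.
  · rw [wMap_eq hθ' hθ, totClass_columnZero_classicalForm hθ']
    exact (hΦ _ (deRhamD_classicalForm hθ' f)).symm
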